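/- A graph on $n$ vertices is given by weights $w_{ij}=w_{ji}\ge 0$ for $i\ne j$ (and $w_{ii}=0$), not all zero; the value of a cut $x\in\{0,1\}^n$ is the fraction $\sum_{i<j,\,x_i\ne x_j}w_{ij}\big/\sum_{i<j}w_{ij}$ of the edge weight that it cuts, and $\mathrm{MaxCut}(G)$ is the largest value of a cut. A Boolean $t$-local pseudodistribution is a family $\mu=(\mu_S)$ of probability distributions $\mu_S$ on $\{0,1\}^S$, one for every $S\subseteq[n]$ with $|S|\le t$, such that for $S'\subseteq S$ the marginal of $\mu_S$ on $S'$ is $\mu_{S'}$. Its value on $G$ is $\sum_{i<j}w_{ij}\Pr_{\mu_{\{i,j\}}}[X_i\ne X_j]\big/\sum_{i<j}w_{ij}$, and $\mathrm{SA}_t(G)$ is the maximal value of a $t$-local pseudodistribution (the value of the degree-$t$ Sherali–Adams LP). The degree $n^\alpha$ is rounded down to an integer. **Theorem.** There is a universal constant $C>0$ such that for every $\alpha>0$, with $\varepsilon_\alpha=\exp(-C\max(1,1/\alpha^3))$ (so $\varepsilon_\alpha=\exp(-C/\alpha^3)$ for $\alpha\le 1$), there is $n_0=n_0(\alpha)$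 with the following properties. 1. If $G$ is a graph on $n\ge n_0$ vertices with $\mathrm{SA}_{n^\alpha}(G)\ge 1-\varepsilon_\alpha$, then $G$ has a cut of value at least $\tfrac12+\varepsilon_\alpha$. 2. There is a deterministic polynomial-time rounding algorithm for the degree-$n^\alpha$ Sherali–Adams LP that produces such a cut: a program, depending only on $\alpha$, for a random access machine with logarithmic (bit) cost, which receives $n$, the degree, and random access to the weights of a rationally weighted graph $G$ on $n$ vertices and to the entries $\mu_S(x)$, $|S|\le n^\alpha$, of a rational $\lfloor n^\alpha\rfloor$-local pseudodistribution $\mu$. It always halts, in time polynomial in $n$ and in the maximal bit length of these numbers (hence polynomial in the size of the LP solution); and if $n\ge n_0$ and the value of $\mu$ on $G$ is at least $1-\varepsilon_\alpha$, then it outputs a cut of $G$ of value at least $\tfrac12+\varepsilon_\alpha$. 3. Consequently, the degree-$n^\alpha$ Sherali–Adams LP value is a $(\tfrac12+\varepsilon_\alpha)$-approximation to Max-Cut: for every graph $G$ on $n\ge n_0$ vertices, $$\bigl(\tfrac12+\varepsilon_\alpha\bigr)\,\mathrm{SA}_{n^\alpha}(G)\ \le\ \mathrm{MaxCut}(G)\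 \le\ \mathrm{SA}_{n^\alpha}(G).$$ -/

import Mathlib

namespace SAMaxCut

noncomputable section

/-! ### Max-Cut instances -/

/-- A weighted, undirected, loopless graph on `n` vertices, with at least one edge of positive
weight. An unweighted graph is the case of weights in `{0, 1}`. -/
structure WeightedGraph (n : ℕ) where
  w : Fin n → Fin n → ℝ
  symm : ∀ i j, w i j = w j i
  loopless : ∀ i, w i i = 0
  nonneg : ∀ i j, 0 ≤ w i j
  total_pos : 0 < ∑ i, ∑ j, w i j

/-- The total weight (every edge is counted once in each direction). -/
def WeightedGraph.total {n : ℕ} (G : WeightedGraph n) : ℝ := ∑ i, ∑ j, G.w i j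

/-- The fraction of the edge weight that is cut by `x`. -/
def cutValue {n : ℕ} (G : WeightedGraph n) (x : Fin n → Bool) : ℝ :=
  (∑ i, ∑ j, if x i ≠ x j then G.w i j else 0) / G.total

/-- The Max-Cut value, normalized to lie in `[0, 1]`. -/
def maxCut {n : ℕ} (G : WeightedGraph n) : ℝ := ⨆ x : Fin n → Bool, cutValue G x

/-! ### The Sherali-Adams relaxation -/

/-- A family of functions `μ S` on the `{0,1}`-assignments to `S`, one for every set `S` of
variables. Only the members with `S.card ≤ t` are meaningful for degree `t`. -/
abbrev LocalFamily (n : ℕ) (K : Type) : Type := (S : Finset (Fin n)) → (S → Bool) → K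

/-- `μ` is a Boolean `t`-local pseudodistribution: every `μ S` with `|S| ≤ t` is a probability
distribution on assignments to `S`, and the marginal of `μ S` on `S' ⊆ S` is `μ S'`. -/
structure IsLocalPseudodistribution {n : ℕ} (t : ℕ) (μ : LocalFamily n ℝ) : Prop where
  nonneg : ∀ S : Finset (Fin n), S.card ≤ t → ∀ x, 0 ≤ μ S x
  sum_eq_one : ∀ S : Finset (Fin n), S.card ≤ t → ∑ x, μ S x = 1
  marginal : ∀ (S S' : Finset (Fin n)) (h : S' ⊆ S), S.card ≤ t → ∀ y : S' → Bool,
    (∑ x : S → Bool, if (fun i : S' => x ⟨i.1, h i.2⟩) = y then μ S x else 0) = μ S' y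

/-- The probability that `X i ≠ X j` under the local distribution on `{i, j}`. -/
def cutProb {n : ℕ} (μ : LocalFamily n ℝ) (i j : Fin n) : ℝ :=
  ∑ x : ({i, j} : Finset (Fin n)) → Bool,
    if x ⟨i, by simp⟩ ≠ x ⟨j, by simp⟩ then μ {i, j} x else 0

/-- The objective value of a local pseudodistribution for Max-Cut on `G`. -/
def objective {n : ℕ} (G : WeightedGraph n) (μ : LocalFamily n ℝ) : ℝ :=
  (∑ i, ∑ j, G.w i j * cutProb μ i j) / G.total

/-- The value of the degree-`t` Sherali-Adams relaxation of Max-Cut on `G`. -/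
def saValue {n : ℕ} (t : ℕ) (G : WeightedGraph n) : ℝ :=
  sSup {v | ∃ μ : LocalFamily n ℝ, IsLocalPseudodistribution t μ ∧ v = objective G μ}

/-- The degree `n ^ α`, rounded down. -/
def degree (α : ℝ) (n : ℕ) : ℕ := ⌊(n : ℝ) ^ α⌋₊

end

/-! ### A random access machine over `ℚ` with logarithmic cost

Programs are deterministic while-programs. The memory is an array of rationals with indirect
addressing. Every operation is charged one unit plus the bit length of the value it
produces (so all its operands have been paid for as well); hence the cost of a run is
polynomially related to its running time on a Turing machine. -/

/-- Number of bits of numerator and denominator. -/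
def bitSize (q : ℚ) : ℕ := Nat.size q.num.natAbs + Nat.size q.den

/-- Read-only input, accessed by the instructions `weight` and `query` below. -/
structure Input where
  weight : ℕ → ℕ → ℚ
  table : ℕ → ℚ

/-- Arithmetic expressions. `load e` is the content of the memory cell with address `e`;
`weight` and `query` access the input. Addresses and indices are rounded down to naturals. -/
inductive Expr where
  | const (q : ℚ)
  | load (e : Expr)
  | add (e₁ e₂ : Expr)
  | sub (e₁ e₂ : Expr)
  | mul (e₁ e₂ : Expr)
  | div (e₁ e₂ : Expr)
  | floor (e : Expr)
  | weight (e₁ e₂ : Expr)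
  | query (e : Expr)

/-- Memory contents. -/
abbrev Mem : Type := ℕ → ℚ

/-- The value of an expression. -/
def Expr.eval (I : Input) (σ : Mem) : Expr → ℚ
  | const q => q
  | load e => σ ⌊e.eval I σ⌋₊
  | add e₁ e₂ => e₁.eval I σ + e₂.eval I σ
  | sub e₁ e₂ => e₁.eval I σ - e₂.eval I σ
  | mul e₁ e₂ => e₁.eval I σ * e₂.eval I σ
  | div e₁ e₂ => e₁.eval I σ / e₂.eval I σ
  | floor e => (⌊e.eval I σ⌋ : ℤ)
  | weight e₁ e₂ => I.weight ⌊e₁.eval I σ⌋₊ ⌊e₂.eval I σ⌋₊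
  | query e => I.table ⌊e.eval I σ⌋₊

/-- The cost of evaluating an expression: each node of the expression tree costs one plus the bit
length of its value. -/
def Expr.cost (I : Input) (σ : Mem) : Expr → ℕ
  | const q => 1 + bitSize q
  | load e => e.cost I σ + (1 + bitSize ((load e).eval I σ))
  | add e₁ e₂ => e₁.cost I σ + e₂.cost I σ + (1 + bitSize ((add e₁ e₂).eval I σ))
  | sub e₁ e₂ => e₁.cost I σ + e₂.cost I σ + (1 + bitSize ((sub e₁ e₂).eval I σ))
  | mul e₁ e₂ => e₁.cost I σ + e₂.cost I σ + (1 + bitSize ((mul e₁ e₂).eval I σ))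
  | div e₁ e₂ => e₁.cost I σ + e₂.cost I σ + (1 + bitSize ((div e₁ e₂).eval I σ))
  | floor e => e.cost I σ + (1 + bitSize ((floor e).eval I σ))
  | weight e₁ e₂ => e₁.cost I σ + e₂.cost I σ + (1 + bitSize ((weight e₁ e₂).eval I σ))
  | query e => e.cost I σ + (1 + bitSize ((query e).eval I σ))

/-- Programs. `store a e` writes the value of `e` to the memory cell with address `a`; the
conditional and the loop test `e₁ < e₂`. -/
inductive Prog where
  | skip
  | store (a e : Expr)
  | seq (c₁ c₂ : Prog)
  | ite (e₁ e₂ : Expr) (c₁ c₂ : Prog)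
  | while (e₁ e₂ : Expr) (c : Prog)

/-- `Exec I c σ k σ'`: started with memory `σ`, the program `c` halts with memory `σ'`, at
total cost `k`. -/
inductive Exec (I : Input) : Prog → Mem → ℕ → Mem → Prop where
  | skip (σ : Mem) : Exec I .skip σ 1 σ
  | store (a e : Expr) (σ : Mem) :
      Exec I (.store a e) σ (1 + a.cost I σ + e.cost I σ)
        (Function.update σ ⌊a.eval I σ⌋₊ (e.eval I σ))
  | seq {c₁ c₂ : Prog} {σ σ₁ σ₂ : Mem} {k₁ k₂ : ℕ}
      (h₁ : Exec I c₁ σ k₁ σ₁) (h₂ : Exec I c₂ σ₁ k₂ σ₂) :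
      Exec I (.seq c₁ c₂) σ (k₁ + k₂) σ₂
  | ite_true {e₁ e₂ : Expr} {c₁ c₂ : Prog} {σ σ' : Mem} {k : ℕ}
      (h : e₁.eval I σ < e₂.eval I σ) (h₁ : Exec I c₁ σ k σ') :
      Exec I (.ite e₁ e₂ c₁ c₂) σ (1 + e₁.cost I σ + e₂.cost I σ + k) σ'
  | ite_false {e₁ e₂ : Expr} {c₁ c₂ : Prog} {σ σ' : Mem} {k : ℕ}
      (h : ¬ e₁.eval I σ < e₂.eval I σ) (h₂ : Exec I c₂ σ k σ') :
      Exec I (.ite e₁ e₂ c₁ c₂) σ (1 + e₁.cost I σ + e₂.cost I σ + k) σ'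
  | while_true {e₁ e₂ : Expr} {c : Prog} {σ σ₁ σ₂ : Mem} {k₁ k₂ : ℕ}
      (h : e₁.eval I σ < e₂.eval I σ) (h₁ : Exec I c σ k₁ σ₁)
      (h₂ : Exec I (.while e₁ e₂ c) σ₁ k₂ σ₂) :
      Exec I (.while e₁ e₂ c) σ (1 + e₁.cost I σ + e₂.cost I σ + k₁ + k₂) σ₂
  | while_false {e₁ e₂ : Expr} {c : Prog} {σ : Mem}
      (h : ¬ e₁.eval I σ < e₂.eval I σ) :
      Exec I (.while e₁ e₂ c) σ (1 + e₁.cost I σ + e₂.cost I σ) σ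

/-! ### Rounding algorithms: input and output conventions -/

/-- The variables that a natural number `c`, read in base three, mentions: digit `0` at place `i`
means that variable `i` is not mentioned. -/
def codeSet (n c : ℕ) : Finset (Fin n) :=
  Finset.univ.filter fun i => c / 3 ^ (i : ℕ) % 3 ≠ 0

/-- The values that `c` gives to the variables that it mentions: digit `1` means `false` and digit
`2` means `true`. -/
def codeAssignment (n c : ℕ) : codeSet n c → Bool :=
  fun i => decide (c / 3 ^ (i.1 : ℕ) % 3 = 2)

/-- The input of a rounding algorithm for the degree-`t` relaxation: the edge weights, and the
entries `μ S x` with `|S| ≤ t` of a solution. -/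
def roundingInput {n : ℕ} (t : ℕ) (w : Fin n → Fin n → ℚ) (μ : LocalFamily n ℚ) : Input where
  weight i j := if h : i < n ∧ j < n then w ⟨i, h.1⟩ ⟨j, h.2⟩ else 0
  table c := if (codeSet n c).card ≤ t then μ (codeSet n c) (codeAssignment n c) else 0

/-- At the start, cell `0` holds `n`, cell `1` holds the degree `t`, and all others hold `0`. -/
def initialMem (n t : ℕ) : Mem :=
  fun a => if a = 0 then (n : ℚ) else if a = 1 then (t : ℚ) else 0

/-- At the end, cell `i` tells on which side of the cut vertex `i` lies. -/
def outputCut (n : ℕ) (σ : Mem) : Fin n → Bool := fun i => decide (σ i ≠ 0)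

/-- The real family underlying a rational one. -/
noncomputable def LocalFamily.toReal {n : ℕ} (μ : LocalFamily n ℚ) : LocalFamily n ℝ :=
  fun S x => (μ S x : ℝ)

/-- All edge weights, and all entries of degree at most `t` of `μ`, have bit length at most `B`. -/
def BitBound {n : ℕ} (t : ℕ) (w : Fin n → Fin n → ℚ) (μ : LocalFamily n ℚ) (B : ℕ) : Prop :=
  (∀ i j, bitSize (w i j) ≤ B) ∧
    ∀ S : Finset (Fin n), S.card ≤ t → ∀ x, bitSize (μ S x) ≤ B

/-- The program `c` is a polynomial-time rounding algorithm for the degree-`n ^ α` Sherali-Adams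
relaxation of Max-Cut: on every graph with rational weights and every rational feasible solution, it
halts at a cost polynomial in the number of vertices and the bit length of the numbers in the
input; and if there are at least `n₀` vertices and the solution has value at least `1 - ε`, then
it outputs a cut of value at least `1 / 2 + ε`. -/
def IsPolyTimeRounding (α ε : ℝ) (n₀ : ℕ) (c : Prog) : Prop :=
  ∃ p : Polynomial ℕ, ∀ (n : ℕ) (G : WeightedGraph n) (w : Fin n → Fin n → ℚ)
    (μ : LocalFamily n ℚ) (B : ℕ),
    (∀ i j, G.w i j = (w i j : ℝ)) →
    IsLocalPseudodistribution (degree α n) μ.toReal →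
    BitBound (degree α n) w μ B →
    ∃ (k : ℕ) (σ : Mem),
      Exec (roundingInput (degree α n) w μ) c (initialMem n (degree α n)) k σ ∧
      k ≤ p.eval (n + B) ∧
      (n₀ ≤ n → 1 - ε ≤ objective G μ.toReal → 1 / 2 + ε ≤ cutValue G (outputCut n σ))

end SAMaxCut

open SAMaxCut

set_option linter.unusedSectionVars false

/-! Write `M i j = 1 - 2 * cutProb μ i j` for the correlation of two signs. The only feature of the
pseudodistribution that matters is that `M` has unit diagonal and is positive semidefinite on every
set of at most `t` vertices (`isLocalCorrelation`).

For a weighted graph `a` of total weight `T`, consider the signed lazy walk `P = (1 - D⁻¹A)/2`, and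
let `ρ k` be the correlation between the ends of a `k`-step walk, weighted by degree (`walkCorr`).
Then `ρ 1` is the value of the relaxation times `T`. Replacing the `k`-step distribution by `m < t`
random samples makes local positivity applicable, and a second moment argument gives `ρ k ^ 2 ≤ T *
(ρ (2k) + 2T/m)` (`IsLocalCorrelation.sq_sum_le`, `walkCorr_sq_le`). Repeated doubling shows that `ρ
L ≥ T (1 - 2ε)^L` as long as the sampling error `2/m`, of order `n^(-α)`, stays negligible against
`ε (1 - 2ε)^L`. For `L` of order `log n` this needs only that `ε` is at most a small multiple of
`min 1 α`.

Conversely `|M| ≤ 1` gives `ρ L ^ 2 ≤ n T ∑ i ‖P^L e_i‖²`. If every column lost a factor `31/32` in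
every step, the right side would be too small once `L` is a large multiple of `log n`. So for some
start `i` and some `k < L` the function `f = P^k e_i` is hardly contracted by `P`, which says that
`∑ a_jl (f_j + f_l)²` is small compared with `∑ d_j f_j²` (`exists_colNorm_succ`, `energy_lt`). A
bipartite Cheeger argument then finds a threshold at which the signs of `f` form a partial cut whose
surplus of cut over uncut weight is at least half of its volume (`exists_goodCut_sweep`).

Such partial cuts are accumulated. Each is glued to the previous ones with the sign for which the
crossing edges do no harm, and the search is repeated on the vertices still open. While half of the
weight is open, the open part inherits value `1 - 2ε`. When less is open, the invariant `IsAhead`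
turns the surplus into a cut of value at least `9/16`, and the remaining vertices are placed
greedily. Thus a gap linear in `min 1 α` would suffice; `exp (-C/α³)` is far below it
(`exp_neg_mul_max_le`).

The algorithm tries all starts, all lengths `k < n` and all thresholds. It never reads the
pseudodistribution, whose existence merely guarantees that some candidate succeeds. To control bit
lengths, weights are rounded to integers of size at most `n³`, and the walk is multiplied by powers
of a common multiple of the degrees. The program is written in a small loop language in which
oversized values are clipped, so that polynomial running time is automatic; correctness amounts to
showing that clipping never happens. -/

namespace SAMaxCut

/-! ### Local correlations -/

section Correlation

variable {V : Type*} [Fintype V] [DecidableEq V]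

/-- A symmetric matrix with unit diagonal all of whose principal submatrices of size at most `t` are
positive semidefinite. -/
structure IsLocalCorrelation (t : ℕ) (M : V → V → ℝ) : Prop where
  symm : ∀ i j, M i j = M j i
  diag : ∀ i, M i i = 1
  psd : ∀ S : Finset V, S.card ≤ t → ∀ c : V → ℝ, 0 ≤ ∑ i ∈ S, ∑ j ∈ S, c i * c j * M i j

/-- Random samples may repeat. Adding up the coefficients of equal vertices reduces a family to its
image, which is no larger. -/
theorem IsLocalCorrelation.psd_family {t : ℕ} {M : V → V → ℝ} (hM : IsLocalCorrelation t M)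
    {ι : Type*} [Fintype ι] (hι : Fintype.card ι ≤ t) (J : ι → V) (c : ι → ℝ) :
    0 ≤ ∑ a, ∑ b, c a * c b * M (J a) (J b) := by
  classical
  have hcard : (Finset.univ.image J).card ≤ t := Finset.card_image_le.trans hι
  have h := hM.psd _ hcard (fun v => ∑ a, if J a = v then c a else 0)
  have key : ∀ g : V → ℝ, ∑ i ∈ Finset.univ.image J, (∑ a, if J a = i then c a else 0) * g i
      = ∑ a, c a * g (J a) := by
    intro g
    simp_rw [Finset.sum_mul]
    rw [Finset.sum_comm]
    refine Finset.sum_congr rfl fun a _ => ?_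
    rw [Finset.sum_eq_single (J a)]
    · simp
    · intro b _ hb
      rw [if_neg (Ne.symm hb), zero_mul]
    · intro h
      exact absurd (Finset.mem_image_of_mem J (Finset.mem_univ a)) h
  have e : ∑ i ∈ Finset.univ.image J, ∑ j ∈ Finset.univ.image J,
      (∑ a, if J a = i then c a else 0) * (∑ a, if J a = j then c a else 0) * M i j
      = ∑ a, ∑ b, c a * c b * M (J a) (J b) := by
    calc _ = ∑ i ∈ Finset.univ.image J, (∑ a, if J a = i then c a else 0) *
          ∑ j ∈ Finset.univ.image J, (∑ a, if J a = j then c a else 0) * M i j := by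
          refine Finset.sum_congr rfl fun i _ => ?_
          rw [Finset.mul_sum]
          exact Finset.sum_congr rfl fun j _ => by ring
      _ = ∑ a, c a * ∑ j ∈ Finset.univ.image J, (∑ a, if J a = j then c a else 0) * M (J a) j :=
          key _
      _ = _ := by
          refine Finset.sum_congr rfl fun a _ => ?_
          rw [key, Finset.mul_sum]
          exact Finset.sum_congr rfl fun j _ => by ring
  rwa [e] at h

theorem IsLocalCorrelation.abs_le_one {t : ℕ} {M : V → V → ℝ} (hM : IsLocalCorrelation t M)
    (ht : 2 ≤ t) (i j : V) : |M i j| ≤ 1 := by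
  have h1 := hM.psd_family (ι := Fin 2) (by simpa using ht) ![i, j] ![1, 1]
  have h2 := hM.psd_family (ι := Fin 2) (by simpa using ht) ![i, j] ![1, -1]
  simp only [Fin.sum_univ_two, Matrix.cons_val_zero, Matrix.cons_val_one, hM.diag, hM.symm j i]
    at h1 h2
  rw [abs_le]
  constructor <;> linarith

/-- The weights `∏ c, p (J c)` describe `m` independent samples from `p`; distinct samples are
independent because the sum over `J` factorizes over the coordinates. -/
theorem sum_prod_mul_apply_mul_apply {m : ℕ} {p : V → ℝ} (hp : ∑ j, p j = 1) {a b : Fin m}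
    (hab : a ≠ b) (h g : V → ℝ) :
    ∑ J : Fin m → V, (∏ c, p (J c)) * (h (J a) * g (J b)) = (∑ j, p j * h j) * ∑ j, p j * g j := by
  have e : ∀ J : Fin m → V, (∏ c, p (J c)) * (h (J a) * g (J b)) =
      ∏ c, p (J c) * ((if c = a then h (J c) else 1) * (if c = b then g (J c) else 1)) := by
    intro J
    rw [Finset.prod_mul_distrib, Finset.prod_mul_distrib]
    simp
  simp_rw [e]
  rw [← Fintype.piFinset_univ, ← Finset.prod_univ_sum (fun _ => Finset.univ)
    (fun c j => p j * ((if c = a then h j else 1) * (if c = b then g j else 1))),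
    Finset.prod_eq_mul a b hab]
  · simp [hab, hab.symm]
  · intro c _ hc
    simp [hc.1, hc.2, hp]
  · simp
  · simp

theorem sum_prod_mul_apply {m : ℕ} {p : V → ℝ} (hp : ∑ j, p j = 1) (a : Fin m) (h : V → ℝ) :
    ∑ J : Fin m → V, (∏ c, p (J c)) * h (J a) = ∑ j, p j * h j := by
  have e : ∀ J : Fin m → V, (∏ c, p (J c)) * h (J a) =
      ∏ c, p (J c) * (if c = a then h (J c) else 1) := by
    intro J
    rw [Finset.prod_mul_distrib]
    simp
  simp_rw [e]
  rw [← Fintype.piFinset_univ, ← Finset.prod_univ_sum (fun _ => Finset.univ)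
    (fun c j => p j * (if c = a then h j else 1)), Finset.prod_eq_single a]
  · simp
  · intro c _ hc
    simp [hc, hp]
  · simp

theorem sum_prod_mul_apply₂ {m : ℕ} {p : V → ℝ} (hp : ∑ j, p j = 1) {a b : Fin m}
    (hab : a ≠ b) (G : V → V → ℝ) :
    ∑ J : Fin m → V, (∏ c, p (J c)) * G (J a) (J b) = ∑ j, ∑ l, p j * p l * G j l := by
  have e : ∀ J : Fin m → V, (∏ c, p (J c)) * G (J a) (J b) =
      ∑ u, (∏ c, p (J c)) * ((if J a = u then 1 else 0) * G u (J b)) := by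
    intro J
    simp
  simp_rw [e]
  rw [Finset.sum_comm]
  refine Finset.sum_congr rfl fun u _ => ?_
  rw [sum_prod_mul_apply_mul_apply hp hab (fun j => if j = u then 1 else 0) (G u)]
  simp [Finset.mul_sum, mul_assoc]

/-- Second moment method with `m` independent samples. -/
theorem IsLocalCorrelation.sq_sum_le {t m : ℕ} {M : V → V → ℝ} (hM : IsLocalCorrelation t M)
    (hm : 1 ≤ m) (hmt : m + 1 ≤ t) (i : V) (κ : V → ℝ) (hκ : ∑ j, |κ j| ≤ 1) :
    (∑ j, κ j * M i j) ^ 2 ≤ (∑ j, ∑ l, κ j * κ l * M j l) + 2 / m := by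
  obtain ⟨p, hp0, hp, σ, hσ, hpσ⟩ : ∃ p : V → ℝ, (∀ j, 0 ≤ p j) ∧ ∑ j, p j = 1 ∧
      ∃ σ : V → ℝ, (∀ j, σ j * σ j ≤ 1) ∧ ∀ j, κ j = p j * σ j := by
    -- The mass that `|κ|` lacks is placed at `i`, where the ratio `κ / p` then shrinks in absolute
    -- value; so `κ = p * σ` with a probability vector `p` and `|σ| ≤ 1`.
    let p : V → ℝ := fun j => |κ j| + if j = i then 1 - ∑ j, |κ j| else 0
    have hle : ∀ j, |κ j| ≤ p j := by
      intro j
      simp only [p]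
      split_ifs <;> linarith
    refine ⟨p, fun j => (abs_nonneg _).trans (hle j), ?_, fun j => κ j / p j, ?_, ?_⟩
    · simp [p, Finset.sum_add_distrib]
    · intro j
      have : |κ j / p j| ≤ 1 := by
        rw [abs_div, abs_of_nonneg ((abs_nonneg _).trans (hle j))]
        exact div_le_one_of_le₀ (hle j) ((abs_nonneg _).trans (hle j))
      nlinarith [abs_mul_abs_self (κ j / p j), abs_nonneg (κ j / p j)]
    · intro j
      by_cases h : p j = 0
      · have := hle j
        rw [h] at this
        have : κ j = 0 := abs_eq_zero.1 (le_antisymm this (abs_nonneg _))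
        simp [this]
      · field_simp
  set γ := ∑ j, κ j * M i j with hγ
  set q := ∑ j, ∑ l, κ j * κ l * M j l with hq
  have hm0 : (0 : ℝ) < m := by exact_mod_cast hm
  -- Local positivity on the `m + 1` vertices `i, J 0, …`: the formal square of the sample mean of
  -- the signed variables minus `γ` times the variable at `i`. Averaging over `J` yields the claim.
  have hJ : ∀ J : Fin m → V, 0 ≤ γ * γ - 2 * γ * (∑ a, σ (J a) * M i (J a)) / m +
      (∑ a, ∑ b, σ (J a) * σ (J b) * M (J a) (J b)) / (m * m) := by
    intro J
    have h := hM.psd_family (ι := Option (Fin m)) (by simpa using hmt)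
      (fun o => o.elim i J) (fun o => o.elim (-γ) (fun a => σ (J a) / m))
    simp only [Fintype.sum_option, Option.elim_none, Option.elim_some, hM.diag] at h
    refine h.trans (le_of_eq ?_)
    simp only [Finset.sum_add_distrib, hM.symm _ i]
    have e1 : ∑ x, -γ * (σ (J x) / m) * M i (J x) = -γ * (∑ a, σ (J a) * M i (J a)) / m := by
      rw [Finset.mul_sum, Finset.sum_div]
      exact Finset.sum_congr rfl fun a _ => by ring
    have e2 : ∑ x, σ (J x) / m * -γ * M i (J x) = -γ * (∑ a, σ (J a) * M i (J a)) / m := by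
      rw [Finset.mul_sum, Finset.sum_div]
      exact Finset.sum_congr rfl fun a _ => by ring
    have e3 : ∑ x, ∑ y, σ (J x) / m * (σ (J y) / m) * M (J x) (J y) =
        (∑ a, ∑ b, σ (J a) * σ (J b) * M (J a) (J b)) / (m * m) := by
      rw [Finset.sum_div]
      refine Finset.sum_congr rfl fun a _ => ?_
      rw [Finset.sum_div]
      refine Finset.sum_congr rfl fun b _ => ?_
      field_simp
    rw [e1, e2, e3]
    ring
  have hw : ∀ J : Fin m → V, 0 ≤ ∏ c, p (J c) := fun J => Finset.prod_nonneg fun c _ => hp0 _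
  have hsum : 0 ≤ ∑ J : Fin m → V, (∏ c, p (J c)) * (γ * γ - 2 * γ * (∑ a, σ (J a) * M i (J a)) / m +
      (∑ a, ∑ b, σ (J a) * σ (J b) * M (J a) (J b)) / (m * m)) :=
    Finset.sum_nonneg fun J _ => mul_nonneg (hw J) (hJ J)
  have h0 : ∑ J : Fin m → V, ∏ c, p (J c) = 1 := by
    rw [← Fintype.sum_pow, hp, one_pow]
  have h1 : ∑ J : Fin m → V, (∏ c, p (J c)) * ∑ a, σ (J a) * M i (J a) = m * γ := by
    simp_rw [Finset.mul_sum]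
    rw [Finset.sum_comm]
    simp_rw [sum_prod_mul_apply hp _ (fun j => σ j * M i j)]
    simp only [Finset.sum_const, Finset.card_univ, Fintype.card_fin, nsmul_eq_mul]
    rw [hγ]
    congr 1
    exact Finset.sum_congr rfl fun j _ => by rw [hpσ j]; ring
  -- The `m * (m - 1)` pairs of distinct samples contribute `q` each, the `m` coincident ones at
  -- most `1` each.
  have h2 : ∑ J : Fin m → V, (∏ c, p (J c)) * ∑ a, ∑ b, σ (J a) * σ (J b) * M (J a) (J b)
      ≤ m + m * (m - 1) * q := by
    have hoff : ∀ a b : Fin m, a ≠ b →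
        ∑ J : Fin m → V, (∏ c, p (J c)) * (σ (J a) * σ (J b) * M (J a) (J b)) = q := by
      intro a b hab
      rw [sum_prod_mul_apply₂ hp hab (fun j l => σ j * σ l * M j l), hq]
      refine Finset.sum_congr rfl fun j _ => Finset.sum_congr rfl fun l _ => ?_
      rw [hpσ j, hpσ l]
      ring
    have hdiag : ∀ a : Fin m,
        ∑ J : Fin m → V, (∏ c, p (J c)) * (σ (J a) * σ (J a) * M (J a) (J a)) ≤ 1 := by
      intro a
      rw [← h0]
      refine Finset.sum_le_sum fun J _ => ?_
      rw [hM.diag, mul_one]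
      exact mul_le_of_le_one_right (hw J) (hσ _)
    have hrow : ∀ a : Fin m, ∑ b : Fin m,
        ∑ J : Fin m → V, (∏ c, p (J c)) * (σ (J a) * σ (J b) * M (J a) (J b)) ≤ 1 + (m - 1) * q := by
      intro a
      rw [← Finset.add_sum_erase _ _ (Finset.mem_univ a)]
      refine add_le_add (hdiag a) (le_of_eq ?_)
      rw [Finset.sum_congr rfl fun b hb => hoff a b (Finset.ne_of_mem_erase hb).symm]
      rw [Finset.sum_const, Finset.card_erase_of_mem (Finset.mem_univ a), Finset.card_univ,
        Fintype.card_fin, nsmul_eq_mul, Nat.cast_sub hm, Nat.cast_one]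
    calc _ = ∑ a : Fin m, ∑ b : Fin m,
        ∑ J : Fin m → V, (∏ c, p (J c)) * (σ (J a) * σ (J b) * M (J a) (J b)) := by
          simp_rw [Finset.mul_sum]
          rw [Finset.sum_comm]
          exact Finset.sum_congr rfl fun a _ => Finset.sum_comm
      _ ≤ ∑ a : Fin m, (1 + (m - 1) * q) := Finset.sum_le_sum fun a _ => hrow a
      _ = _ := by
        rw [Finset.sum_const, Finset.card_univ, Fintype.card_fin, nsmul_eq_mul]
        ring
  clear_value γ q
  have hexp : ∑ J : Fin m → V, (∏ c, p (J c)) * (γ * γ - 2 * γ * (∑ a, σ (J a) * M i (J a)) / m +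
      (∑ a, ∑ b, σ (J a) * σ (J b) * M (J a) (J b)) / (m * m)) =
      γ * γ * (∑ J : Fin m → V, ∏ c, p (J c))
      - 2 * γ / m * (∑ J : Fin m → V, (∏ c, p (J c)) * ∑ a, σ (J a) * M i (J a))
      + (∑ J : Fin m → V, (∏ c, p (J c)) * ∑ a, ∑ b, σ (J a) * σ (J b) * M (J a) (J b)) /
        (m * m) := by
    rw [Finset.mul_sum, Finset.mul_sum (s := Finset.univ) (a := 2 * γ / m), Finset.sum_div,
      ← Finset.sum_sub_distrib, ← Finset.sum_add_distrib]
    exact Finset.sum_congr rfl fun J _ => by ring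
  rw [hexp, h0, h1] at hsum
  have h3 : 2 * γ / m * (m * γ) = 2 * γ * γ := by field_simp
  have h4 : (∑ J : Fin m → V, (∏ c, p (J c)) * ∑ a, ∑ b, σ (J a) * σ (J b) * M (J a) (J b)) /
        (m * m) ≤ (m + m * (m - 1) * q) / (m * m) := by gcongr
  have h5 : (m + m * (m - 1) * q) / (m * m) = q + (1 - q) / m := by
    field_simp
    ring
  -- The sampling error comes out as `(1 - q) / m`; this bound makes it at most `2 / m`.
  have hqge : -1 ≤ q := by
    have hb : ∀ j l, |M j l| ≤ 1 := hM.abs_le_one (by omega)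
    have hqa : |q| ≤ (∑ j, |κ j|) * ∑ l, |κ l| := by
      rw [hq, Finset.sum_mul_sum]
      refine (Finset.abs_sum_le_sum_abs _ _).trans (Finset.sum_le_sum fun j _ => ?_)
      refine (Finset.abs_sum_le_sum_abs _ _).trans (Finset.sum_le_sum fun l _ => ?_)
      rw [abs_mul, abs_mul]
      exact mul_le_of_le_one_right (by positivity) (hb j l)
    have hs0 : 0 ≤ ∑ j, |κ j| := Finset.sum_nonneg fun _ _ => abs_nonneg _
    have : (∑ j, |κ j|) * ∑ l, |κ l| ≤ 1 := by nlinarith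
    linarith [neg_abs_le q]
  have h6 : (1 - q) / m ≤ 2 / m := by
    gcongr
    linarith
  rw [h3] at hsum
  nlinarith

end Correlation

/-! ### Signed walks -/

section Walk

variable {V : Type*} [Fintype V] [DecidableEq V]

/-- Weighted degree. -/
noncomputable def wdeg (a : V → V → ℝ) (i : V) : ℝ := ∑ j, a i j

/-- The signed lazy walk: stay with probability `1/2`, or move along an edge and flip the sign. -/
noncomputable def walk (a : V → V → ℝ) : Matrix V V ℝ :=
  Matrix.of fun i j => ((if i = j then 1 else 0) - a i j / wdeg a i) / 2

variable {a : V → V → ℝ}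

theorem wdeg_nonneg (hn : ∀ i j, 0 ≤ a i j) (i : V) : 0 ≤ wdeg a i :=
  Finset.sum_nonneg fun j _ => hn i j

theorem eq_zero_of_wdeg_eq_zero (hn : ∀ i j, 0 ≤ a i j) {i : V} (h : wdeg a i = 0) (j : V) :
    a i j = 0 :=
  (Finset.sum_eq_zero_iff_of_nonneg fun j _ => hn i j).1 h j (Finset.mem_univ j)

theorem wdeg_mul_div (hn : ∀ i j, 0 ≤ a i j) (i j : V) : wdeg a i * (a i j / wdeg a i) = a i j := by
  by_cases h : wdeg a i = 0
  · rw [eq_zero_of_wdeg_eq_zero hn h j, h, zero_mul]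
  · field_simp

theorem wdeg_mul_walk (hn : ∀ i j, 0 ≤ a i j) (i j : V) :
    wdeg a i * walk a i j = ((if i = j then wdeg a i else 0) - a i j) / 2 := by
  have := wdeg_mul_div hn i j
  simp only [walk, Matrix.of_apply]
  split_ifs <;> linarith

/-- Reversibility: the diagonal matrix of degrees intertwines the walk with its transpose, hence
also their powers. -/
theorem wdeg_mul_walk_pow (hs : ∀ i j, a i j = a j i) (hn : ∀ i j, 0 ≤ a i j) (k : ℕ) (i j : V) :
    wdeg a i * (walk a ^ k) i j = wdeg a j * (walk a ^ k) j i := by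
  have h : SemiconjBy (Matrix.diagonal (wdeg a)) (walk a) (walk a).transpose := by
    ext i j
    rw [Matrix.diagonal_mul, Matrix.mul_diagonal, Matrix.transpose_apply, wdeg_mul_walk hn,
      mul_comm, wdeg_mul_walk hn, hs i j]
    rcases eq_or_ne i j with rfl | hij
    · rfl
    · rw [if_neg hij, if_neg hij.symm]
  have h2 := congrFun (congrFun (h.pow_right k).eq i) j
  rwa [← Matrix.transpose_pow, Matrix.diagonal_mul, Matrix.mul_diagonal, Matrix.transpose_apply,
    mul_comm _ (wdeg a j)] at h2

theorem walk_pow_succ_apply (a : V → V → ℝ) (k : ℕ) (j i : V) :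
    (walk a ^ (k + 1)) j i =
      ((walk a ^ k) j i - (∑ l, a j l * (walk a ^ k) l i) / wdeg a j) / 2 := by
  rw [pow_succ', Matrix.mul_apply]
  have : ∀ l, walk a j l * (walk a ^ k) l i =
      ((if j = l then (walk a ^ k) l i else 0) - a j l * (walk a ^ k) l i / wdeg a j) / 2 := by
    intro l
    simp only [walk, Matrix.of_apply]
    split_ifs <;> ring
  simp_rw [this]
  rw [← Finset.sum_div, Finset.sum_sub_distrib, Finset.sum_div]
  simp

/-- The absolute values of a row of one step sum to `1`, or to `1/2` at a vertex of degree zero,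
where `a i j / 0 = 0`. Rows of powers are therefore admissible as `κ` in
`IsLocalCorrelation.sq_sum_le`. -/
theorem sum_abs_walk_pow_le (hn : ∀ i j, 0 ≤ a i j) (k : ℕ) (i : V) :
    ∑ j, |(walk a ^ k) i j| ≤ 1 := by
  have h1 : ∀ i, ∑ j, |walk a i j| ≤ 1 := by
    intro i
    have h : ∀ j, |walk a i j| ≤ ((if i = j then 1 else 0) + a i j / wdeg a i) / 2 := by
      intro j
      have h0 : 0 ≤ a i j / wdeg a i := div_nonneg (hn i j) (wdeg_nonneg hn i)
      simp only [walk, Matrix.of_apply]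
      rw [abs_le]
      split_ifs <;> constructor <;> linarith
    refine (Finset.sum_le_sum fun j _ => h j).trans ?_
    rw [← Finset.sum_div, Finset.sum_add_distrib, ← Finset.sum_div]
    simp only [Finset.sum_ite_eq, Finset.mem_univ, if_true]
    have : (∑ j, a i j) / wdeg a i ≤ 1 := div_self_le_one _
    linarith
  induction k generalizing i with
  | zero => simp [Matrix.one_apply, apply_ite abs]
  | succ k ih =>
    rw [pow_succ']
    calc ∑ j, |(walk a * walk a ^ k) i j| ≤ ∑ j, ∑ l, |walk a i l| * |(walk a ^ k) l j| := by
          refine Finset.sum_le_sum fun j _ => ?_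
          rw [Matrix.mul_apply]
          refine (Finset.abs_sum_le_sum_abs _ _).trans (le_of_eq ?_)
          simp_rw [abs_mul]
      _ = ∑ l, |walk a i l| * ∑ j, |(walk a ^ k) l j| := by
          rw [Finset.sum_comm]
          simp_rw [Finset.mul_sum]
      _ ≤ ∑ l, |walk a i l| * 1 :=
          Finset.sum_le_sum fun l _ => mul_le_mul_of_nonneg_left (ih l) (abs_nonneg _)
      _ ≤ 1 := by simpa using h1 i

/-- Correlation between the ends of a signed walk of length `k`, times the total weight. -/
noncomputable def walkCorr (a M : V → V → ℝ) (k : ℕ) : ℝ :=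
  ∑ i, wdeg a i * ∑ j, (walk a ^ k) i j * M i j

/-- Cauchy–Schwarz over the starting vertex, followed by the second moment bound for each row. By
reversibility, two `k`-step walks leaving a common vertex join to one walk of length `2 * k`. -/
theorem walkCorr_sq_le {t m : ℕ} {M : V → V → ℝ} (hM : IsLocalCorrelation t M)
    (hs : ∀ i j, a i j = a j i) (hn : ∀ i j, 0 ≤ a i j) (hm : 1 ≤ m) (hmt : m + 1 ≤ t) (k : ℕ) :
    walkCorr a M k ^ 2 ≤ (∑ i, wdeg a i) * (walkCorr a M (2 * k) + (∑ i, wdeg a i) * (2 / m)) := by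
  have hd := wdeg_nonneg hn
  have h1 : walkCorr a M k ^ 2 ≤ (∑ i, wdeg a i) *
      ∑ i, wdeg a i * (∑ j, (walk a ^ k) i j * M i j) ^ 2 := by
    refine Finset.sum_sq_le_sum_mul_sum_of_sq_le_mul _ (fun i _ => hd i)
      (fun i _ => mul_nonneg (hd i) (sq_nonneg _)) fun i _ => le_of_eq (by ring)
  refine h1.trans (mul_le_mul_of_nonneg_left ?_ (Finset.sum_nonneg fun i _ => hd i))
  have h2 : ∑ i, wdeg a i * (∑ j, (walk a ^ k) i j * M i j) ^ 2 ≤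
      ∑ i, wdeg a i * ((∑ j, ∑ l, (walk a ^ k) i j * (walk a ^ k) i l * M j l) + 2 / m) :=
    Finset.sum_le_sum fun i _ => mul_le_mul_of_nonneg_left
      (hM.sq_sum_le hm hmt i _ (sum_abs_walk_pow_le hn k i)) (hd i)
  refine h2.trans (le_of_eq ?_)
  simp_rw [mul_add, Finset.sum_add_distrib, ← Finset.sum_mul]
  congr 1
  rw [walkCorr, two_mul, pow_add]
  simp_rw [Finset.mul_sum]
  rw [Finset.sum_comm]
  refine Finset.sum_congr rfl fun j _ => ?_
  rw [Finset.sum_comm]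
  refine Finset.sum_congr rfl fun l _ => ?_
  rw [Matrix.mul_apply, Finset.sum_mul, Finset.mul_sum]
  refine Finset.sum_congr rfl fun i _ => ?_
  have := wdeg_mul_walk_pow hs hn k i j
  linear_combination ((walk a ^ k) i l * M j l) * this

/-- For `M = 1 - 2 * cutProb μ` the right side is the weight that `μ` cuts, so the value of the
relaxation starts the doubling. -/
theorem walkCorr_one {t : ℕ} {M : V → V → ℝ} (hM : IsLocalCorrelation t M)
    (hn : ∀ i j, 0 ≤ a i j) :
    walkCorr a M 1 = ∑ i, ∑ j, a i j * ((1 - M i j) / 2) := by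
  rw [walkCorr]
  refine Finset.sum_congr rfl fun i _ => ?_
  rw [Finset.mul_sum, pow_one]
  have : ∀ j, wdeg a i * (walk a i j * M i j) =
      ((if i = j then wdeg a i * M i j else 0) - a i j * M i j) / 2 := by
    intro j
    rw [← mul_assoc, wdeg_mul_walk hn]
    split_ifs <;> ring
  simp_rw [this]
  rw [← Finset.sum_div, Finset.sum_sub_distrib]
  simp only [Finset.sum_ite_eq, Finset.mem_univ, if_true, hM.diag, wdeg]
  rw [mul_one, ← Finset.sum_sub_distrib, Finset.sum_div]
  exact Finset.sum_congr rfl fun j _ => by ring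

/-- The factor `1 + ε` is slack that absorbs the sampling error: squaring turns it into `1 + 2ε +
ε²`, and the error, at most `ε` times the squared power, consumes only one `ε`. The factor is
available at the start since `(1 - 2ε)(1 + ε) ≤ 1 - ε`. -/
theorem le_walkCorr_two_pow {t m : ℕ} {M : V → V → ℝ} (hM : IsLocalCorrelation t M)
    (hs : ∀ i j, a i j = a j i) (hn : ∀ i j, 0 ≤ a i j) (hm : 1 ≤ m) (hmt : m + 1 ≤ t)
    (hT : 0 < ∑ i, wdeg a i) {ε : ℝ} (hε : 0 ≤ ε) (hε2 : ε ≤ 1 / 2)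
    (hval : (1 - ε) * ∑ i, wdeg a i ≤ ∑ i, ∑ j, a i j * ((1 - M i j) / 2)) (s : ℕ)
    (hcond : 2 / m ≤ ε * (1 - 2 * ε) ^ 2 ^ s) :
    (∑ i, wdeg a i) * ((1 - 2 * ε) ^ 2 ^ s * (1 + ε)) ≤ walkCorr a M (2 ^ s) := by
  have hq0 : 0 ≤ 1 - 2 * ε := by linarith
  have hq1 : 1 - 2 * ε ≤ 1 := by linarith
  set T := ∑ i, wdeg a i with hTdef
  induction s with
  | zero =>
    rw [pow_zero, pow_one, walkCorr_one hM hn]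
    refine le_trans ?_ hval
    nlinarith [mul_nonneg hε hε]
  | succ s ih =>
    have hmono : (1 - 2 * ε) ^ 2 ^ (s + 1) ≤ (1 - 2 * ε) ^ 2 ^ s :=
      pow_le_pow_of_le_one hq0 hq1 (Nat.pow_le_pow_right (by norm_num) (by omega))
    have ih' := ih (hcond.trans (mul_le_mul_of_nonneg_left hmono hε))
    have h := walkCorr_sq_le hM hs hn hm hmt (2 ^ s)
    rw [← hTdef, ← pow_succ'] at h
    have hsq : (1 - 2 * ε) ^ 2 ^ (s + 1) = ((1 - 2 * ε) ^ 2 ^ s) ^ 2 := by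
      rw [← pow_mul, pow_succ]
    rw [hsq] at hcond ⊢
    set y := (1 - 2 * ε) ^ 2 ^ s with hy
    have hy0 : 0 ≤ y := pow_nonneg hq0 _
    have h3 : (T * (y * (1 + ε))) ^ 2 ≤ walkCorr a M (2 ^ s) ^ 2 :=
      pow_le_pow_left₀ (by positivity) ih' 2
    have h4 : T * (T * (y ^ 2 * (1 + ε) ^ 2)) ≤ T * (walkCorr a M (2 ^ (s + 1)) + T * (2 / m)) := by
      calc _ = (T * (y * (1 + ε))) ^ 2 := by ring
        _ ≤ _ := h3.trans h
    have h5 := le_of_mul_le_mul_left h4 hT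
    have h6 : T * (2 / m) ≤ T * (ε * y ^ 2) := mul_le_mul_of_nonneg_left hcond hT.le
    have h7 : 0 ≤ T * (ε ^ 2 * y ^ 2) := by positivity
    nlinarith

/-- Squared norm of the `i`-th column of the `k`-step walk. -/
noncomputable def colNorm (a : V → V → ℝ) (i : V) (k : ℕ) : ℝ :=
  ∑ j, wdeg a j * (walk a ^ k) j i ^ 2

/-- Only `|M| ≤ 1` and two applications of Cauchy–Schwarz enter. The number of vertices lost here is
what forces walks of length of order `log n`. -/
theorem walkCorr_sq_le_sum_colNorm {t : ℕ} {M : V → V → ℝ} (hM : IsLocalCorrelation t M)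
    (ht : 2 ≤ t) (hn : ∀ i j, 0 ≤ a i j) (k : ℕ) :
    walkCorr a M k ^ 2 ≤ Fintype.card V * ((∑ i, wdeg a i) * ∑ i, colNorm a i k) := by
  have hd := wdeg_nonneg hn
  have h1 : |walkCorr a M k| ≤ ∑ j, ∑ i, wdeg a i * |(walk a ^ k) i j| := by
    rw [Finset.sum_comm, walkCorr]
    refine (Finset.abs_sum_le_sum_abs _ _).trans (Finset.sum_le_sum fun i _ => ?_)
    rw [abs_mul, abs_of_nonneg (hd i), ← Finset.mul_sum]
    refine mul_le_mul_of_nonneg_left ?_ (hd i)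
    refine (Finset.abs_sum_le_sum_abs _ _).trans (Finset.sum_le_sum fun j _ => ?_)
    rw [abs_mul]
    exact mul_le_of_le_one_right (abs_nonneg _) (hM.abs_le_one ht i j)
  have h2 : ∀ j, (∑ i, wdeg a i * |(walk a ^ k) i j|) ^ 2 ≤ (∑ i, wdeg a i) * colNorm a j k := by
    intro j
    refine Finset.sum_sq_le_sum_mul_sum_of_sq_le_mul _ (fun i _ => hd i)
      (fun i _ => mul_nonneg (hd i) (sq_nonneg _)) fun i _ => le_of_eq ?_
    rw [mul_pow, sq_abs]
    ring
  have h3 := sq_sum_le_card_mul_sum_sq (s := (Finset.univ : Finset V))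
    (f := fun j => ∑ i, wdeg a i * |(walk a ^ k) i j|)
  rw [← sq_abs (walkCorr a M k)]
  refine (pow_le_pow_left₀ (abs_nonneg _) h1 2).trans (h3.trans ?_)
  rw [Finset.card_univ, Finset.mul_sum _ _ (∑ i, wdeg a i)]
  exact mul_le_mul_of_nonneg_left (Finset.sum_le_sum fun j _ => h2 j) (Nat.cast_nonneg _)

theorem colNorm_zero (i : V) : colNorm a i 0 = wdeg a i := by
  simp [colNorm, Matrix.one_apply]

/-- If every column contracted by `31/32` in each of the `L = 2 ^ s` steps, then `walkCorr² ≤ n T²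
(31/32)^L`. By `hlen` this is less than `(T (1 - 2ε)^L)²`, contradicting `le_walkCorr_two_pow`. -/
theorem exists_colNorm_succ {t m : ℕ} {M : V → V → ℝ} (hM : IsLocalCorrelation t M)
    (hs : ∀ i j, a i j = a j i) (hn : ∀ i j, 0 ≤ a i j) (hm : 1 ≤ m) (hmt : m + 1 ≤ t)
    (hT : 0 < ∑ i, wdeg a i) {ε : ℝ} (hε : 0 ≤ ε) (hε2 : ε ≤ 1 / 2)
    (hval : (1 - ε) * ∑ i, wdeg a i ≤ ∑ i, ∑ j, a i j * ((1 - M i j) / 2)) (s : ℕ)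
    (hcond : 2 / m ≤ ε * (1 - 2 * ε) ^ 2 ^ s)
    (hlen : Fintype.card V * (31 / 32 : ℝ) ^ 2 ^ s < ((1 - 2 * ε) ^ 2 ^ s) ^ 2) :
    ∃ i, ∃ k < 2 ^ s, 31 / 32 * colNorm a i k < colNorm a i (k + 1) := by
  by_contra! hcon
  have hd := wdeg_nonneg hn
  set L := 2 ^ s with hL
  have hdec : ∀ i, ∀ k ≤ L, colNorm a i k ≤ (31 / 32 : ℝ) ^ k * wdeg a i := by
    intro i k hk
    induction k with
    | zero => simp [colNorm_zero]
    | succ k ih =>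
      refine (hcon i k (by omega)).trans ?_
      rw [pow_succ']
      have := ih (by omega)
      linarith
  have hq0 : 0 ≤ 1 - 2 * ε := by linarith
  have h1 := le_walkCorr_two_pow hM hs hn hm hmt hT hε hε2 hval s hcond
  have h2 := walkCorr_sq_le_sum_colNorm hM (by omega) hn (a := a) L
  have h3 : ∑ i, colNorm a i L ≤ (31 / 32 : ℝ) ^ L * ∑ i, wdeg a i := by
    rw [Finset.mul_sum]
    exact Finset.sum_le_sum fun i _ => hdec i L le_rfl
  rw [← hL] at h1
  set T := ∑ i, wdeg a i
  set y := (1 - 2 * ε) ^ L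
  have hy0 : 0 ≤ y := pow_nonneg hq0 _
  have h4 : (T * y) ^ 2 ≤ walkCorr a M L ^ 2 := by
    refine pow_le_pow_left₀ (by positivity) (le_trans ?_ h1) 2
    refine mul_le_mul_of_nonneg_left ?_ hT.le
    nlinarith
  have h5 : (Fintype.card V : ℝ) * (T * ∑ i, colNorm a i L) ≤
      Fintype.card V * (T * ((31 / 32 : ℝ) ^ L * T)) := by gcongr
  have h6 : T ^ 2 * (Fintype.card V * (31 / 32 : ℝ) ^ L) < T ^ 2 * y ^ 2 :=
    mul_lt_mul_of_pos_left hlen (by positivity)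
  nlinarith

/-- With `N = ∑ d f²` and `X = ∑ f (A f)`, Cauchy–Schwarz at each vertex bounds four times the next
norm by `2N - 2X`, while the energy is `2N + 2X`. These add up to `4N`, so slow contraction means
small energy. -/
theorem energy_lt (hs : ∀ i j, a i j = a j i) (hn : ∀ i j, 0 ≤ a i j) {i : V} {k : ℕ} {τ : ℝ}
    (h : τ * colNorm a i k < colNorm a i (k + 1)) :
    ∑ j, ∑ l, a j l * ((walk a ^ k) j i + (walk a ^ k) l i) ^ 2 <
      4 * (1 - τ) * ∑ j, wdeg a j * (walk a ^ k) j i ^ 2 := by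
  have hd := wdeg_nonneg hn
  set f : V → ℝ := fun j => (walk a ^ k) j i with hf
  have hstep : ∀ j, (walk a ^ (k + 1)) j i = (f j - (∑ l, a j l * f l) / wdeg a j) / 2 :=
    fun j => walk_pow_succ_apply a k j i
  have hcs : ∀ j, (∑ l, a j l * f l) ^ 2 / wdeg a j ≤ ∑ l, a j l * f l ^ 2 := by
    intro j
    have h1 : (∑ l, a j l * f l) ^ 2 ≤ wdeg a j * ∑ l, a j l * f l ^ 2 :=
      Finset.sum_sq_le_sum_mul_sum_of_sq_le_mul _ (fun l _ => hn j l)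
        (fun l _ => mul_nonneg (hn j l) (sq_nonneg _)) fun l _ => le_of_eq (by ring)
    exact div_le_of_le_mul₀ (hd j) (Finset.sum_nonneg fun l _ => mul_nonneg (hn j l) (sq_nonneg _))
      (by rwa [mul_comm])
  have hN1 : 4 * colNorm a i (k + 1) ≤ 2 * (∑ j, wdeg a j * f j ^ 2)
      - 2 * ∑ j, f j * ∑ l, a j l * f l := by
    have hswap : ∑ j, ∑ l, a j l * f l ^ 2 = ∑ j, wdeg a j * f j ^ 2 := by
      rw [Finset.sum_comm]
      refine Finset.sum_congr rfl fun l _ => ?_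
      rw [wdeg, Finset.sum_mul]
      exact Finset.sum_congr rfl fun j _ => by rw [hs]
    have hterm : ∀ j, 4 * (wdeg a j * ((walk a ^ (k + 1)) j i) ^ 2) ≤
        wdeg a j * f j ^ 2 - 2 * (f j * ∑ l, a j l * f l) + ∑ l, a j l * f l ^ 2 := by
      intro j
      rw [hstep]
      refine le_trans (le_of_eq ?_) (add_le_add_right (hcs j) _)
      by_cases h0 : wdeg a j = 0
      · have : ∑ l, a j l * f l = 0 :=
          Finset.sum_eq_zero fun l _ => by rw [eq_zero_of_wdeg_eq_zero hn h0, zero_mul]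
        rw [h0, this]
        ring
      · field_simp
        ring
    rw [colNorm, Finset.mul_sum]
    refine (Finset.sum_le_sum fun j _ => hterm j).trans (le_of_eq ?_)
    rw [Finset.sum_add_distrib, Finset.sum_sub_distrib, hswap, ← Finset.mul_sum]
    ring
  have hE : ∑ j, ∑ l, a j l * (f j + f l) ^ 2 =
      2 * (∑ j, wdeg a j * f j ^ 2) + 2 * ∑ j, f j * ∑ l, a j l * f l := by
    have h1 : ∑ j, ∑ l, a j l * f j ^ 2 = ∑ j, wdeg a j * f j ^ 2 :=
      Finset.sum_congr rfl fun j _ => by rw [wdeg, Finset.sum_mul]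
    have h2 : ∑ j, ∑ l, a j l * f l ^ 2 = ∑ j, wdeg a j * f j ^ 2 := by
      rw [Finset.sum_comm, ← h1]
      exact Finset.sum_congr rfl fun l _ => Finset.sum_congr rfl fun j _ => by rw [hs]
    have h3 : ∑ j, ∑ l, a j l * (f j + f l) ^ 2 = ∑ j, ∑ l, a j l * f j ^ 2 +
        ∑ j, ∑ l, a j l * f l ^ 2 + 2 * ∑ j, f j * ∑ l, a j l * f l := by
      simp_rw [Finset.mul_sum, ← Finset.sum_add_distrib]
      exact Finset.sum_congr rfl fun j _ => Finset.sum_congr rfl fun l _ => by ring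
    rw [h3, h1, h2]
    ring
  have hN0 : colNorm a i k = ∑ j, wdeg a j * f j ^ 2 := rfl
  rw [hN0] at h
  change ∑ j, ∑ l, a j l * (f j + f l) ^ 2 < 4 * (1 - τ) * ∑ j, wdeg a j * f j ^ 2
  rw [hE]
  linarith

end Walk

/-! ### Sweep cuts and a bipartite Cheeger inequality. -/

/-- The partial cut given by the signs of the entries of `f` that are at least as large as that of
`s`. -/
def sweep {V R : Type*} [Ring R] [LinearOrder R] (f : V → R) (s j : V) : ℤ :=
  if f j * f j < f s * f s then 0 else if f j < 0 then -1 else if 0 < f j then 1 else 0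

/-- The partial cut `z` has positive volume, and the weight that it cuts exceeds the weight that it
does not cut by at least half of its volume. -/
def GoodCut {V : Type*} [Fintype V] (a : V → V → ℝ) (z : V → ℤ) : Prop :=
  0 < ∑ j, ∑ l, a j l * (z j * z j : ℝ) ∧
    ∑ j, ∑ l, a j l * (z j * z j : ℝ) ≤ -2 * ∑ j, ∑ l, a j l * (z j * z l : ℝ)

section Sweep

variable {V : Type*} [Fintype V] [DecidableEq V]

/-- Layer-cake decomposition: `min (u i) (u j)` is the total height of the levels below both values,
and the superlevel sets change only at values of `u`. The induction peels off the lowest layer,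
whose height is the least positive value `u s`. -/
theorem sum_mul_min_nonneg (c : V → V → ℝ) (u : V → ℝ) (hu : ∀ i, 0 ≤ u i)
    (h : ∀ s, 0 < u s → 0 ≤ ∑ i, ∑ j, if u s ≤ u i ∧ u s ≤ u j then c i j else 0) :
    0 ≤ ∑ i, ∑ j, c i j * min (u i) (u j) := by
  induction hN : (Finset.univ.filter fun i => 0 < u i).card using Nat.strong_induction_on
    generalizing u with
  | _ N ih =>
    rcases (Finset.univ.filter fun i => 0 < u i).eq_empty_or_nonempty with he | hne
    · have h0 : ∀ i, u i = 0 := by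
        intro i
        by_contra hi
        have : i ∈ Finset.univ.filter fun i => 0 < u i := by
          simpa using lt_of_le_of_ne (hu i) (Ne.symm hi)
        rw [he] at this
        simp at this
      simp [h0]
    · obtain ⟨s, hs, hmin⟩ := Finset.exists_min_image _ u hne
      simp only [Finset.mem_filter, Finset.mem_univ, true_and] at hs hmin
      let u' : V → ℝ := fun i => max (u i - u s) 0
      have hpos : ∀ i, 0 < u' i ↔ u s < u i := by
        intro i
        simp [u']
      have hcard : (Finset.univ.filter fun i => 0 < u' i).card < N := by
        rw [← hN]
        refine Finset.card_lt_card ⟨?_, ?_⟩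
        · intro i hi
          simp only [Finset.mem_filter, Finset.mem_univ, true_and, hpos] at hi ⊢
          exact hs.trans hi
        · intro hsub
          have := hsub (show s ∈ _ by simpa using hs)
          simp [hpos] at this
      have h' := ih _ hcard u' (fun i => le_max_right _ _) (fun r hr => by
        have hr' := (hpos r).1 hr
        refine (h r (hs.trans hr')).trans (le_of_eq ?_)
        have hiff : ∀ i, u' r ≤ u' i ↔ u r ≤ u i := by
          intro i
          simp only [u']
          rw [max_eq_left (by linarith : (0 : ℝ) ≤ u r - u s)]
          constructor
          · intro hh
            rcases le_max_iff.1 hh with h1 | h1 <;> linarith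
          · intro hh
            exact le_max_of_le_left (by linarith)
        simp only [hiff]) rfl
      have hstep : ∀ i j, c i j * min (u i) (u j) =
          c i j * min (u' i) (u' j) + u s * if u s ≤ u i ∧ u s ≤ u j then c i j else 0 := by
        intro i j
        have key : ∀ i, u i = 0 ∧ u' i = 0 ∨ u s ≤ u i ∧ u' i = u i - u s := by
          intro i
          rcases (hu i).eq_or_lt with h0 | h0
          · left
            refine ⟨h0.symm, ?_⟩
            simp only [u']
            rw [← h0]
            exact max_eq_right (by linarith)
          · right
            refine ⟨hmin i h0, max_eq_left (by linarith [hmin i h0])⟩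
        rcases key i with ⟨h1, h2⟩ | ⟨h1, h2⟩ <;> rcases key j with ⟨h3, h4⟩ | ⟨h3, h4⟩
        · rw [h1, h2, h3, h4, if_neg (by simp [hs])]
          ring
        · rw [h1, h2, h4, if_neg (by simp [hs]), min_eq_left (hs.le.trans h3),
            min_eq_left (by linarith)]
          ring
        · rw [h2, h3, h4, if_neg (by simp [hs]), min_eq_right (hs.le.trans h1),
            min_eq_right (by linarith)]
          ring
        · rw [h2, h4, if_pos ⟨h1, h3⟩, min_sub_sub_right]
          ring
      simp_rw [hstep, Finset.sum_add_distrib, ← Finset.mul_sum]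
      exact add_nonneg h' (mul_nonneg hs.le (h s hs))

/-- A two-threshold-free form of the bipartite Cheeger inequality: a function with small signless
energy has a good sweep cut. -/
theorem exists_goodCut_sweep {a : V → V → ℝ} (hs : ∀ i j, a i j = a j i) (hn : ∀ i j, 0 ≤ a i j)
    (f : V → ℝ)
    (hf : ∑ j, ∑ l, a j l * (f j + f l) ^ 2 < 1 / 8 * ∑ j, wdeg a j * f j ^ 2) :
    ∃ s, GoodCut a (sweep f s) := by
  by_contra! hcon
  let σ : V → ℝ := fun i => if f i < 0 then -1 else if 0 < f i then 1 else 0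
  have hvol : ∀ z : V → ℝ, ∑ j, ∑ l, a j l * (z l * z l) = ∑ j, ∑ l, a j l * (z j * z j) := by
    intro z
    rw [Finset.sum_comm]
    exact Finset.sum_congr rfl fun l _ => Finset.sum_congr rfl fun j _ => by rw [hs]
  have hge : ∀ z : V → ℝ, -∑ j, ∑ l, a j l * (z j * z j) ≤ ∑ j, ∑ l, a j l * (z j * z l) := by
    intro z
    have h1 : 0 ≤ ∑ j, ∑ l, a j l * (z j + z l) ^ 2 :=
      Finset.sum_nonneg fun j _ => Finset.sum_nonneg fun l _ => mul_nonneg (hn _ _) (sq_nonneg _)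
    have h2 : ∑ j, ∑ l, a j l * (z j + z l) ^ 2 = ∑ j, ∑ l, a j l * (z j * z j) +
        ∑ j, ∑ l, a j l * (z l * z l) + 2 * ∑ j, ∑ l, a j l * (z j * z l) := by
      simp_rw [Finset.mul_sum, ← Finset.sum_add_distrib]
      exact Finset.sum_congr rfl fun j _ => Finset.sum_congr rfl fun l _ => by ring
    rw [h2, hvol] at h1
    linarith
  -- If this failed, `hge` would force the volume to be positive, and the sweep would be a good cut.
  have hbad : ∀ s, 0 ≤ ∑ j, ∑ l, a j l * ((sweep f s j : ℝ) * sweep f s j) +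
      2 * ∑ j, ∑ l, a j l * ((sweep f s j : ℝ) * sweep f s l) := by
    intro s
    have h1 := hcon s
    have h2 := hge (fun j => (sweep f s j : ℝ))
    have h3 : 0 ≤ ∑ j, ∑ l, a j l * ((sweep f s j : ℝ) * sweep f s j) :=
      Finset.sum_nonneg fun j _ => Finset.sum_nonneg fun l _ =>
        mul_nonneg (hn _ _) (mul_self_nonneg _)
    unfold GoodCut at h1
    by_contra! h4
    exact h1 ⟨by linarith, by linarith⟩
  -- The coefficients are chosen so that the sum over a superlevel set of `f²` is the volume of the
  -- corresponding sweep plus twice its quadratic form.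
  have hmain := sum_mul_min_nonneg
    (fun i j => (if i = j then wdeg a i else 0) + 2 * (a i j * (σ i * σ j))) (fun i => f i * f i)
    (fun i => mul_self_nonneg _) (fun s hsp => by
      refine (hbad s).trans (le_of_eq ?_)
      have hz : ∀ i, (sweep f s i : ℝ) = if f s * f s ≤ f i * f i then σ i else 0 := by
        intro i
        simp only [sweep, σ, ← not_lt]
        split_ifs <;> simp
      have hzz : ∀ i, (sweep f s i : ℝ) * sweep f s i = if f s * f s ≤ f i * f i then 1 else 0 := by
        intro i
        rw [hz]
        split_ifs with h1
        · have h0 : f i ≠ 0 := by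
            rintro h0
            rw [h0] at h1
            linarith
          simp only [σ]
          rcases lt_or_gt_of_ne h0 with h2 | h2
          · simp [h2]
          · simp [h2, not_lt.2 h2.le]
        · simp
      rw [Finset.mul_sum, ← Finset.sum_add_distrib]
      refine Finset.sum_congr rfl fun i _ => ?_
      have e1 : ∑ l, a i l * ((sweep f s i : ℝ) * sweep f s i) =
          ∑ l, if i = l then (if f s * f s ≤ f i * f i then wdeg a i else 0) else 0 := by
        rw [hzz, ← Finset.sum_mul, Finset.sum_ite_eq, if_pos (Finset.mem_univ _)]
        split_ifs <;> simp [wdeg]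
      rw [e1, Finset.mul_sum, ← Finset.sum_add_distrib]
      refine Finset.sum_congr rfl fun j _ => ?_
      rw [hz, hz]
      by_cases hij : i = j
      · subst hij
        by_cases h1 : f s * f s ≤ f i * f i <;> simp [h1]
      · by_cases h1 : f s * f s ≤ f i * f i <;> by_cases h2 : f s * f s ≤ f j * f j <;>
          simp [h1, h2, hij])
  -- Summed against `a`, this bounds the quantity in `hmain` by `E + 2 * (-(3/4) * E + energy)`,
  -- which is negative when the energy is below `E / 8`.
  have hpt : ∀ i j, σ i * σ j * min (f i * f i) (f j * f j) ≤
      -(3 / 8) * (f i * f i + f j * f j) + (f i + f j) ^ 2 := by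
    intro i j
    have same : ∀ x y : ℝ, 0 ≤ x * y →
        min (x * x) (y * y) ≤ -(3 / 8) * (x * x + y * y) + (x + y) ^ 2 := by
      intro x y hxy
      have h1 := min_le_left (x * x) (y * y)
      have h2 := min_le_right (x * x) (y * y)
      nlinarith [mul_self_nonneg x, mul_self_nonneg y]
    have opp : ∀ x y : ℝ, x * y ≤ 0 →
        -min (x * x) (y * y) ≤ -(3 / 8) * (x * x + y * y) + (x + y) ^ 2 := by
      intro x y hxy
      rcases min_choice (x * x) (y * y) with h | h <;> rw [h]
      · nlinarith [sq_nonneg (x * 13 / 8 + y), sq_nonneg (5 * y + 8 * x), sq_nonneg (x + y)]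
      · nlinarith [sq_nonneg (y * 13 / 8 + x), sq_nonneg (5 * x + 8 * y), sq_nonneg (x + y)]
    have zero : ∀ x y : ℝ, x * y = 0 →
        0 ≤ -(3 / 8) * (x * x + y * y) + (x + y) ^ 2 := by
      intro x y hxy
      nlinarith [mul_self_nonneg x, mul_self_nonneg y]
    rcases lt_trichotomy (f i) 0 with h1 | h1 | h1 <;>
      rcases lt_trichotomy (f j) 0 with h2 | h2 | h2
    · simpa [σ, h1, h2] using same _ _ (mul_pos_of_neg_of_neg h1 h2).le
    · simpa [σ, h1, h2] using zero (f i) (f j) (by simp [h2])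
    · simpa [σ, h1, h2, not_lt.2 h2.le] using opp (f i) (f j) (mul_neg_of_neg_of_pos h1 h2).le
    · simpa [σ, h1, h2] using zero (f i) (f j) (by simp [h1])
    · simp [σ, h1, h2]
    · simpa [σ, h1, h2] using zero (f i) (f j) (by simp [h1])
    · simpa [σ, h1, h2, not_lt.2 h1.le] using opp (f i) (f j) (mul_neg_of_pos_of_neg h1 h2).le
    · simpa [σ, h1, h2] using zero (f i) (f j) (by simp [h2])
    · simpa [σ, h1, h2, not_lt.2 h1.le, not_lt.2 h2.le] using same _ _ (mul_pos h1 h2).le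
  set E := ∑ j, wdeg a j * f j ^ 2 with hE
  have hEa : ∑ j, ∑ l, a j l * (f j * f j) = E := by
    rw [hE]
    refine Finset.sum_congr rfl fun j _ => ?_
    rw [← Finset.sum_mul, wdeg, sq]
  have hsum : ∑ i, ∑ j, ((if i = j then wdeg a i else 0) + 2 * (a i j * (σ i * σ j))) *
      min (f i * f i) (f j * f j) = E + 2 * ∑ i, ∑ j, a i j *
        (σ i * σ j * min (f i * f i) (f j * f j)) := by
    rw [hE, Finset.mul_sum, ← Finset.sum_add_distrib]
    refine Finset.sum_congr rfl fun i _ => ?_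
    have e1 : wdeg a i * f i ^ 2 = ∑ j, if i = j then wdeg a i * f i ^ 2 else 0 := by simp
    rw [e1, Finset.mul_sum, ← Finset.sum_add_distrib]
    refine Finset.sum_congr rfl fun j _ => ?_
    by_cases hij : i = j
    · subst hij
      simp only [if_true, min_self]
      ring
    · simp only [if_neg hij]
      ring
  have hle : ∑ i, ∑ j, a i j * (σ i * σ j * min (f i * f i) (f j * f j)) ≤
      ∑ i, ∑ j, a i j * (-(3 / 8) * (f i * f i + f j * f j) + (f i + f j) ^ 2) :=
    Finset.sum_le_sum fun i _ => Finset.sum_le_sum fun j _ =>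
      mul_le_mul_of_nonneg_left (hpt i j) (hn i j)
  have hval : ∑ i, ∑ j, a i j * (-(3 / 8) * (f i * f i + f j * f j) + (f i + f j) ^ 2) =
      -(3 / 4) * E + ∑ j, ∑ l, a j l * (f j + f l) ^ 2 := by
    have : -(3 / 4) * E = -(3 / 8) * ∑ j, ∑ l, a j l * (f j * f j) +
        -(3 / 8) * ∑ j, ∑ l, a j l * (f l * f l) := by
      rw [hvol f, hEa]
      ring
    rw [this]
    simp_rw [Finset.mul_sum, ← Finset.sum_add_distrib]
    exact Finset.sum_congr rfl fun j _ => Finset.sum_congr rfl fun l _ => by ring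
  have hE0 : 0 ≤ ∑ j, ∑ l, a j l * (f j + f l) ^ 2 :=
    Finset.sum_nonneg fun j _ => Finset.sum_nonneg fun l _ => mul_nonneg (hn _ _) (sq_nonneg _)
  rw [hsum] at hmain
  linarith

/-- If a local correlation matrix makes `a` nearly fully cut, then some sweep of a short signed walk
is a good partial cut. -/
theorem exists_goodCut_walk {a : V → V → ℝ} {t m : ℕ} {M : V → V → ℝ}
    (hM : IsLocalCorrelation t M)
    (hs : ∀ i j, a i j = a j i) (hn : ∀ i j, 0 ≤ a i j) (hm : 1 ≤ m) (hmt : m + 1 ≤ t)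
    (hT : 0 < ∑ i, ∑ j, a i j) {ε : ℝ} (hε : 0 ≤ ε) (hε2 : ε ≤ 1 / 2)
    (hval : (1 - ε) * ∑ i, ∑ j, a i j ≤ ∑ i, ∑ j, a i j * ((1 - M i j) / 2)) (s : ℕ)
    (hcond : 2 / m ≤ ε * (1 - 2 * ε) ^ 2 ^ s)
    (hlen : Fintype.card V * (31 / 32 : ℝ) ^ 2 ^ s < ((1 - 2 * ε) ^ 2 ^ s) ^ 2) :
    ∃ i, ∃ k < 2 ^ s, ∃ r, GoodCut a (sweep (fun j => (walk a ^ k) j i) r) := by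
  obtain ⟨i, k, hk, h⟩ := exists_colNorm_succ hM hs hn hm hmt hT hε hε2 hval s hcond hlen
  refine ⟨i, k, hk, exists_goodCut_sweep hs hn _ ?_⟩
  -- The contraction factor `31/32` was chosen so that `4 * (1 - 31/32) = 1/8`.
  refine (energy_lt hs hn h).trans_le (le_of_eq ?_)
  norm_num

end Sweep

/-! ### Correlations of local pseudodistributions -/

section Pseudo

variable {n t : ℕ} {μ : LocalFamily n ℝ}

/-- Consistency of marginals: the pair probabilities inside `S` all come from the single
distribution `μ S`. -/
theorem cutProb_eq_sum (hμ : IsLocalPseudodistribution t μ) {S : Finset (Fin n)}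
    (hS : S.card ≤ t) {i j : Fin n} (hi : i ∈ S) (hj : j ∈ S) :
    cutProb μ i j = ∑ x : S → Bool, if x ⟨i, hi⟩ ≠ x ⟨j, hj⟩ then μ S x else 0 := by
  have hsub : ({i, j} : Finset (Fin n)) ⊆ S := by
    intro l hl
    simp only [Finset.mem_insert, Finset.mem_singleton] at hl
    rcases hl with rfl | rfl <;> assumption
  unfold cutProb
  simp_rw [← hμ.marginal S {i, j} hsub hS]
  have : ∀ y : ({i, j} : Finset (Fin n)) → Bool,
      (if y ⟨i, by simp⟩ ≠ y ⟨j, by simp⟩ then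
        ∑ x : S → Bool, if (fun l : ({i, j} : Finset (Fin n)) => x ⟨l.1, hsub l.2⟩) = y then μ S x
          else 0 else 0) =
      ∑ x : S → Bool, if (fun l : ({i, j} : Finset (Fin n)) => x ⟨l.1, hsub l.2⟩) = y then
        (if x ⟨i, hi⟩ ≠ x ⟨j, hj⟩ then μ S x else 0) else 0 := by
    intro y
    split_ifs with h
    · refine Finset.sum_congr rfl fun x _ => ?_
      split_ifs with h1 h2
      · rfl
      · subst h1
        exact absurd h h2
      · rfl
    · symm
      refine Finset.sum_eq_zero fun x _ => ?_
      split_ifs with h1 h2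
      · subst h1
        exact absurd h2 h
      · rfl
      · rfl
  simp_rw [this]
  rw [Finset.sum_comm]
  refine Finset.sum_congr rfl fun x _ => ?_
  rw [Finset.sum_ite_eq, if_pos (Finset.mem_univ _)]

theorem cutProb_self (μ : LocalFamily n ℝ) (i : Fin n) : cutProb μ i i = 0 := by
  simp [cutProb]

theorem card_pair_le (ht : 2 ≤ t) (i j : Fin n) : ({i, j} : Finset (Fin n)).card ≤ t :=
  Finset.card_le_two.trans ht

theorem cutProb_comm (hμ : IsLocalPseudodistribution t μ) (ht : 2 ≤ t) (i j : Fin n) :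
    cutProb μ i j = cutProb μ j i := by
  have hS := card_pair_le ht i j
  rw [cutProb_eq_sum hμ hS (by simp) (by simp),
    cutProb_eq_sum hμ hS (i := j) (j := i) (by simp) (by simp)]
  exact Finset.sum_congr rfl fun x _ => by simp only [ne_comm]

theorem cutProb_le_one (hμ : IsLocalPseudodistribution t μ) (ht : 2 ≤ t) (i j : Fin n) :
    cutProb μ i j ≤ 1 := by
  rw [← hμ.sum_eq_one _ (card_pair_le ht i j)]
  refine Finset.sum_le_sum fun x _ => ?_
  split_ifs
  · exact le_rfl
  · exact hμ.nonneg _ (card_pair_le ht i j) x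

/-- On `S` the entries are true second moments of `±1`-valued variables under `μ S`, so the
quadratic form is an expected square. -/
theorem isLocalCorrelation (hμ : IsLocalPseudodistribution t μ) (ht : 2 ≤ t) :
    IsLocalCorrelation t (fun i j => 1 - 2 * cutProb μ i j) where
  symm i j := by rw [cutProb_comm hμ ht]
  diag i := by simp [cutProb_self]
  psd S hS c := by
    let χ : Bool → ℝ := fun b => if b then 1 else -1
    have hχ : ∀ b b' : Bool, χ b * χ b' = 1 - 2 * (if b ≠ b' then 1 else 0) := by
      intro b b'
      cases b <;> cases b' <;> simp [χ] <;> norm_num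
    have hM : ∀ i j : S, 1 - 2 * cutProb μ i j = ∑ x, μ S x * (χ (x i) * χ (x j)) := by
      intro i j
      rw [cutProb_eq_sum hμ hS i.2 j.2]
      simp_rw [hχ, mul_sub, Finset.sum_sub_distrib, mul_one, hμ.sum_eq_one S hS, Finset.mul_sum]
      congr 1
      refine Finset.sum_congr rfl fun x _ => ?_
      split_ifs <;> ring
    have : ∑ i ∈ S, ∑ j ∈ S, c i * c j * (1 - 2 * cutProb μ i j) =
        ∑ x, μ S x * (∑ i : S, c i * χ (x i)) ^ 2 := by
      rw [← Finset.sum_coe_sort S]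
      simp_rw [← Finset.sum_coe_sort S, hM, sq, Finset.sum_mul_sum, Finset.mul_sum]
      rw [Finset.sum_comm' (t' := Finset.univ) (s' := fun _ => Finset.univ) (by simp)]
      conv_rhs => rw [Finset.sum_comm]
      rw [Finset.sum_comm]
      refine Finset.sum_congr rfl fun i _ => ?_
      rw [Finset.sum_comm]
      refine Finset.sum_congr rfl fun x _ => Finset.sum_congr rfl fun j _ => by ring
    rw [this]
    exact Finset.sum_nonneg fun x _ => mul_nonneg (hμ.nonneg S hS x) (sq_nonneg _)

end Pseudo

/-! ### Choice of the walk length -/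

theorem exp_neg_two_mul_le {u : ℝ} (h0 : 0 ≤ u) (h1 : u ≤ 1 / 2) : Real.exp (-(2 * u)) ≤ 1 - u := by
  rw [Real.exp_neg]
  have h := Real.add_one_le_exp (2 * u)
  have hpos : 0 < 2 * u + 1 := by linarith
  calc (Real.exp (2 * u))⁻¹ ≤ (2 * u + 1)⁻¹ := inv_anti₀ hpos h
    _ ≤ 1 - u := by
      rw [inv_le_iff_one_le_mul₀ hpos]
      nlinarith

/-- The length `L = 2 ^ s` lies between `64 log n` and `128 log n`. The upper bound and `ε ≤ β /
2048` give `(1 - 2ε)^L ≥ n^(-β/4)`, which dominates the sampling error of order `n^(-β)`. The lower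
bound makes `n (31/32)^L` at most `exp (-L/64)`, whereas `(1 - 2ε)^(2L)` is at least `exp (-L/256)`.
-/
theorem eventually_walk_length {α β ε : ℝ} (hβ : 0 < β) (hβ1 : β ≤ 1) (hβα : β ≤ α) (hε : 0 < ε)
    (hεβ : ε ≤ β / 2048) :
    ∀ᶠ n : ℕ in Filter.atTop, 3 ≤ degree α n ∧ ∃ s : ℕ, 2 ^ s ≤ n ∧
      2 / ((degree α n - 1 : ℕ) : ℝ) ≤ ε * (1 - 2 * ε) ^ 2 ^ s ∧
      (n : ℝ) * (31 / 32 : ℝ) ^ 2 ^ s < ((1 - 2 * ε) ^ 2 ^ s) ^ 2 := by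
  have hcast : Filter.Tendsto (fun n : ℕ => (n : ℝ)) Filter.atTop Filter.atTop :=
    tendsto_natCast_atTop_atTop
  have e1 : ∀ᶠ n : ℕ in Filter.atTop, 4 ≤ (n : ℝ) ^ β :=
    ((tendsto_rpow_atTop hβ).comp hcast).eventually_ge_atTop 4
  have e2 : ∀ᶠ n : ℕ in Filter.atTop, 4 / ε ≤ (n : ℝ) ^ (β / 2) :=
    ((tendsto_rpow_atTop (half_pos hβ)).comp hcast).eventually_ge_atTop _
  have e3 : ∀ᶠ n : ℕ in Filter.atTop, 128 * Real.log n ≤ n := by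
    have h := (Real.isLittleO_log_id_atTop.comp_tendsto hcast).bound
      (show (0 : ℝ) < 1 / 128 by norm_num)
    filter_upwards [h, Filter.eventually_ge_atTop 1] with n hn hn1
    simp only [Function.comp, id, Real.norm_eq_abs, Nat.abs_cast] at hn
    have := le_abs_self (Real.log n)
    linarith
  have e4 : ∀ᶠ n : ℕ in Filter.atTop, 1 ≤ Real.log n :=
    (Real.tendsto_log_atTop.comp hcast).eventually_ge_atTop 1
  filter_upwards [e1, e2, e3, e4, Filter.eventually_ge_atTop 1] with n h1 h2 h3 h4 hn1
  have hn1' : (1 : ℝ) ≤ n := by exact_mod_cast hn1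
  have hn0 : (0 : ℝ) < n := by linarith
  have hpow : (n : ℝ) ^ β ≤ (n : ℝ) ^ α := Real.rpow_le_rpow_of_exponent_le hn1' hβα
  have hdeg3 : 3 ≤ degree α n := by
    refine Nat.le_floor ?_
    push_cast
    linarith
  have hm : (n : ℝ) ^ β / 2 ≤ ((degree α n - 1 : ℕ) : ℝ) := by
    rw [Nat.cast_sub (by omega), Nat.cast_one]
    have := Nat.lt_floor_add_one ((n : ℝ) ^ α)
    change _ < (degree α n : ℝ) + 1 at this
    linarith
  refine ⟨hdeg3, ?_⟩
  -- Lengths must be powers of two for the doubling argument, which costs a factor `2` in the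
  -- choice.
  obtain ⟨s, hs1, hs2⟩ := exists_nat_pow_near (show 1 ≤ 128 * Real.log n by linarith)
    (show (1 : ℝ) < 2 by norm_num)
  have hs3 : 64 * Real.log n < 2 ^ s := by
    rw [pow_succ] at hs2
    linarith
  have hL : ((2 ^ s : ℕ) : ℝ) = 2 ^ s := by push_cast; rfl
  have hy : Real.exp (-(4 * ε * 2 ^ s)) ≤ (1 - 2 * ε) ^ 2 ^ s := by
    have h := exp_neg_two_mul_le (u := 2 * ε) (by linarith) (by linarith)
    have h' := pow_le_pow_left₀ (Real.exp_pos _).le h (2 ^ s)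
    rw [← Real.exp_nat_mul, hL] at h'
    refine le_trans (le_of_eq ?_) h'
    congr 1
    ring
  refine ⟨s, ?_, ?_, ?_⟩
  · have : ((2 ^ s : ℕ) : ℝ) ≤ n := by
      rw [hL]
      linarith
    exact_mod_cast this
  · have h5 : (n : ℝ) ^ (-(β / 4)) ≤ (1 - 2 * ε) ^ 2 ^ s := by
      refine le_trans ?_ hy
      rw [Real.rpow_def_of_pos hn0]
      apply Real.exp_le_exp.2
      have : 4 * ε * 2 ^ s ≤ 4 * (β / 2048) * (128 * Real.log n) := by gcongr
      linarith
    have h5' : (n : ℝ) ^ (-(β / 2)) ≤ (1 - 2 * ε) ^ 2 ^ s :=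
      (Real.rpow_le_rpow_of_exponent_le hn1' (by linarith)).trans h5
    have hmpos : 0 < ((degree α n - 1 : ℕ) : ℝ) := lt_of_lt_of_le (by positivity) hm
    rw [div_le_iff₀ hmpos]
    have h6 : ε * (n : ℝ) ^ (-(β / 2)) * ((n : ℝ) ^ β / 2) ≤
        ε * (1 - 2 * ε) ^ 2 ^ s * ((degree α n - 1 : ℕ) : ℝ) := by
      gcongr
      exact mul_nonneg hε.le ((Real.exp_pos _).le.trans hy)
    refine le_trans ?_ h6
    have h7 : (n : ℝ) ^ (-(β / 2)) * (n : ℝ) ^ β = (n : ℝ) ^ (β / 2) := by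
      rw [← Real.rpow_add hn0]
      congr 1
      ring
    have h8 : 4 ≤ ε * (n : ℝ) ^ (β / 2) := by
      rw [div_le_iff₀ hε] at h2
      linarith
    calc (2 : ℝ) ≤ ε * (n : ℝ) ^ (β / 2) / 2 := by linarith
      _ = _ := by rw [← h7]; ring
  · have h5 : (31 / 32 : ℝ) ^ 2 ^ s ≤ Real.exp (-(2 ^ s / 32)) := by
      have h := Real.add_one_le_exp (-(1 / 32) : ℝ)
      have h' := pow_le_pow_left₀ (by norm_num) h (2 ^ s)
      rw [← Real.exp_nat_mul, hL] at h'
      refine le_trans (le_of_eq (by norm_num)) (h'.trans (le_of_eq ?_))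
      congr 1
      ring
    have h6 : Real.exp (-(8 * ε * 2 ^ s)) ≤ ((1 - 2 * ε) ^ 2 ^ s) ^ 2 := by
      have h' := pow_le_pow_left₀ (Real.exp_pos _).le hy 2
      rw [← Real.exp_nat_mul] at h'
      refine le_trans (le_of_eq ?_) h'
      congr 1
      push_cast
      ring
    refine lt_of_lt_of_le ?_ h6
    calc (n : ℝ) * (31 / 32 : ℝ) ^ 2 ^ s ≤ Real.exp (Real.log n) * Real.exp (-(2 ^ s / 32)) := by
          rw [Real.exp_log hn0]
          gcongr
      _ = Real.exp (Real.log n - 2 ^ s / 32) := by rw [← Real.exp_add]; ring_nf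
      _ < _ := by
          apply Real.exp_lt_exp.2
          have : 8 * ε * 2 ^ s ≤ 8 * (1 / 2048) * 2 ^ s := by
            gcongr
            linarith
          linarith

/-- For large `n`, near-optimal degree-`n ^ α` solutions yield a good sweep cut. -/
theorem eventually_exists_goodCut {α β ε : ℝ} (hβ : 0 < β) (hβ1 : β ≤ 1) (hβα : β ≤ α)
    (hε : 0 < ε) (hεβ : ε ≤ β / 2048) :
    ∀ᶠ n : ℕ in Filter.atTop, 3 ≤ degree α n ∧
      ∀ (μ : LocalFamily n ℝ), IsLocalPseudodistribution (degree α n) μ →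
      ∀ a : Fin n → Fin n → ℝ, (∀ i j, a i j = a j i) → (∀ i j, 0 ≤ a i j) →
      0 < ∑ i, ∑ j, a i j → (1 - ε) * ∑ i, ∑ j, a i j ≤ ∑ i, ∑ j, a i j * cutProb μ i j →
      ∃ i, ∃ k < n, ∃ r, GoodCut a (sweep (fun j => (walk a ^ k) j i) r) := by
  filter_upwards [eventually_walk_length hβ hβ1 hβα hε hεβ] with n hn
  obtain ⟨h3, s, hsn, hc, hl⟩ := hn
  refine ⟨h3, fun μ hμ a hs hnn hT hval => ?_⟩
  obtain ⟨i, k, hk, r, h⟩ := exists_goodCut_walk (isLocalCorrelation hμ (by omega)) hs hnn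
    (m := degree α n - 1) (by omega) (by omega) hT hε.le (by linarith)
    (hval.trans (le_of_eq (Finset.sum_congr rfl fun i _ => Finset.sum_congr rfl fun j _ => by ring)))
    s hc (by rwa [Fintype.card_fin])
  exact ⟨i, k, hk.trans_le hsn, r, h⟩

/-! ### Partial cuts -/

section PartialCut

variable {V : Type*} [Fintype V] [DecidableEq V]

/-- A partial cut assigns `1` or `-1` to some of the vertices, and `0` to the others. -/
def IsPartial (x : V → ℤ) : Prop := ∀ i, x i = 0 ∨ x i = 1 ∨ x i = -1

/-- The weights between vertices that `x` leaves open. -/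
def openWeight (w : V → V → ℝ) (x : V → ℤ) (i j : V) : ℝ :=
  w i j * ((1 - x i * x i) * (1 - x j * x j))

/-- The quadratic form of the weights at a partial cut. -/
def cutForm (w : V → V → ℝ) (x : V → ℤ) : ℝ := ∑ i, ∑ j, w i j * (x i * x j : ℝ)

/-- The weight that `x` cuts exceeds the weight that it does not cut by a quarter of the weight of
the edges that it decides. -/
def IsAhead (w : V → V → ℝ) (x : V → ℤ) : Prop :=
  4 * cutForm w x + ∑ i, ∑ j, w i j ≤ ∑ i, ∑ j, openWeight w x i j

theorem isAhead_zero (w : V → V → ℝ) : IsAhead w 0 := by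
  simp [IsAhead, cutForm, openWeight]

theorem IsPartial.sq_cast {x : V → ℤ} (hx : IsPartial x) (i : V) :
    (x i * x i : ℝ) = 0 ∨ (x i * x i : ℝ) = 1 := by
  rcases hx i with h | h | h <;> simp [h]

variable {w : V → V → ℝ}

theorem openWeight_nonneg (hn : ∀ i j, 0 ≤ w i j) {x : V → ℤ} (hx : IsPartial x) (i j : V) :
    0 ≤ openWeight w x i j := by
  refine mul_nonneg (hn i j) ?_
  rcases hx.sq_cast i with h | h <;> rcases hx.sq_cast j with h' | h' <;> rw [h, h'] <;> norm_num

theorem openWeight_le (hn : ∀ i j, 0 ≤ w i j) {x : V → ℤ} (hx : IsPartial x) (i j : V) :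
    openWeight w x i j ≤ w i j := by
  refine mul_le_of_le_one_right (hn i j) ?_
  rcases hx.sq_cast i with h | h <;> rcases hx.sq_cast j with h' | h' <;> rw [h, h'] <;> norm_num

theorem openWeight_symm (hs : ∀ i j, w i j = w j i) (x : V → ℤ) (i j : V) :
    openWeight w x i j = openWeight w x j i := by
  rw [openWeight, openWeight, hs, mul_comm (1 - (x i * x i : ℝ))]

theorem cutForm_add (hs : ∀ i j, w i j = w j i) (x z : V → ℤ) (σ : ℤ) (hσ : σ = 1 ∨ σ = -1) :
    cutForm w (fun i => x i + σ * z i) =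
      cutForm w x + 2 * (σ * ∑ i, ∑ j, w i j * (z i * x j : ℝ)) + cutForm w z := by
  have hσ2 : (σ * σ : ℝ) = 1 := by rcases hσ with h | h <;> simp [h]
  have e : ∑ i, ∑ j, w i j * (x i * z j : ℝ) = ∑ i, ∑ j, w i j * (z i * x j : ℝ) := by
    rw [Finset.sum_comm]
    exact Finset.sum_congr rfl fun i _ => Finset.sum_congr rfl fun j _ => by rw [hs]; ring
  have e2 : 2 * (σ * ∑ i, ∑ j, w i j * (z i * x j : ℝ)) =
      σ * ∑ i, ∑ j, w i j * (x i * z j : ℝ) + σ * ∑ i, ∑ j, w i j * (z i * x j : ℝ) := by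
    rw [e]
    ring
  rw [e2]
  unfold cutForm
  simp_rw [Finset.mul_sum, ← Finset.sum_add_distrib]
  refine Finset.sum_congr rfl fun i _ => Finset.sum_congr rfl fun j _ => ?_
  push_cast
  linear_combination (w i j * (z i * z j : ℝ)) * hσ2

theorem isPartial_add {x z : V → ℤ} (hx : IsPartial x) (hz : IsPartial z)
    (hxz : ∀ i, x i ≠ 0 → z i = 0) {σ : ℤ} (hσ : σ = 1 ∨ σ = -1) :
    IsPartial fun i => x i + σ * z i := by
  intro i
  by_cases h : x i = 0
  · rcases hσ with rfl | rfl <;> rcases hz i with h' | h' | h' <;> simp [h, h']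
  · simpa [hxz i h] using hx i

/-- Extending a partial cut by a good cut of the open vertices keeps it ahead. -/
theorem isAhead_add (hs : ∀ i j, w i j = w j i) (hn : ∀ i j, 0 ≤ w i j) {x z : V → ℤ}
    (hxz : ∀ i, x i ≠ 0 → z i = 0) {σ : ℤ}
    (hσ : σ = 1 ∨ σ = -1) (hcross : σ * ∑ i, ∑ j, w i j * (z i * x j : ℝ) ≤ 0)
    (hgood : GoodCut (openWeight w x) z) (ha : IsAhead w x) :
    IsAhead w (fun i => x i + σ * z i) := by
  have hσ2 : (σ * σ : ℝ) = 1 := by rcases hσ with h | h <;> simp [h]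
  have hxz' : ∀ i, (x i * z i : ℝ) = 0 := by
    intro i
    by_cases h : x i = 0
    · simp [h]
    · simp [hxz i h]
  have hform : cutForm w z = ∑ j, ∑ l, openWeight w x j l * (z j * z l : ℝ) := by
    refine Finset.sum_congr rfl fun j _ => Finset.sum_congr rfl fun l _ => ?_
    have h1 := hxz' j
    have h2 := hxz' l
    unfold openWeight
    linear_combination (w j l * z l * x j * (1 - x l * x l)) * h1 + (w j l * z j * x l) * h2
  have hsq : ∀ i, ((x i + σ * z i : ℤ) * (x i + σ * z i : ℤ) : ℝ) = x i * x i + z i * z i := by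
    intro i
    push_cast
    linear_combination (2 * σ : ℝ) * hxz' i + (z i * z i : ℝ) * hσ2
  -- Deciding the support of `z` removes at most twice its volume from the open weight, since edges
  -- are counted in both directions; edges inside the support are subtracted twice.
  have hopen : ∑ i, ∑ j, openWeight w x i j - 2 * ∑ j, ∑ l, openWeight w x j l * (z j * z j : ℝ) ≤
      ∑ i, ∑ j, openWeight w (fun i => x i + σ * z i) i j := by
    have hswap : ∑ j, ∑ l, openWeight w x j l * (z l * z l : ℝ) =
        ∑ j, ∑ l, openWeight w x j l * (z j * z j : ℝ) := by
      rw [Finset.sum_comm]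
      exact Finset.sum_congr rfl fun i _ => Finset.sum_congr rfl fun j _ => by
        rw [openWeight_symm hs]
    have e : ∑ i, ∑ j, openWeight w x i j - 2 * ∑ j, ∑ l, openWeight w x j l * (z j * z j : ℝ) =
        ∑ i, ∑ j, (openWeight w x i j - openWeight w x i j * (z i * z i : ℝ)
          - openWeight w x i j * (z j * z j : ℝ)) := by
      simp_rw [Finset.sum_sub_distrib]
      rw [hswap]
      ring
    rw [e]
    refine Finset.sum_le_sum fun i _ => Finset.sum_le_sum fun j _ => ?_
    simp only [openWeight, hsq]
    have h1 := hxz' i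
    have h2 := hxz' j
    have h3 : 0 ≤ w i j * ((z i * z i : ℝ) * (z j * z j : ℝ)) :=
      mul_nonneg (hn i j) (mul_nonneg (mul_self_nonneg _) (mul_self_nonneg _))
    have h4 : w i j * ((1 - (x i * x i + z i * z i : ℝ)) * (1 - (x j * x j + z j * z j : ℝ))) -
        (w i j * ((1 - x i * x i) * (1 - x j * x j)) -
          w i j * ((1 - x i * x i) * (1 - x j * x j)) * (z i * z i : ℝ) -
          w i j * ((1 - x i * x i) * (1 - x j * x j)) * (z j * z j : ℝ)) =
        w i j * ((z i * z i : ℝ) * (z j * z j : ℝ)) := by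
      linear_combination (-(w i j * (1 - x j * x j) * x i * z i : ℝ)) * h1 +
        (-(w i j * (1 - x i * x i) * x j * z j : ℝ)) * h2
    linarith
  -- Goodness lowers `4 * cutForm` by at least twice the volume of `z`, which pays for the lost open
  -- weight; the cross term has the right sign by `hcross`.
  obtain ⟨hg1, hg2⟩ := hgood
  unfold IsAhead at ha ⊢
  rw [cutForm_add hs x z σ hσ, hform]
  linarith

/-- The number of open vertices. -/
def numOpen (x : V → ℤ) : ℕ := (Finset.univ.filter fun i => x i = 0).card

theorem numOpen_add_lt {x z : V → ℤ} (hxz : ∀ i, x i ≠ 0 → z i = 0) {σ : ℤ}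
    (hσ : σ = 1 ∨ σ = -1) (hz : ∃ i, z i ≠ 0) : numOpen (fun i => x i + σ * z i) < numOpen x := by
  obtain ⟨i, hi⟩ := hz
  have hσ0 : σ ≠ 0 := by rcases hσ with h | h <;> simp [h]
  have hxi : x i = 0 := by
    by_contra h
    exact hi (hxz i h)
  refine Finset.card_lt_card ⟨?_, ?_⟩
  · intro j hj
    simp only [Finset.mem_filter, Finset.mem_univ, true_and] at hj ⊢
    by_contra h
    rw [hxz j h] at hj
    exact h (by simpa using hj)
  · intro hsub
    have := hsub (show i ∈ _ by simpa using hxi)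
    simp [hxi, hi, hσ0] at this

theorem GoodCut.exists_ne_zero {a : V → V → ℝ} {z : V → ℤ} (h : GoodCut a z) : ∃ i, z i ≠ 0 := by
  by_contra! h0
  have := h.1
  simp [h0] at this

/-- The part of a cut that lies in the open vertices. -/
def mask (x z : V → ℤ) (i : V) : ℤ := z i * (1 - x i * x i)

theorem mask_eq_zero {x z : V → ℤ} (hx : IsPartial x) (i : V) (h : x i ≠ 0) : mask x z i = 0 := by
  rcases hx i with h' | h' | h'
  · exact absurd h' h
  all_goals simp [mask, h']

theorem isPartial_mask {x z : V → ℤ} (hx : IsPartial x) (hz : IsPartial z) :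
    IsPartial (mask x z) := by
  intro i
  rcases hx i with h' | h' | h' <;> rcases hz i with h'' | h'' | h'' <;> simp [mask, h', h'']

theorem isPartial_sweep {R : Type*} [Ring R] [LinearOrder R] (f : V → R) (s : V) :
    IsPartial (sweep f s) := by
  intro i
  unfold sweep
  split_ifs <;> simp

/-- The open weights vanish at decided vertices, so a sweep over all vertices may be restricted to
the open ones afterwards. -/
theorem goodCut_mask {x z : V → ℤ} (hx : IsPartial x) :
    GoodCut (openWeight w x) (mask x z) ↔ GoodCut (openWeight w x) z := by
  have h1 : ∀ j l, openWeight w x j l * (mask x z j * mask x z j : ℝ) =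
      openWeight w x j l * (z j * z j : ℝ) := by
    intro j l
    unfold openWeight mask
    rcases hx j with h | h | h <;> simp [h]
  have h2 : ∀ j l, openWeight w x j l * (mask x z j * mask x z l : ℝ) =
      openWeight w x j l * (z j * z l : ℝ) := by
    intro j l
    unfold openWeight mask
    rcases hx j with h | h | h <;> rcases hx l with h' | h' | h' <;> simp [h, h']
  simp only [GoodCut, h1, h2]

theorem cutForm_single (hl : ∀ i, w i i = 0) (v : V) : cutForm w (Pi.single v 1) = 0 := by
  refine Finset.sum_eq_zero fun i _ => Finset.sum_eq_zero fun j _ => ?_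
  by_cases hi : i = v
  · by_cases hj : j = v
    · rw [hi, hj, hl, zero_mul]
    · simp [hj]
  · simp [hi]

theorem sum_single_mul (x : V → ℤ) (v : V) :
    ∑ i, ∑ j, w i j * ((Pi.single v 1 : V → ℤ) i * x j : ℝ) = ∑ j, w v j * x j := by
  rw [Finset.sum_eq_single v]
  · simp
  · intro i _ hi
    simp [hi]
  · simp

/-- Deciding one more vertex greedily does not increase the quadratic form. -/
theorem cutForm_update_le (hs : ∀ i j, w i j = w j i) (hl : ∀ i, w i i = 0) {x : V → ℤ} {v : V}
    (hv : x v = 0) {σ : ℤ} (hσ : σ = 1 ∨ σ = -1) (hc : σ * ∑ j, w v j * x j ≤ 0) :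
    cutForm w (Function.update x v σ) ≤ cutForm w x := by
  have e : Function.update x v σ = fun i => x i + σ * (Pi.single v 1 : V → ℤ) i := by
    funext i
    by_cases h : i = v
    · subst h
      simp [hv]
    · simp [h]
  rw [e, cutForm_add hs _ _ _ hσ, cutForm_single hl, sum_single_mul]
  linarith

theorem exists_full_cutForm_le (hs : ∀ i j, w i j = w j i) (hl : ∀ i, w i i = 0) {x : V → ℤ}
    (hx : IsPartial x) :
    ∃ y : V → ℤ, (∀ i, y i = 1 ∨ y i = -1) ∧ cutForm w y ≤ cutForm w x := by
  induction hN : numOpen x using Nat.strong_induction_on generalizing x with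
  | _ N ih =>
    by_cases h : ∃ v, x v = 0
    · obtain ⟨v, hv⟩ := h
      obtain ⟨σ, hσ, hc⟩ : ∃ σ : ℤ, (σ = 1 ∨ σ = -1) ∧ σ * ∑ j, w v j * x j ≤ 0 := by
        rcases le_total (∑ j, w v j * (x j : ℝ)) 0 with h | h
        · exact ⟨1, by simp, by simpa using h⟩
        · exact ⟨-1, by simp, by simpa using h⟩
      have e : Function.update x v σ = fun i => x i + σ * (Pi.single v 1 : V → ℤ) i := by
        funext i
        by_cases h : i = v
        · subst h
          simp [hv]
        · simp [h]
      have hxz : ∀ i, x i ≠ 0 → (Pi.single v 1 : V → ℤ) i = 0 := by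
        intro i hi
        have : i ≠ v := by
          rintro rfl
          exact hi hv
        simp [this]
      have hlt : numOpen (Function.update x v σ) < N := by
        rw [← hN, e]
        exact numOpen_add_lt hxz hσ ⟨v, by simp⟩
      have hp : IsPartial (Function.update x v σ) := by
        intro i
        by_cases h : i = v
        · subst h
          simp [hσ]
        · simpa [h] using hx i
      obtain ⟨y, hy, hle⟩ := ih _ hlt hp rfl
      exact ⟨y, hy, hle.trans (cutForm_update_le hs hl hv hσ hc)⟩
    · push Not at h
      exact ⟨x, fun i => (hx i).resolve_left (h i), le_rfl⟩

/-- If every partial cut that leaves half of the weight open has a good extension, then there is a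
cut that is far ahead. -/
theorem exists_full_of_goodCut (hs : ∀ i j, w i j = w j i) (hn : ∀ i j, 0 ≤ w i j)
    (hl : ∀ i, w i i = 0)
    (H : ∀ x : V → ℤ, IsPartial x → ∑ i, ∑ j, w i j ≤ 2 * ∑ i, ∑ j, openWeight w x i j →
      ∃ z : V → ℤ, IsPartial z ∧ GoodCut (openWeight w x) z) :
    ∃ y : V → ℤ, (∀ i, y i = 1 ∨ y i = -1) ∧ 8 * cutForm w y ≤ -∑ i, ∑ j, w i j := by
  have key : ∀ N : ℕ, ∀ x : V → ℤ, numOpen x = N → IsPartial x → IsAhead w x →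
      ∃ y : V → ℤ, (∀ i, y i = 1 ∨ y i = -1) ∧ 8 * cutForm w y ≤ -∑ i, ∑ j, w i j := by
    intro N
    induction N using Nat.strong_induction_on with
    | _ N ih =>
      intro x hN hx ha
      by_cases hT : ∑ i, ∑ j, w i j ≤ 2 * ∑ i, ∑ j, openWeight w x i j
      · obtain ⟨z, hz, hg⟩ := H x hx hT
        rw [← goodCut_mask hx] at hg
        have hz' := isPartial_mask hx hz
        have hxz := fun i h => mask_eq_zero (z := z) hx i h
        obtain ⟨σ, hσ, hc⟩ : ∃ σ : ℤ, (σ = 1 ∨ σ = -1) ∧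
            σ * ∑ i, ∑ j, w i j * (mask x z i * x j : ℝ) ≤ 0 := by
          rcases le_total (∑ i, ∑ j, w i j * (mask x z i * x j : ℝ)) 0 with h | h
          · exact ⟨1, by simp, by simpa using h⟩
          · exact ⟨-1, by simp, by simpa using h⟩
        refine ih _ ?_ _ rfl (isPartial_add hx hz' hxz hσ) (isAhead_add hs hn hxz hσ hc hg ha)
        rw [← hN]
        exact numOpen_add_lt hxz hσ hg.exists_ne_zero
      -- Less than half of the weight is open, so being ahead gives `4 * cutForm w x + T < T / 2`,
      -- with `T` the total weight.
      · obtain ⟨y, hy, hle⟩ := exists_full_cutForm_le hs hl hx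
        refine ⟨y, hy, ?_⟩
        unfold IsAhead at ha
        linarith
  exact key _ 0 rfl (fun i => by simp) (isAhead_zero w)

end PartialCut

/-! ### Values of cuts and of the relaxation -/

section Value

variable {n : ℕ}

/-- Only the partition matters, so `hxy` compares pairs of vertices; this leaves open which side is
called `true`, a freedom that the output convention of the program uses. -/
theorem cutValue_eq (G : WeightedGraph n) {y : Fin n → ℤ} (hy : ∀ i, y i = 1 ∨ y i = -1)
    {x : Fin n → Bool} (hxy : ∀ i j, x i = x j ↔ y i = y j) :
    cutValue G x = 1 / 2 - cutForm G.w y / (2 * G.total) := by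
  have hT : G.total ≠ 0 := G.total_pos.ne'
  have h : ∑ i, ∑ j, (if x i ≠ x j then G.w i j else 0) = (G.total - cutForm G.w y) / 2 := by
    rw [WeightedGraph.total, cutForm, ← Finset.sum_sub_distrib, Finset.sum_div]
    refine Finset.sum_congr rfl fun i _ => ?_
    rw [← Finset.sum_sub_distrib, Finset.sum_div]
    refine Finset.sum_congr rfl fun j _ => ?_
    simp only [ne_eq, hxy]
    rcases hy i with h1 | h1 <;> rcases hy j with h2 | h2 <;> simp [h1, h2]
  rw [cutValue, h]
  field_simp

theorem exists_cutValue_eq (G : WeightedGraph n) {y : Fin n → ℤ} (hy : ∀ i, y i = 1 ∨ y i = -1) :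
    ∃ x, cutValue G x = 1 / 2 - cutForm G.w y / (2 * G.total) := by
  refine ⟨fun i => decide (y i = 1), cutValue_eq G hy fun i j => ?_⟩
  rcases hy i with h1 | h1 <;> rcases hy j with h2 | h2 <;> simp [h1, h2]

theorem exists_half_le_cutValue (G : WeightedGraph n) : ∃ x, 1 / 2 ≤ cutValue G x := by
  obtain ⟨y, hy, hle⟩ := exists_full_cutForm_le (w := G.w) G.symm G.loopless
    (x := 0) (fun i => by simp)
  obtain ⟨x, hx⟩ := exists_cutValue_eq G hy
  refine ⟨x, ?_⟩
  have h0 : cutForm G.w 0 = 0 := by simp [cutForm]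
  have hT : 0 < G.total := G.total_pos
  have : cutForm G.w y / (2 * G.total) ≤ 0 :=
    div_nonpos_of_nonpos_of_nonneg (h0 ▸ hle) (by linarith)
  linarith

/-- The weights left open by `x` inherit a near-optimal value of the relaxation. -/
theorem le_sum_openWeight_mul_cutProb {t : ℕ} {μ : LocalFamily n ℝ}
    (hμ : IsLocalPseudodistribution t μ) (ht : 2 ≤ t) {w : Fin n → Fin n → ℝ}
    (hn : ∀ i j, 0 ≤ w i j) {ε : ℝ} (hε : 0 ≤ ε)
    (hval : (1 - ε) * ∑ i, ∑ j, w i j ≤ ∑ i, ∑ j, w i j * cutProb μ i j) {x : Fin n → ℤ}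
    (hx : IsPartial x) (hT : ∑ i, ∑ j, w i j ≤ 2 * ∑ i, ∑ j, openWeight w x i j) :
    (1 - 2 * ε) * ∑ i, ∑ j, openWeight w x i j ≤
      ∑ i, ∑ j, openWeight w x i j * cutProb μ i j := by
  -- The uncut weight can only shrink, while the total at most halves; hence the relative loss `ε`
  -- at most doubles.
  have h1 : ∑ i, ∑ j, openWeight w x i j * (1 - cutProb μ i j) ≤
      ∑ i, ∑ j, w i j * (1 - cutProb μ i j) :=
    Finset.sum_le_sum fun i _ => Finset.sum_le_sum fun j _ =>
      mul_le_mul_of_nonneg_right (openWeight_le hn hx i j)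
        (by linarith [cutProb_le_one hμ ht i j])
  simp_rw [mul_sub, mul_one, Finset.sum_sub_distrib] at h1
  nlinarith

/-- The bound `8 * cutForm ≤ -total` of `exists_full_of_goodCut` is a surplus of `1/16` over one
half. The condition on `ε` is twice as strict as in `eventually_exists_goodCut` because the open
weights only have value `1 - 2ε`. -/
theorem exists_cutValue_ge {α β ε : ℝ} (hβ : 0 < β) (hβ1 : β ≤ 1) (hβα : β ≤ α)
    (hε : 0 < ε) (hεβ : ε ≤ β / 4096) :
    ∀ᶠ n : ℕ in Filter.atTop, ∀ (G : WeightedGraph n) (μ : LocalFamily n ℝ),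
      IsLocalPseudodistribution (degree α n) μ → 1 - ε ≤ objective G μ →
      ∃ x, 9 / 16 ≤ cutValue G x := by
  filter_upwards [eventually_exists_goodCut hβ hβ1 hβα (ε := 2 * ε) (by linarith) (by linarith)]
    with n hn G μ hμ hobj
  obtain ⟨h3, hn⟩ := hn
  have hT : 0 < G.total := G.total_pos
  rw [objective, le_div_iff₀ hT] at hobj
  obtain ⟨y, hy, hle⟩ := exists_full_of_goodCut G.symm G.nonneg G.loopless (fun x hx hopen => by
    have hpos : 0 < ∑ i, ∑ j, openWeight G.w x i j := by
      have : 0 < ∑ i, ∑ j, G.w i j := hT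
      linarith
    obtain ⟨i, k, hk, r, hg⟩ := hn μ hμ (openWeight G.w x) (openWeight_symm G.symm x)
      (openWeight_nonneg G.nonneg hx) hpos
      (le_sum_openWeight_mul_cutProb hμ (by omega) G.nonneg hε.le hobj hx hopen)
    exact ⟨_, isPartial_sweep _ _, hg⟩)
  obtain ⟨x, hx⟩ := exists_cutValue_eq G hy
  refine ⟨x, ?_⟩
  rw [hx]
  have h1 : cutForm G.w y / (2 * G.total) ≤ -(1 / 16) := by
    rw [div_le_iff₀ (by linarith)]
    change 8 * cutForm G.w y ≤ -G.total at hle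
    linarith
  linarith

theorem objective_le_one {t : ℕ} (ht : 2 ≤ t) (G : WeightedGraph n) {μ : LocalFamily n ℝ}
    (hμ : IsLocalPseudodistribution t μ) : objective G μ ≤ 1 := by
  have hT : 0 < G.total := G.total_pos
  rw [objective, div_le_one hT]
  exact Finset.sum_le_sum fun i _ => Finset.sum_le_sum fun j _ =>
    mul_le_of_le_one_right (G.nonneg i j) (cutProb_le_one hμ ht i j)

theorem bddAbove_objective {t : ℕ} (ht : 2 ≤ t) (G : WeightedGraph n) :
    BddAbove {v | ∃ μ : LocalFamily n ℝ, IsLocalPseudodistribution t μ ∧ v = objective G μ} := by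
  refine ⟨1, ?_⟩
  rintro v ⟨μ, hμ, rfl⟩
  exact objective_le_one ht G hμ

/-- The local family of the point mass at `x`. -/
noncomputable def pointFamily (x : Fin n → Bool) : LocalFamily n ℝ :=
  fun _ y => if y = fun i => x i.1 then 1 else 0

theorem isLocalPseudodistribution_pointFamily (t : ℕ) (x : Fin n → Bool) :
    IsLocalPseudodistribution t (pointFamily x) where
  nonneg _ _ y := by
    unfold pointFamily
    split_ifs <;> norm_num
  sum_eq_one _ _ := by simp [pointFamily]
  marginal S S' h _ y := by
    unfold pointFamily
    rw [Finset.sum_eq_single (fun i : S => x i.1)]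
    · simp only [if_true]
      exact if_congr eq_comm rfl rfl
    · intro z _ hz
      simp [hz]
    · simp

theorem cutProb_pointFamily (x : Fin n → Bool) (i j : Fin n) :
    cutProb (pointFamily x) i j = if x i ≠ x j then 1 else 0 := by
  unfold cutProb pointFamily
  rw [Finset.sum_eq_single (fun i : ({i, j} : Finset (Fin n)) => x i.1)]
  · simp
  · intro z _ hz
    simp [hz]
  · simp

theorem cutValue_le_saValue {t : ℕ} (ht : 2 ≤ t) (G : WeightedGraph n) (x : Fin n → Bool) :
    cutValue G x ≤ saValue t G := by
  refine le_csSup (bddAbove_objective ht G)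
    ⟨pointFamily x, isLocalPseudodistribution_pointFamily t x, ?_⟩
  simp [cutValue, objective, cutProb_pointFamily]

theorem cutValue_le_maxCut (G : WeightedGraph n) (x : Fin n → Bool) : cutValue G x ≤ maxCut G :=
  le_ciSup (Set.finite_range _).bddAbove x

theorem maxCut_le_saValue {t : ℕ} (ht : 2 ≤ t) (G : WeightedGraph n) :
    maxCut G ≤ saValue t G :=
  ciSup_le fun x => cutValue_le_saValue ht G x

theorem saValue_le_one {t : ℕ} (ht : 2 ≤ t) (G : WeightedGraph n) : saValue t G ≤ 1 := by
  refine csSup_le ⟨_, pointFamily (fun _ => true), isLocalPseudodistribution_pointFamily t _, rfl⟩ ?_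
  rintro v ⟨μ, hμ, rfl⟩
  exact objective_le_one ht G hμ

/-- A strict inequality avoids any appeal to attainment of the supremum; the main theorem has room
for it because it works with `4ε` in place of `ε`. -/
theorem exists_lt_objective {t : ℕ} {G : WeightedGraph n} {c : ℝ} (h : c < saValue t G) :
    ∃ μ : LocalFamily n ℝ, IsLocalPseudodistribution t μ ∧ c < objective G μ := by
  have hne : {v | ∃ μ : LocalFamily n ℝ,
      IsLocalPseudodistribution t μ ∧ v = objective G μ}.Nonempty :=
    ⟨_, pointFamily (fun _ => true), isLocalPseudodistribution_pointFamily t _, rfl⟩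
  obtain ⟨v, ⟨μ, hμ, rfl⟩, hv⟩ := exists_lt_of_lt_csSup hne h
  exact ⟨μ, hμ, hv⟩

end Value

/-! ### Bit lengths of rational numbers -/

theorem size_mul_le (a b : ℕ) : (a * b).size ≤ a.size + b.size := by
  rw [Nat.size_le, pow_add]
  exact Nat.mul_lt_mul'' (Nat.lt_size_self a) (Nat.lt_size_self b)

theorem size_add_le (a b : ℕ) : (a + b).size ≤ a.size + b.size + 1 := by
  rw [Nat.size_le, pow_succ, pow_add]
  have h1 := Nat.lt_size_self a
  have h2 := Nat.lt_size_self b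
  have h3 : 1 ≤ 2 ^ a.size := Nat.one_le_two_pow
  have h4 : 1 ≤ 2 ^ b.size := Nat.one_le_two_pow
  nlinarith

/-- Reduction to lowest terms can only shorten numerator and denominator. -/
theorem bitSize_divInt_le (a b : ℤ) (hb : b ≠ 0) :
    bitSize (Rat.divInt a b) ≤ a.natAbs.size + b.natAbs.size := by
  refine add_le_add (Nat.size_le_size ?_) (Nat.size_le_size ?_)
  · by_cases ha : a = 0
    · simp [ha]
    · exact Int.natAbs_le_of_dvd_ne_zero (Rat.num_dvd a hb) ha
  · exact Nat.le_of_dvd (Int.natAbs_pos.2 hb) (Int.natCast_dvd.1 (Rat.den_dvd a b))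

theorem bitSize_add_le (q r : ℚ) : bitSize (q + r) ≤ 2 * (bitSize q + bitSize r) + 1 := by
  rw [Rat.add_num_den]
  refine (bitSize_divInt_le _ _ (by positivity)).trans ?_
  have h1 : (q.num * r.den + q.den * r.num).natAbs.size ≤
      (q.num.natAbs.size + r.den.size) + (q.den.size + r.num.natAbs.size) + 1 := by
    refine (Nat.size_le_size (Int.natAbs_add_le _ _)).trans ((size_add_le _ _).trans ?_)
    rw [Int.natAbs_mul, Int.natAbs_mul, Int.natAbs_natCast, Int.natAbs_natCast]
    have h1 := size_mul_le q.num.natAbs r.den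
    have h2 := size_mul_le q.den r.num.natAbs
    omega
  have h2 : ((q.den : ℤ) * r.den).natAbs.size ≤ q.den.size + r.den.size := by
    rw [Int.natAbs_mul, Int.natAbs_natCast, Int.natAbs_natCast]
    exact size_mul_le _ _
  unfold bitSize
  omega

theorem bitSize_neg (q : ℚ) : bitSize (-q) = bitSize q := by simp [bitSize]

theorem bitSize_sub_le (q r : ℚ) : bitSize (q - r) ≤ 2 * (bitSize q + bitSize r) + 1 := by
  rw [sub_eq_add_neg, ← bitSize_neg r]
  exact bitSize_add_le q (-r)

theorem bitSize_mul_le (q r : ℚ) : bitSize (q * r) ≤ bitSize q + bitSize r := by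
  have e : q * r = Rat.divInt (q.num * r.num) (q.den * r.den) := by
    rw [Rat.divInt_eq_div]
    push_cast
    rw [← div_mul_div_comm, Rat.num_div_den, Rat.num_div_den]
  rw [e]
  refine (bitSize_divInt_le _ _ (by positivity)).trans ?_
  rw [Int.natAbs_mul, Int.natAbs_mul, Int.natAbs_natCast, Int.natAbs_natCast]
  have h1 := size_mul_le q.num.natAbs r.num.natAbs
  have h2 := size_mul_le q.den r.den
  unfold bitSize
  omega

theorem bitSize_intCast (z : ℤ) : bitSize (z : ℚ) = z.natAbs.size + 1 := by simp [bitSize]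

theorem bitSize_inv_le (q : ℚ) : bitSize q⁻¹ ≤ bitSize q := by
  by_cases h : q = 0
  · simp [h]
  · rw [Rat.inv_def]
    refine (bitSize_divInt_le _ _ (Rat.num_ne_zero.2 h)).trans ?_
    rw [Int.natAbs_natCast]
    unfold bitSize
    omega

theorem bitSize_div_le (q r : ℚ) : bitSize (q / r) ≤ bitSize q + bitSize r := by
  rw [div_eq_mul_inv]
  exact (bitSize_mul_le _ _).trans (add_le_add le_rfl (bitSize_inv_le r))

theorem bitSize_floor_le (q : ℚ) : bitSize ((⌊q⌋ : ℤ) : ℚ) ≤ bitSize q := by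
  rw [bitSize_intCast]
  refine add_le_add (Nat.size_le_size ?_) (Nat.size_pos.2 q.den_pos)
  have h : ⌊q⌋ = q.num / q.den := by rw [← Rat.floor_def]; rfl
  rw [h]
  exact Int.natAbs_ediv_le_natAbs _ _

/-! ### Costs of expressions -/

/-- An upper bound for the cost of an expression, relative to the maximal bit length of the numbers
in the memory and in the input. -/
def Expr.factor : Expr → ℕ
  | const q => 1 + bitSize q
  | load e => e.factor + 1
  | add e₁ e₂ => 3 * (e₁.factor + e₂.factor) + 2
  | sub e₁ e₂ => 3 * (e₁.factor + e₂.factor) + 2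
  | mul e₁ e₂ => 3 * (e₁.factor + e₂.factor) + 2
  | div e₁ e₂ => 3 * (e₁.factor + e₂.factor) + 2
  | floor e => 3 * e.factor + 2
  | weight e₁ e₂ => e₁.factor + e₂.factor + 1
  | query e => e.factor + 1

/-- All numbers in the input have bit length at most `Q`. -/
def Input.Bounded (I : Input) (Q : ℕ) : Prop :=
  (∀ i j, bitSize (I.weight i j) ≤ Q) ∧ ∀ c, bitSize (I.table c) ≤ Q

/-- All numbers in the memory have bit length at most `Q`. -/
def Mem.Bounded (σ : Mem) (Q : ℕ) : Prop := ∀ a, bitSize (σ a) ≤ Q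

/-- Cost and length of the value are bounded together, since a node is charged for the length of its
value. The `3` in `Expr.factor` is one for the costs of the operands plus two for the doubling of
lengths in `bitSize_add_le`. -/
theorem Expr.cost_le {I : Input} {σ : Mem} {Q : ℕ} (hI : I.Bounded Q) (hσ : σ.Bounded Q)
    (e : Expr) :
    e.cost I σ ≤ e.factor * (Q + 1) ∧ bitSize (e.eval I σ) ≤ e.factor * (Q + 1) := by
  induction e with
  | const q =>
    simp only [cost, eval, factor]
    constructor <;> nlinarith
  | load e ih =>
    have h := hσ ⌊e.eval I σ⌋₊
    simp only [cost, eval, factor]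
    constructor <;> nlinarith [ih.1, ih.2]
  | add e₁ e₂ ih₁ ih₂ =>
    have h := bitSize_add_le (e₁.eval I σ) (e₂.eval I σ)
    simp only [cost, eval, factor]
    constructor <;> nlinarith [ih₁.1, ih₁.2, ih₂.1, ih₂.2]
  | sub e₁ e₂ ih₁ ih₂ =>
    have h := bitSize_sub_le (e₁.eval I σ) (e₂.eval I σ)
    simp only [cost, eval, factor]
    constructor <;> nlinarith [ih₁.1, ih₁.2, ih₂.1, ih₂.2]
  | mul e₁ e₂ ih₁ ih₂ =>
    have h := bitSize_mul_le (e₁.eval I σ) (e₂.eval I σ)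
    simp only [cost, eval, factor]
    constructor <;> nlinarith [ih₁.1, ih₁.2, ih₂.1, ih₂.2]
  | div e₁ e₂ ih₁ ih₂ =>
    have h := bitSize_div_le (e₁.eval I σ) (e₂.eval I σ)
    simp only [cost, eval, factor]
    constructor <;> nlinarith [ih₁.1, ih₁.2, ih₂.1, ih₂.2]
  | floor e ih =>
    have h := bitSize_floor_le (e.eval I σ)
    simp only [cost, eval, factor]
    constructor <;> nlinarith [ih.1, ih.2]
  | weight e₁ e₂ ih₁ ih₂ =>
    have h := hI.1 ⌊e₁.eval I σ⌋₊ ⌊e₂.eval I σ⌋₊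
    simp only [cost, eval, factor]
    constructor <;> nlinarith [ih₁.1, ih₁.2, ih₂.1, ih₂.2]
  | query e ih =>
    have h := hI.2 ⌊e.eval I σ⌋₊
    simp only [cost, eval, factor]
    constructor <;> nlinarith [ih.1, ih.2]

theorem Mem.Bounded.update {σ : Mem} {Q : ℕ} (hσ : σ.Bounded Q) (a : ℕ) {q : ℚ}
    (hq : bitSize q ≤ Q) : Mem.Bounded (Function.update σ a q) Q := by
  intro b
  by_cases h : b = a
  · subst h
    simpa using hq
  · simpa [h] using hσ b

/-! ### A structured language

Its state consists of counters, integer variables and integer arrays. All loops run over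
`0, …, n - 1`, and every value that is stored is rounded down and replaced by `0` when it exceeds a
fixed bound. Programs of this language thus halt in polynomial time by construction. -/

/-- States of structured programs. -/
@[ext]
structure St where
  ctr : Fin 8 → ℕ
  var : Fin 8 → ℤ
  arr : Fin 8 → ℕ → ℤ

/-- Assignment to a counter. -/
def St.setCtr (s : St) (v : Fin 8) (k : ℕ) : St := { s with ctr := Function.update s.ctr v k }

/-- Assignment to a variable. -/
def St.setVar (s : St) (a : Fin 8) (z : ℤ) : St := { s with var := Function.update s.var a z }

/-- Assignment to an entry of an array. -/
def St.setArr (s : St) (b : Fin 8) (i : ℕ) (z : ℤ) : St :=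
  { s with arr := Function.update s.arr b (Function.update (s.arr b) i z) }

/-- Terms of the structured language. Arrays are indexed by counters. -/
inductive Term where
  | const (z : ℤ)
  | size
  | ctr (v : Fin 8)
  | var (a : Fin 8)
  | arr (b v : Fin 8)
  | add (e₁ e₂ : Term)
  | sub (e₁ e₂ : Term)
  | mul (e₁ e₂ : Term)
  | div (e₁ e₂ : Term)
  | floor (e : Term)
  | weight (e₁ e₂ : Term)

/-- The value of a term. -/
def Term.val (n : ℕ) (W : ℕ → ℕ → ℚ) (s : St) : Term → ℚ
  | const z => z
  | size => n
  | ctr v => s.ctr v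
  | var a => s.var a
  | arr b v => s.arr b (s.ctr v)
  | add e₁ e₂ => e₁.val n W s + e₂.val n W s
  | sub e₁ e₂ => e₁.val n W s - e₂.val n W s
  | mul e₁ e₂ => e₁.val n W s * e₂.val n W s
  | div e₁ e₂ => e₁.val n W s / e₂.val n W s
  | floor e => (⌊e.val n W s⌋ : ℤ)
  | weight e₁ e₂ => W ⌊e₁.val n W s⌋₊ ⌊e₂.val n W s⌋₊

/-- The address `n + k`. -/
def offset (k : ℕ) : Expr := .add (.load (.const 0)) (.const k)

/-- The address of a counter. -/
def ctrAddr (v : Fin 8) : Expr := offset (1 + v)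

/-- The address of a variable. -/
def varAddr (a : Fin 8) : Expr := offset (9 + a)

/-- The address of an array entry. -/
def arrAddr (b v : Fin 8) : Expr := .add (offset (17 + b)) (.mul (.const 24) (.load (ctrAddr v)))

/-- Compilation of terms. -/
def Term.toExpr : Term → Expr
  | const z => .const z
  | size => .load (.const 0)
  | ctr v => .load (ctrAddr v)
  | var a => .load (varAddr a)
  | arr b v => .load (arrAddr b v)
  | add e₁ e₂ => .add e₁.toExpr e₂.toExpr
  | sub e₁ e₂ => .sub e₁.toExpr e₂.toExpr
  | mul e₁ e₂ => .mul e₁.toExpr e₂.toExpr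
  | div e₁ e₂ => .div e₁.toExpr e₂.toExpr
  | floor e => .floor e.toExpr
  | weight e₁ e₂ => .weight e₁.toExpr e₂.toExpr

/-- The memory `σ` represents the state `s`; the bound `M` is kept in cell `n`. -/
structure Rep (n M : ℕ) (s : St) (σ : Mem) : Prop where
  size : σ 0 = n
  bound : σ n = M
  ctr : ∀ v : Fin 8, σ (n + (1 + v)) = s.ctr v
  var : ∀ a : Fin 8, σ (n + (9 + a)) = s.var a
  arr : ∀ (b : Fin 8) (i : ℕ), σ (n + (17 + b) + 24 * i) = s.arr b i

section Compile

variable {n M : ℕ} {s : St} {σ : Mem} {I : Input}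

theorem eval_offset (h0 : σ 0 = n) (k : ℕ) : (offset k).eval I σ = ((n + k : ℕ) : ℚ) := by
  simp [offset, Expr.eval, h0]

theorem Rep.floor_ctrAddr (h : Rep n M s σ) (v : Fin 8) :
    ⌊(ctrAddr v).eval I σ⌋₊ = n + (1 + v) := by
  rw [ctrAddr, eval_offset h.size, Nat.floor_natCast]

theorem Rep.floor_varAddr (h : Rep n M s σ) (a : Fin 8) :
    ⌊(varAddr a).eval I σ⌋₊ = n + (9 + a) := by
  rw [varAddr, eval_offset h.size, Nat.floor_natCast]

theorem Rep.floor_arrAddr (h : Rep n M s σ) (b v : Fin 8) :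
    ⌊(arrAddr b v).eval I σ⌋₊ = n + (17 + b) + 24 * s.ctr v := by
  have : (arrAddr b v).eval I σ = ((n + (17 + b) + 24 * s.ctr v : ℕ) : ℚ) := by
    simp only [arrAddr, Expr.eval, eval_offset h.size, h.floor_ctrAddr, h.ctr]
    push_cast
    ring
  rw [this, Nat.floor_natCast]

theorem Rep.eval_toExpr (h : Rep n M s σ) (e : Term) :
    e.toExpr.eval I σ = e.val n I.weight s := by
  induction e with
  | const z => rfl
  | size => simp [Term.toExpr, Term.val, Expr.eval, h.size]
  | ctr v => simp only [Term.toExpr, Term.val, Expr.eval, h.floor_ctrAddr, h.ctr]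
  | var a => simp only [Term.toExpr, Term.val, Expr.eval, h.floor_varAddr, h.var]
  | arr b v => simp only [Term.toExpr, Term.val, Expr.eval, h.floor_arrAddr, h.arr]
  | add e₁ e₂ ih₁ ih₂ => simp only [Term.toExpr, Term.val, Expr.eval, ih₁, ih₂]
  | sub e₁ e₂ ih₁ ih₂ => simp only [Term.toExpr, Term.val, Expr.eval, ih₁, ih₂]
  | mul e₁ e₂ ih₁ ih₂ => simp only [Term.toExpr, Term.val, Expr.eval, ih₁, ih₂]
  | div e₁ e₂ ih₁ ih₂ => simp only [Term.toExpr, Term.val, Expr.eval, ih₁, ih₂]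
  | floor e ih => simp only [Term.toExpr, Term.val, Expr.eval, ih]
  | weight e₁ e₂ ih₁ ih₂ => simp only [Term.toExpr, Term.val, Expr.eval, ih₁, ih₂]

/-- Counters occupy the cells `n + 1, …, n + 8`, variables `n + 9, …, n + 16`, and array `b` the
cells `n + 17 + b + 24 * i`. These are disjoint, and the cells `1, …, n - 1` stay free for the
output. -/
theorem Rep.setCtr (hn : 0 < n) (h : Rep n M s σ) (v : Fin 8) (k : ℕ) :
    Rep n M (s.setCtr v k) (Function.update σ (n + (1 + v)) k) where
  size := by rw [Function.update_of_ne (by omega), h.size]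
  bound := by rw [Function.update_of_ne (by omega), h.bound]
  ctr u := by
    by_cases huv : u = v
    · subst huv
      simp [St.setCtr]
    · have : (u : ℕ) ≠ v := fun hh => huv (Fin.ext hh)
      rw [Function.update_of_ne (by omega), h.ctr]
      simp [St.setCtr, huv]
  var a := by
    rw [Function.update_of_ne (by omega), h.var]
    rfl
  arr b i := by
    rw [Function.update_of_ne (by omega), h.arr]
    rfl

theorem Rep.setVar (hn : 0 < n) (h : Rep n M s σ) (a : Fin 8) (z : ℤ) :
    Rep n M (s.setVar a z) (Function.update σ (n + (9 + a)) z) where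
  size := by rw [Function.update_of_ne (by omega), h.size]
  bound := by rw [Function.update_of_ne (by omega), h.bound]
  ctr u := by
    rw [Function.update_of_ne (by omega), h.ctr]
    rfl
  var u := by
    by_cases huv : u = a
    · subst huv
      simp [St.setVar]
    · have : (u : ℕ) ≠ a := fun hh => huv (Fin.ext hh)
      rw [Function.update_of_ne (by omega), h.var]
      simp [St.setVar, huv]
  arr b i := by
    rw [Function.update_of_ne (by omega), h.arr]
    rfl

theorem Rep.setArr (hn : 0 < n) (h : Rep n M s σ) (b : Fin 8) (i : ℕ) (z : ℤ) :
    Rep n M (s.setArr b i z) (Function.update σ (n + (17 + b) + 24 * i) z) where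
  size := by rw [Function.update_of_ne (by omega), h.size]
  bound := by rw [Function.update_of_ne (by omega), h.bound]
  ctr u := by
    rw [Function.update_of_ne (by omega), h.ctr]
    rfl
  var u := by
    rw [Function.update_of_ne (by omega), h.var]
    rfl
  arr c j := by
    by_cases hc : c = b
    · subst hc
      by_cases hj : j = i
      · subst hj
        simp [St.setArr]
      · rw [Function.update_of_ne (by omega), h.arr]
        simp [St.setArr, hj]
    · have : (c : ℕ) ≠ b := fun hh => hc (Fin.ext hh)
      rw [Function.update_of_ne (by omega), h.arr]
      simp [St.setArr, hc]

end Compile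

/-- Structured programs. -/
inductive Cmd where
  | set (a : Fin 8) (e : Term)
  | put (b v : Fin 8) (e : Term)
  | seq (c₁ c₂ : Cmd)
  | ite (e₁ e₂ : Term) (c₁ c₂ : Cmd)
  | loop (v : Fin 8) (c : Cmd)
  | skip

/-- Values that are too large are replaced by `0`. -/
def clip (M : ℕ) (z : ℤ) : ℤ := if |z| ≤ M then z else 0

theorem clip_of_le {M : ℕ} {z : ℤ} (h : |z| ≤ M) : clip M z = z := if_pos h

theorem abs_clip_le (M : ℕ) (z : ℤ) : |clip M z| ≤ M := by
  unfold clip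
  split_ifs with h
  · exact h
  · simp

/-- The state after `k` rounds of a loop. -/
def iterLoop (f : St → St) (v : Fin 8) (s : St) : ℕ → St
  | 0 => s.setCtr v 0
  | k + 1 => (f (iterLoop f v s k)).setCtr v (k + 1)

/-- The effect of a structured program. -/
def Cmd.run (n : ℕ) (W : ℕ → ℕ → ℚ) (M : ℕ) : Cmd → St → St
  | set a e, s => s.setVar a (clip M ⌊e.val n W s⌋)
  | put b v e, s => s.setArr b (s.ctr v) (clip M ⌊e.val n W s⌋)
  | seq c₁ c₂, s => c₂.run n W M (c₁.run n W M s)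
  | ite e₁ e₂ c₁ c₂, s => if e₁.val n W s < e₂.val n W s then c₁.run n W M s else c₂.run n W M s
  | loop v c, s => iterLoop (c.run n W M) v s n
  | skip, s => s

/-- The counter `v` is not changed. -/
def Cmd.noLoop (v : Fin 8) : Cmd → Prop
  | set _ _ => True
  | put _ _ _ => True
  | seq c₁ c₂ => c₁.noLoop v ∧ c₂.noLoop v
  | ite _ _ c₁ c₂ => c₁.noLoop v ∧ c₂.noLoop v
  | loop u c => u ≠ v ∧ c.noLoop v
  | skip => True

/-- The bodies of loops do not change the counters of these loops. -/
def Cmd.WF : Cmd → Prop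
  | set _ _ => True
  | put _ _ _ => True
  | seq c₁ c₂ => c₁.WF ∧ c₂.WF
  | ite _ _ c₁ c₂ => c₁.WF ∧ c₂.WF
  | loop v c => c.noLoop v ∧ c.WF
  | skip => True

section Frame

variable {n : ℕ} {W : ℕ → ℕ → ℚ} {M : ℕ}

theorem Cmd.run_ctr {v : Fin 8} (c : Cmd) (h : c.noLoop v) (s : St) :
    (c.run n W M s).ctr v = s.ctr v := by
  induction c generalizing s with
  | set a e => rfl
  | put b v e => rfl
  | seq c₁ c₂ ih₁ ih₂ => simp only [run, ih₂ h.2, ih₁ h.1]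
  | ite e₁ e₂ c₁ c₂ ih₁ ih₂ =>
    simp only [run]
    split_ifs
    · exact ih₁ h.1 s
    · exact ih₂ h.2 s
  | loop u c ih =>
    simp only [run]
    have : ∀ k, (iterLoop (c.run n W M) u s k).ctr v = s.ctr v := by
      intro k
      induction k with
      | zero => simp [iterLoop, St.setCtr, h.1.symm]
      | succ k ihk => simp [iterLoop, St.setCtr, h.1.symm, ih h.2, ihk]
    exact this n
  | skip => rfl

theorem iterLoop_ctr (f : St → St) (v : Fin 8) (s : St) (k : ℕ) :
    (iterLoop f v s k).ctr v = k := by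
  cases k <;> simp [iterLoop, St.setCtr]

/-- Invariants of loops. -/
theorem Cmd.run_loop {v : Fin 8} {c : Cmd} {s : St} (P : ℕ → St → Prop)
    (h0 : P 0 (s.setCtr v 0))
    (hstep : ∀ k < n, ∀ s : St, s.ctr v = k → P k s →
      P (k + 1) ((c.run n W M s).setCtr v (k + 1))) :
    P n ((loop v c).run n W M s) := by
  have : ∀ k ≤ n, P k (iterLoop (c.run n W M) v s k) := by
    intro k hk
    induction k with
    | zero => exact h0
    | succ k ih => exact hstep k (by omega) _ (iterLoop_ctr _ _ _ _) (ih (by omega))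
  exact this n le_rfl

end Frame

/-! ### Compilation of structured programs -/

/-- The address of the bound for stored values. -/
def boundAddr : Expr := .load (.const 0)

/-- Store a value, rounded down, unless it is too large. -/
def clipStore (a e : Expr) : Prog :=
  .ite e (.add (.load boundAddr) (.const 1))
    (.ite e (.sub (.const 0) (.load boundAddr)) (.store a (.const 0)) (.store a (.floor e)))
    (.store a (.const 0))

/-- Compilation. -/
def Cmd.toProg : Cmd → Prog
  | set a e => clipStore (varAddr a) e.toExpr
  | put b v e => clipStore (arrAddr b v) e.toExpr
  | seq c₁ c₂ => .seq c₁.toProg c₂.toProg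
  | ite e₁ e₂ c₁ c₂ => .ite e₁.toExpr e₂.toExpr c₁.toProg c₂.toProg
  | loop v c => .seq (.store (ctrAddr v) (.const 0))
      (.while (.load (ctrAddr v)) (.load (.const 0))
        (.seq c.toProg (.store (ctrAddr v) (.add (.load (ctrAddr v)) (.const 1)))))
  | skip => .skip

/-- A bound for the cost of `clipStore`. -/
def clipFactor (a e : Expr) : ℕ :=
  3 + 2 * e.factor + (Expr.add (.load boundAddr) (.const 1)).factor +
    (Expr.sub (.const 0) (.load boundAddr)).factor + a.factor + (Expr.const 0).factor +
    (Expr.floor e).factor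

/-- The cost of one round of a loop, apart from its body. -/
def loopFactor (v : Fin 8) : ℕ :=
  2 + (Expr.load (ctrAddr v)).factor + (Expr.load (.const 0)).factor + (ctrAddr v).factor +
    (Expr.add (.load (ctrAddr v)) (.const 1)).factor + (Expr.const 0).factor

/-- A bound for the cost of a structured program, relative to the maximal bit length. -/
def Cmd.cost (n : ℕ) : Cmd → ℕ
  | set a e => clipFactor (varAddr a) e.toExpr
  | put b v e => clipFactor (arrAddr b v) e.toExpr
  | seq c₁ c₂ => c₁.cost n + c₂.cost n
  | ite e₁ e₂ c₁ c₂ => 1 + e₁.toExpr.factor + e₂.toExpr.factor + (c₁.cost n + c₂.cost n)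
  | loop v c => (n + 2) * (c.cost n + loopFactor v)
  | skip => 1

theorem Cmd.cost_mono (c : Cmd) {m n : ℕ} (h : m ≤ n) : c.cost m ≤ c.cost n := by
  induction c with
  | set a e => exact le_rfl
  | put b v e => exact le_rfl
  | seq c₁ c₂ ih₁ ih₂ => exact add_le_add ih₁ ih₂
  | ite e₁ e₂ c₁ c₂ ih₁ ih₂ =>
    simp only [cost]
    omega
  | loop v c ih => exact Nat.mul_le_mul (by omega) (by omega)
  | skip => exact le_rfl

theorem Cmd.exists_polynomial (c : Cmd) : ∃ p : Polynomial ℕ, ∀ n, c.cost n = p.eval n := by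
  induction c with
  | set a e => exact ⟨Polynomial.C (clipFactor (varAddr a) e.toExpr), fun n => by simp [cost]⟩
  | put b v e => exact ⟨Polynomial.C (clipFactor (arrAddr b v) e.toExpr), fun n => by simp [cost]⟩
  | seq c₁ c₂ ih₁ ih₂ =>
    obtain ⟨p, hp⟩ := ih₁
    obtain ⟨q, hq⟩ := ih₂
    exact ⟨p + q, fun n => by simp [cost, hp, hq]⟩
  | ite e₁ e₂ c₁ c₂ ih₁ ih₂ =>
    obtain ⟨p, hp⟩ := ih₁
    obtain ⟨q, hq⟩ := ih₂
    exact ⟨Polynomial.C (1 + e₁.toExpr.factor + e₂.toExpr.factor) + (p + q),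
      fun n => by simp only [cost, hp, hq, Polynomial.eval_add, Polynomial.eval_C]⟩
  | loop v c ih =>
    obtain ⟨p, hp⟩ := ih
    exact ⟨(Polynomial.X + Polynomial.C 2) * (p + Polynomial.C (loopFactor v)),
      fun n => by simp only [cost, hp, Polynomial.eval_add, Polynomial.eval_C, Polynomial.eval_mul,
        Polynomial.eval_X]⟩
  | skip => exact ⟨1, fun n => by simp [cost]⟩

section Simulation

variable {n M Q : ℕ} {I : Input}

theorem bitSize_intCast_le (hQ : M.size + 1 ≤ Q) {z : ℤ} (hz : |z| ≤ M) : bitSize (z : ℚ) ≤ Q := by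
  rw [bitSize_intCast]
  have : z.natAbs ≤ M := by
    rw [Int.abs_eq_natAbs] at hz
    exact_mod_cast hz
  have := Nat.size_le_size this
  omega

theorem exec_clipStore {σ : Mem} (h0 : σ 0 = n) (hM : σ n = M) (hI : I.Bounded Q)
    (hσ : σ.Bounded Q) (hQ : M.size + 1 ≤ Q) (a e : Expr) :
    ∃ k, Exec I (clipStore a e) σ k
        (Function.update σ ⌊a.eval I σ⌋₊ (clip M ⌊e.eval I σ⌋ : ℤ)) ∧
      k ≤ clipFactor a e * (Q + 1) ∧
      Mem.Bounded (Function.update σ ⌊a.eval I σ⌋₊ (clip M ⌊e.eval I σ⌋ : ℤ)) Q := by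
  have hb : (Expr.load boundAddr).eval I σ = M := by
    simp [Expr.eval, boundAddr, h0, hM]
  have c1 := (Expr.cost_le hI hσ e).1
  have c2 := (Expr.cost_le hI hσ (.add (.load boundAddr) (.const 1))).1
  have c3 := (Expr.cost_le hI hσ (.sub (.const 0) (.load boundAddr))).1
  have c4 := (Expr.cost_le hI hσ a).1
  have c5 := (Expr.cost_le hI hσ (.const 0)).1
  have c6 := (Expr.cost_le hI hσ (.floor e)).1
  have hbd := hσ.update ⌊a.eval I σ⌋₊
    (bitSize_intCast_le hQ (abs_clip_le M ⌊e.eval I σ⌋))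
  have st0 : Exec I (.store a (.const 0)) σ (1 + a.cost I σ + (Expr.const 0).cost I σ)
      (Function.update σ ⌊a.eval I σ⌋₊ ((0 : ℤ) : ℚ)) := by
    simpa [Expr.eval] using Exec.store (I := I) a (.const 0) σ
  have st1 : Exec I (.store a (.floor e)) σ (1 + a.cost I σ + (Expr.floor e).cost I σ)
      (Function.update σ ⌊a.eval I σ⌋₊ (⌊e.eval I σ⌋ : ℤ)) :=
    Exec.store (I := I) a (.floor e) σ
  set q := e.eval I σ with hq
  -- The two tests on the unrounded value, `q < M + 1` and `q < -M`, decide exactly whether `|⌊q⌋| ≤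
  -- M`.
  by_cases h1 : q < M + 1
  · have h1' : e.eval I σ < (Expr.add (.load boundAddr) (.const 1)).eval I σ := by
      rw [Expr.eval, hb]
      exact h1
    by_cases h2 : q < -M
    · have h2' : e.eval I σ < (Expr.sub (.const 0) (.load boundAddr)).eval I σ := by
        rw [Expr.eval, hb]
        simpa [Expr.eval] using h2
      have hc : clip M ⌊q⌋ = 0 := by
        rw [clip, if_neg]
        rw [abs_le, not_and_or]
        left
        rw [not_le, Int.floor_lt]
        simpa using h2
      rw [hc] at hbd ⊢
      refine ⟨_, Exec.ite_true h1' (Exec.ite_true h2' st0), ?_, hbd⟩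
      · unfold clipFactor
        nlinarith
    · have h2' : ¬ e.eval I σ < (Expr.sub (.const 0) (.load boundAddr)).eval I σ := by
        rw [Expr.eval, hb]
        simpa [Expr.eval] using h2
      have hc : clip M ⌊q⌋ = ⌊q⌋ := by
        refine clip_of_le (abs_le.2 ⟨?_, ?_⟩)
        · rw [Int.le_floor]
          push_cast
          exact not_lt.1 h2
        · rw [← Int.lt_add_one_iff, Int.floor_lt]
          push_cast
          exact h1
      rw [hc] at hbd ⊢
      refine ⟨_, Exec.ite_true h1' (Exec.ite_false h2' st1), ?_, hbd⟩
      · unfold clipFactor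
        nlinarith
  · have h1' : ¬ e.eval I σ < (Expr.add (.load boundAddr) (.const 1)).eval I σ := by
      rw [Expr.eval, hb]
      exact h1
    have hc : clip M ⌊q⌋ = 0 := by
      rw [clip, if_neg]
      rw [abs_le, not_and_or]
      right
      rw [not_le, ← Int.add_one_le_iff, Int.le_floor]
      push_cast
      exact not_lt.1 h1
    rw [hc] at hbd ⊢
    refine ⟨_, Exec.ite_false h1' st0, ?_, hbd⟩
    · unfold clipFactor
      nlinarith

/-- Compiled programs compute what they should, at the predicted cost. -/
theorem Cmd.exec_toProg (hn : 0 < n) (hI : I.Bounded Q) (hQ : M.size + 1 ≤ Q) (hnM : n ≤ M)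
    (c : Cmd) (hc : c.WF) (s : St) (σ : Mem) (hr : Rep n M s σ) (hσ : σ.Bounded Q) :
    ∃ k σ', Exec I c.toProg σ k σ' ∧ k ≤ c.cost n * (Q + 1) ∧
      Rep n M (c.run n I.weight M s) σ' ∧ σ'.Bounded Q := by
  induction c generalizing s σ with
  | set a e =>
    obtain ⟨k, hk, hle, hb⟩ := exec_clipStore hr.size hr.bound hI hσ hQ (varAddr a) e.toExpr
    rw [hr.floor_varAddr, hr.eval_toExpr] at hk hb
    exact ⟨k, _, hk, hle, hr.setVar hn a _, hb⟩
  | put b v e =>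
    obtain ⟨k, hk, hle, hb⟩ := exec_clipStore hr.size hr.bound hI hσ hQ (arrAddr b v) e.toExpr
    rw [hr.floor_arrAddr, hr.eval_toExpr] at hk hb
    exact ⟨k, _, hk, hle, hr.setArr hn b _ _, hb⟩
  | seq c₁ c₂ ih₁ ih₂ =>
    obtain ⟨k₁, σ₁, h₁, hk₁, hr₁, hb₁⟩ := ih₁ hc.1 s σ hr hσ
    obtain ⟨k₂, σ₂, h₂, hk₂, hr₂, hb₂⟩ := ih₂ hc.2 _ σ₁ hr₁ hb₁
    refine ⟨_, σ₂, h₁.seq h₂, ?_, hr₂, hb₂⟩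
    rw [Cmd.cost, add_mul]
    exact add_le_add hk₁ hk₂
  | ite e₁ e₂ c₁ c₂ ih₁ ih₂ =>
    have g₁ := (Expr.cost_le hI hσ e₁.toExpr).1
    have g₂ := (Expr.cost_le hI hσ e₂.toExpr).1
    by_cases h : e₁.val n I.weight s < e₂.val n I.weight s
    · obtain ⟨k, σ', h', hk, hr', hb⟩ := ih₁ hc.1 s σ hr hσ
      refine ⟨_, σ', Exec.ite_true ?_ h', ?_, ?_, hb⟩
      · rwa [hr.eval_toExpr, hr.eval_toExpr]
      · simp only [Cmd.cost]
        nlinarith [Nat.zero_le (c₂.cost n * (Q + 1))]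
      · rwa [Cmd.run, if_pos h]
    · obtain ⟨k, σ', h', hk, hr', hb⟩ := ih₂ hc.2 s σ hr hσ
      refine ⟨_, σ', Exec.ite_false ?_ h', ?_, ?_, hb⟩
      · rwa [hr.eval_toExpr, hr.eval_toExpr]
      · simp only [Cmd.cost]
        nlinarith [Nat.zero_le (c₁.cost n * (Q + 1))]
      · rwa [Cmd.run, if_neg h]
  | loop v c ih =>
    have hctr : ∀ k ≤ n, bitSize ((k : ℕ) : ℚ) ≤ Q := by
      intro k hk
      have := bitSize_intCast_le hQ (z := (k : ℤ)) (by
        rw [Nat.abs_cast]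
        exact_mod_cast hk.trans hnM)
      simpa using this
    -- Here `r` counts the remaining rounds. The extra unit in `r + 1` pays for the final failing
    -- test, and the second one in `n + 2` for resetting the counter.
    have key : ∀ r k, k + r = n → ∀ σ : Mem, Rep n M (iterLoop (c.run n I.weight M) v s k) σ →
        σ.Bounded Q → ∃ K σ', Exec I (.while (.load (ctrAddr v)) (.load (.const 0))
          (.seq c.toProg (.store (ctrAddr v) (.add (.load (ctrAddr v)) (.const 1))))) σ K σ' ∧
          K ≤ (r + 1) * (c.cost n + loopFactor v) * (Q + 1) ∧
          Rep n M (iterLoop (c.run n I.weight M) v s n) σ' ∧ σ'.Bounded Q := by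
      intro r
      induction r with
      | zero =>
        intro k hk σ hr hσ
        have hkn : k = n := by omega
        subst hkn
        have g₁ := (Expr.cost_le hI hσ (.load (ctrAddr v))).1
        have g₂ := (Expr.cost_le hI hσ (.load (.const 0))).1
        refine ⟨_, σ, Exec.while_false ?_, ?_, hr, hσ⟩
        · simp [Expr.eval, hr.floor_ctrAddr, hr.ctr, iterLoop_ctr, hr.size]
        · unfold loopFactor
          nlinarith [Nat.zero_le (c.cost k * (Q + 1))]
      | succ r ihr =>
        intro k hk σ hr hσ
        have g₁ := (Expr.cost_le hI hσ (.load (ctrAddr v))).1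
        have g₂ := (Expr.cost_le hI hσ (.load (.const 0))).1
        obtain ⟨k₁, σ₁, h₁, hk₁, hr₁, hb₁⟩ := ih hc.2 _ σ hr hσ
        have hv : (c.run n I.weight M (iterLoop (c.run n I.weight M) v s k)).ctr v = k := by
          rw [Cmd.run_ctr c hc.1, iterLoop_ctr]
        have g₃ := (Expr.cost_le hI hb₁ (ctrAddr v)).1
        have g₄ := (Expr.cost_le hI hb₁ (.add (.load (ctrAddr v)) (.const 1))).1
        have hst := Exec.store (I := I) (ctrAddr v) (.add (.load (ctrAddr v)) (.const 1)) σ₁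
        have hval : (Expr.add (.load (ctrAddr v)) (.const 1)).eval I σ₁ = ((k + 1 : ℕ) : ℚ) := by
          simp [Expr.eval, hr₁.floor_ctrAddr, hr₁.ctr, hv]
        rw [hr₁.floor_ctrAddr, hval] at hst
        obtain ⟨K, σ', hK, hKle, hr', hb'⟩ := ihr (k + 1) (by omega) _
          (hr₁.setCtr hn v (k + 1)) (hb₁.update _ (hctr (k + 1) (by omega)))
        refine ⟨_, σ', Exec.while_true ?_ (h₁.seq hst) hK, ?_, hr', hb'⟩
        · simp only [Expr.eval, hr.floor_ctrAddr, hr.ctr, iterLoop_ctr,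
            Nat.floor_zero, hr.size]
          exact_mod_cast (by omega : k < n)
        · have e : (r + 1 + 1) * (c.cost n + loopFactor v) * (Q + 1) =
              (r + 1) * (c.cost n + loopFactor v) * (Q + 1) + c.cost n * (Q + 1) +
                loopFactor v * (Q + 1) := by ring
          rw [e]
          have e2 : 2 + (Expr.load (ctrAddr v)).cost I σ + (Expr.load (.const 0)).cost I σ +
              (ctrAddr v).cost I σ₁ + (Expr.add (.load (ctrAddr v)) (.const 1)).cost I σ₁ ≤
              loopFactor v * (Q + 1) := by
            unfold loopFactor
            nlinarith [Nat.zero_le ((Expr.const 0).factor * (Q + 1))]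
          omega
    have g₁ := (Expr.cost_le hI hσ (ctrAddr v)).1
    have g₂ := (Expr.cost_le hI hσ (.const 0)).1
    have hst := Exec.store (I := I) (ctrAddr v) (.const 0) σ
    rw [hr.floor_ctrAddr] at hst
    obtain ⟨K, σ', hK, hKle, hr', hb'⟩ := key n 0 (by omega) (Function.update σ (n + (1 + v)) 0)
      (by simpa [iterLoop] using hr.setCtr hn v 0) (hσ.update _ (by simpa using hctr 0 (by omega)))
    refine ⟨_, σ', hst.seq hK, ?_, hr', hb'⟩
    have e2 : 1 + (ctrAddr v).cost I σ + (Expr.const 0).cost I σ ≤ loopFactor v * (Q + 1) := by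
      unfold loopFactor
      nlinarith [Nat.zero_le ((Expr.add (.load (ctrAddr v)) (.const 1)).factor * (Q + 1)),
        Nat.zero_le ((Expr.load (ctrAddr v)).factor * (Q + 1)),
        Nat.zero_le ((Expr.load (.const 0)).factor * (Q + 1))]
    have e : (n + 2) * (c.cost n + loopFactor v) * (Q + 1) =
        (n + 1) * (c.cost n + loopFactor v) * (Q + 1) + c.cost n * (Q + 1) +
          loopFactor v * (Q + 1) := by ring
    simp only [Cmd.cost]
    rw [e]
    omega
  | skip =>
    refine ⟨1, σ, Exec.skip σ, ?_, hr, hσ⟩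
    simp only [Cmd.cost]
    omega

end Simulation

/-! ### Frames and elementary loops -/

/-- The states `s` and `s'` agree except for the counters in `C`, the variables in `A` and the
arrays in `B`. -/
structure Agree (C A B : List (Fin 8)) (s s' : St) : Prop where
  ctr : ∀ v, v ∉ C → s'.ctr v = s.ctr v
  var : ∀ a, a ∉ A → s'.var a = s.var a
  arr : ∀ b, b ∉ B → s'.arr b = s.arr b

theorem Agree.refl (C A B : List (Fin 8)) (s : St) : Agree C A B s s :=
  ⟨fun _ _ => rfl, fun _ _ => rfl, fun _ _ => rfl⟩

theorem Agree.trans {C A B : List (Fin 8)} {s s' s'' : St} (h : Agree C A B s s')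
    (h' : Agree C A B s' s'') : Agree C A B s s'' :=
  ⟨fun v hv => (h'.ctr v hv).trans (h.ctr v hv), fun a ha => (h'.var a ha).trans (h.var a ha),
    fun b hb => (h'.arr b hb).trans (h.arr b hb)⟩

theorem Agree.mono {C A B C' A' B' : List (Fin 8)} {s s' : St} (h : Agree C A B s s')
    (hC : C ⊆ C') (hA : A ⊆ A') (hB : B ⊆ B') : Agree C' A' B' s s' :=
  ⟨fun v hv => h.ctr v fun hh => hv (hC hh), fun a ha => h.var a fun hh => ha (hA hh),
    fun b hb => h.arr b fun hh => hb (hB hh)⟩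

theorem agree_setCtr {C A B : List (Fin 8)} (s : St) {v : Fin 8} (hv : v ∈ C) (k : ℕ) :
    Agree C A B s (s.setCtr v k) :=
  ⟨fun u hu => Function.update_of_ne (show u ≠ v from fun h => hu (h ▸ hv)) _ _,
    fun _ _ => rfl, fun _ _ => rfl⟩

theorem agree_setVar {C A B : List (Fin 8)} (s : St) {a : Fin 8} (ha : a ∈ A) (z : ℤ) :
    Agree C A B s (s.setVar a z) :=
  ⟨fun _ _ => rfl, fun u hu => Function.update_of_ne (show u ≠ a from fun h => hu (h ▸ ha)) _ _,
    fun _ _ => rfl⟩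

theorem agree_setArr {C A B : List (Fin 8)} (s : St) {b : Fin 8} (hb : b ∈ B) (i : ℕ) (z : ℤ) :
    Agree C A B s (s.setArr b i z) :=
  ⟨fun _ _ => rfl, fun _ _ => rfl,
    fun u hu => Function.update_of_ne (show u ≠ b from fun h => hu (h ▸ hb)) _ _⟩

/-- The program changes only the counters in `C`, the variables in `A` and the arrays in `B`. -/
def Cmd.within (C A B : List (Fin 8)) : Cmd → Bool
  | set a _ => decide (a ∈ A)
  | put b _ _ => decide (b ∈ B)
  | seq c₁ c₂ => c₁.within C A B && c₂.within C A B
  | ite _ _ c₁ c₂ => c₁.within C A B && c₂.within C A B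
  | loop v c => decide (v ∈ C) && c.within C A B
  | skip => true

section Loops

variable {n : ℕ} {W : ℕ → ℕ → ℚ} {M : ℕ}

theorem Cmd.agree_run {C A B : List (Fin 8)} (c : Cmd) (h : c.within C A B = true) (s : St) :
    Agree C A B s (c.run n W M s) := by
  induction c generalizing s with
  | set a e => exact agree_setVar s (of_decide_eq_true h) _
  | put b v e => exact agree_setArr s (of_decide_eq_true h) _ _
  | seq c₁ c₂ ih₁ ih₂ =>
    simp only [within, Bool.and_eq_true] at h
    exact (ih₁ h.1 s).trans (ih₂ h.2 _)
  | ite e₁ e₂ c₁ c₂ ih₁ ih₂ =>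
    simp only [within, Bool.and_eq_true] at h
    simp only [run]
    split_ifs
    · exact ih₁ h.1 s
    · exact ih₂ h.2 s
  | loop v c ih =>
    simp only [within, Bool.and_eq_true] at h
    have hv := of_decide_eq_true h.1
    refine run_loop (fun _ s' => Agree C A B s s') (agree_setCtr s hv 0) ?_
    intro k _ s' _ hs'
    exact (hs'.trans (ih h.2 s')).trans (agree_setCtr _ hv _)
  | skip => exact Agree.refl _ _ _ _

@[simp] theorem setCtr_ctr_same (s : St) (v : Fin 8) (k : ℕ) : (s.setCtr v k).ctr v = k := by
  simp [St.setCtr]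

@[simp] theorem setCtr_var (s : St) (v : Fin 8) (k : ℕ) : (s.setCtr v k).var = s.var := rfl

@[simp] theorem setCtr_arr (s : St) (v : Fin 8) (k : ℕ) : (s.setCtr v k).arr = s.arr := rfl

@[simp] theorem setVar_ctr (s : St) (a : Fin 8) (z : ℤ) : (s.setVar a z).ctr = s.ctr := rfl

@[simp] theorem setVar_arr (s : St) (a : Fin 8) (z : ℤ) : (s.setVar a z).arr = s.arr := rfl

@[simp] theorem setVar_var_same (s : St) (a : Fin 8) (z : ℤ) : (s.setVar a z).var a = z := by
  simp [St.setVar]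

@[simp] theorem setArr_arr_same (s : St) (b : Fin 8) (i : ℕ) (z : ℤ) :
    (s.setArr b i z).arr b = Function.update (s.arr b) i z := by
  simp [St.setArr]

theorem abs_sum_range_le {g : ℕ → ℤ} {G : ℤ} {k : ℕ} (hb : ∀ i < k, |g i| ≤ G) :
    |∑ i ∈ Finset.range k, g i| ≤ k * G := by
  refine (Finset.abs_sum_le_sum_abs _ _).trans ?_
  refine (Finset.sum_le_card_nsmul _ _ G fun i hi => hb i (Finset.mem_range.1 hi)).trans ?_
  simp

/-- Accumulating a sum in a variable. -/
theorem run_sumVar {u a : Fin 8} {e : Term} {s : St} (g : ℕ → ℤ) {G : ℤ}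
    (hb : ∀ k < n, |g k| ≤ G) (hM : |s.var a| + n * G ≤ M)
    (he : ∀ k < n, ∀ s', s'.ctr u = k → Agree [u] [a] [] s s' → e.val n W s' = g k) :
    ((Cmd.loop u (.set a (.add (.var a) e))).run n W M s).var a =
      s.var a + ∑ k ∈ Finset.range n, g k := by
  have h := Cmd.run_loop (n := n) (W := W) (M := M) (v := u)
    (c := .set a (.add (.var a) e)) (s := s)
    (fun k s' => s'.var a = s.var a + ∑ i ∈ Finset.range k, g i ∧ Agree [u] [a] [] s s')
    ⟨by simp, agree_setCtr s (by simp) 0⟩ (by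
      rintro k hk s' hu ⟨h1, h2⟩
      refine ⟨?_, (h2.trans (agree_setVar _ (by simp) _)).trans (agree_setCtr _ (by simp) _)⟩
      have hv : ⌊(Term.add (.var a) e).val n W s'⌋ = s.var a + ∑ i ∈ Finset.range (k + 1), g i := by
        rw [Term.val, he k hk s' hu h2, Term.val, h1, Finset.sum_range_succ, ← Int.cast_add,
          Int.floor_intCast, add_assoc]
      simp only [Cmd.run, setCtr_var, setVar_var_same, hv]
      -- Every partial sum stays within the bound, so clipping is inactive.
      refine clip_of_le ((abs_add_le _ _).trans (le_trans ?_ hM))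
      have h3 := abs_sum_range_le (g := g) (G := G) (k := k + 1) fun i hi => hb i (by omega)
      have hG : 0 ≤ G := (abs_nonneg _).trans (hb k hk)
      have : ((k + 1 : ℕ) : ℤ) * G ≤ n * G :=
        mul_le_mul_of_nonneg_right (by exact_mod_cast hk) hG
      linarith)
  exact h.1

/-- Compute a double sum. -/
def sum₂ (a : Fin 8) (e : Term) : Cmd :=
  .seq (.set a (.const 0)) (.loop 4 (.loop 5 (.set a (.add (.var a) e))))

theorem run_sum₂ {a : Fin 8} {e : Term} {s : St} (g : ℕ → ℕ → ℤ) {G : ℤ}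
    (hb : ∀ j < n, ∀ l < n, |g j l| ≤ G) (hM : n * (n * G) ≤ M)
    (he : ∀ j < n, ∀ l < n, ∀ s', s'.ctr 4 = j → s'.ctr 5 = l → Agree [4, 5] [a] [] s s' →
      e.val n W s' = g j l) :
    ((sum₂ a e).run n W M s).var a =
      ∑ j ∈ Finset.range n, ∑ l ∈ Finset.range n, g j l := by
  set s₀ := s.setVar a 0 with hs₀
  have e0 : (sum₂ a e).run n W M s =
      (Cmd.loop 4 (.loop 5 (.set a (.add (.var a) e)))).run n W M s₀ := by
    simp [sum₂, Cmd.run, Term.val, clip, hs₀]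
  rw [e0]
  have hs : Agree [4, 5] [a] [] s s₀ := agree_setVar s (by simp) 0
  have h := Cmd.run_loop (n := n) (W := W) (M := M) (v := 4)
    (c := .loop 5 (.set a (.add (.var a) e))) (s := s₀)
    (fun k s' => s'.var a = ∑ i ∈ Finset.range k, ∑ l ∈ Finset.range n, g i l ∧
      Agree [4, 5] [a] [] s s')
    ⟨by simp [hs₀], hs.trans (agree_setCtr _ (by simp) 0)⟩ (by
      rintro k hk s' hu ⟨h1, h2⟩
      have hin : Agree [5] [a] [] s' ((Cmd.loop 5 (.set a (.add (.var a) e))).run n W M s') :=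
        Cmd.agree_run _ (by simp [Cmd.within]) s'
      refine ⟨?_, (h2.trans (hin.mono (by simp) (by simp) (by simp))).trans
        (agree_setCtr _ (by simp) _)⟩
      have hG : 0 ≤ n * G := by
        have : 0 ≤ G := (abs_nonneg _).trans (hb k hk k hk)
        positivity
      have hrow : ∀ i < n, |∑ l ∈ Finset.range n, g i l| ≤ n * G := fun i hi =>
        abs_sum_range_le fun l hl => hb i hi l hl
      rw [setCtr_var, run_sumVar (g k) (G := G) (fun l hl => hb k hk l hl), h1,
        Finset.sum_range_succ]
      · rw [h1]
        have h3 := abs_sum_range_le (g := fun i => ∑ l ∈ Finset.range n, g i l) (G := n * G)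
          (k := k)
          fun i hi => hrow i (by omega)
        have h4 : ((k + 1 : ℕ) : ℤ) * (n * G) ≤ n * (n * G) :=
          mul_le_mul_of_nonneg_right (by exact_mod_cast hk) hG
        push_cast at h4
        linarith
      · intro l hl s'' h5 hag
        refine he k hk l hl s'' ?_ h5 (h2.trans (hag.mono (by simp) (by simp) (by simp)))
        rw [hag.ctr 4 (by decide), hu])
  exact h.1

/-- Computing the entries of an array one after the other. -/
theorem run_map {b : Fin 8} {c : Cmd} {s : St} (g : ℕ → ℤ) (hc : c.within [5] [] [b] = true)
    (he : ∀ k < n, ∀ s', s'.ctr 4 = k → Agree [4, 5] [] [b] s s' → s'.arr b k = s.arr b k →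
      (c.run n W M s').arr b = Function.update (s'.arr b) k (g k)) :
    ∀ k < n, ((Cmd.loop 4 c).run n W M s).arr b k = g k := by
  -- The invariant also records that entries not yet visited are unchanged, because a new entry may
  -- be computed from the old one in the same cell.
  have h := Cmd.run_loop (n := n) (W := W) (M := M) (v := 4) (c := c) (s := s)
    (fun k s' => (∀ i < k, s'.arr b i = g i) ∧ (∀ i, k ≤ i → s'.arr b i = s.arr b i) ∧
      Agree [4, 5] [] [b] s s')
    ⟨by simp, by simp, agree_setCtr s (by simp) 0⟩ (by
      rintro k hk s' hu ⟨h1, h2, h3⟩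
      have hin : Agree [5] [] [b] s' (c.run n W M s') := Cmd.agree_run _ hc s'
      have hr := he k hk s' hu h3 (h2 k le_rfl)
      refine ⟨fun i hi => ?_, fun i hi => ?_, (h3.trans (hin.mono (by simp) (by simp)
        (by simp))).trans (agree_setCtr _ (by simp) _)⟩
      · rw [setCtr_arr, hr]
        rcases eq_or_ne i k with rfl | hik
        · simp
        · rw [Function.update_of_ne hik, h1 i (by omega)]
      · rw [setCtr_arr, hr, Function.update_of_ne (by omega), h2 i (by omega)])
  exact h.1

theorem run_put_arr {b v : Fin 8} {e : Term} {s : St} {z : ℤ} (he : e.val n W s = z)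
    (hz : |z| ≤ M) :
    ((Cmd.put b v e).run n W M s).arr b = Function.update (s.arr b) (s.ctr v) z := by
  simp only [Cmd.run, he, Int.floor_intCast, clip_of_le hz, setArr_arr_same]

/-- Compute the row sums of a matrix. -/
def rowSums (b : Fin 8) (e : Term) : Cmd :=
  .loop 4 (.seq (.put b 4 (.const 0)) (.loop 5 (.put b 4 (.add (.arr b 4) e))))

theorem run_rowSums {b : Fin 8} {e : Term} {s : St} (g : ℕ → ℕ → ℤ) {G : ℤ}
    (hb : ∀ j < n, ∀ l < n, |g j l| ≤ G) (hM : n * G ≤ M)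
    (he : ∀ j < n, ∀ l < n, ∀ s', s'.ctr 4 = j → s'.ctr 5 = l → Agree [4, 5] [] [b] s s' →
      e.val n W s' = g j l) :
    ∀ j < n, ((rowSums b e).run n W M s).arr b j = ∑ l ∈ Finset.range n, g j l := by
  refine run_map _ (by simp [Cmd.within]) ?_
  intro j hj s' hu hag _
  rw [Cmd.run]
  set s₀ := (Cmd.put b 4 (.const 0)).run n W M s' with hs₀
  have hs₀b : s₀.arr b = Function.update (s'.arr b) j 0 := by
    rw [hs₀, run_put_arr (z := 0) (by simp [Term.val]) (by simp), hu]
  have hs₀a : Agree [5] [] [b] s' s₀ := Cmd.agree_run _ (by simp [Cmd.within]) s'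
  have h := Cmd.run_loop (n := n) (W := W) (M := M) (v := 5)
    (c := .put b 4 (.add (.arr b 4) e)) (s := s₀)
    (fun k s'' => s''.arr b = Function.update (s'.arr b) j (∑ i ∈ Finset.range k, g j i) ∧
      Agree [5] [] [b] s' s'')
    ⟨by simp [hs₀b], hs₀a.trans (agree_setCtr _ (by simp) 0)⟩ (by
      rintro k hk s'' hu' ⟨h1, h2⟩
      have hin : Agree [5] [] [b] s'' ((Cmd.put b 4 (.add (.arr b 4) e)).run n W M s'') :=
        Cmd.agree_run _ (by simp [Cmd.within]) s''
      refine ⟨?_, (h2.trans hin).trans (agree_setCtr _ (by simp) _)⟩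
      have h4 : s''.ctr 4 = j := by rw [h2.ctr 4 (by decide), hu]
      rw [setCtr_arr, run_put_arr (z := ∑ i ∈ Finset.range (k + 1), g j i), h4, h1,
        Function.update_idem]
      · rw [Term.val, he j hj k hk s'' h4 hu' (hag.trans (h2.mono (by simp) (by simp) (by simp))),
          Term.val, h4, h1, Function.update_self, Finset.sum_range_succ, ← Int.cast_add]
      · have hG : 0 ≤ G := (abs_nonneg _).trans (hb j hj k hk)
        refine (abs_sum_range_le (G := G) fun i hi => hb j hj i (by omega)).trans (le_trans ?_ hM)
        exact mul_le_mul_of_nonneg_right (by exact_mod_cast hk) hG)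
  exact h.1

end Loops

/-! ### The rounding program

Counters `0, …, 5` run through rounds, starting vertices, walk lengths, thresholds, rows and
columns. Variables `0` and `1` hold the ends of a heaviest edge, `2`, `3` and `4` the volume, the quadratic
form and the cross term of the candidate, `5` the product of the degrees, `6` a sign. Arrays
`0, …, 4` hold the partial cut, the degrees, the scaled walk, its image, and the candidate. -/

/-- The weights, scaled to integers of size at most `n ^ 3`. -/
def weightTerm (u v : Fin 8) : Term :=
  .floor (.div (.mul (.weight (.ctr u) (.ctr v)) (.mul .size (.mul .size .size)))
    (.weight (.var 0) (.var 1)))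

/-- The indicator of an open vertex. -/
def openTerm (v : Fin 8) : Term := .sub (.const 1) (.mul (.arr 0 v) (.arr 0 v))

/-- The scaled weights between open vertices. -/
def openWeightTerm (u v : Fin 8) : Term := .mul (weightTerm u v) (.mul (openTerm u) (openTerm v))

/-- Compute the degrees. -/
def degreeCmd : Cmd := rowSums 1 (openWeightTerm 4 5)

/-- Compute the product of the nonzero degrees. -/
def prodCmd : Cmd :=
  .seq (.set 5 (.const 1))
    (.loop 4 (.ite (.const 0) (.arr 1 4) (.set 5 (.mul (.var 5) (.arr 1 4))) .skip))

/-- Start the walk. -/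
def initCmd : Cmd := .seq (.loop 4 (.put 2 4 (.const 0))) (.put 2 1 (.const 1))

/-- Compute the candidate. -/
def sweepCmd : Cmd :=
  .loop 4 (.ite (.mul (.arr 2 4) (.arr 2 4)) (.mul (.arr 2 3) (.arr 2 3)) (.put 4 4 (.const 0))
    (.ite (.arr 2 4) (.const 0) (.put 4 4 (.sub (.const 0) (openTerm 4)))
      (.ite (.const 0) (.arr 2 4) (.put 4 4 (openTerm 4)) (.put 4 4 (.const 0)))))

/-- Compute the quantities that decide whether the candidate is used. -/
def measureCmd : Cmd :=
  .seq (sum₂ 2 (.mul (openWeightTerm 4 5) (.mul (.arr 4 4) (.arr 4 4))))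
    (.seq (sum₂ 3 (.mul (openWeightTerm 4 5) (.mul (.arr 4 4) (.arr 4 5))))
      (sum₂ 4 (.mul (weightTerm 4 5) (.mul (.arr 4 4) (.arr 0 5)))))

/-- Add the candidate to the partial cut, with the better sign. -/
def extendCmd : Cmd :=
  .seq (.set 6 (.const 1))
    (.seq (.ite (.const 0) (.var 4) (.set 6 (.const (-1))) .skip)
      (.loop 4 (.put 0 4 (.add (.arr 0 4) (.mul (.var 6) (.arr 4 4))))))

/-- Try a candidate. -/
def tryCmd : Cmd :=
  .seq sweepCmd (.seq measureCmd
    (.ite (.const 0) (.var 2)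
      (.ite (.var 2) (.sub (.const 1) (.mul (.const 2) (.var 3))) extendCmd .skip) .skip))

/-- Advance the walk by one step. -/
def stepCmd : Cmd :=
  .seq (rowSums 3 (.mul (openWeightTerm 4 5) (.arr 2 5)))
    (.loop 4 (.put 2 4
      (.sub (.mul (.var 5) (.arr 2 4)) (.mul (.div (.var 5) (.arr 1 4)) (.arr 3 4)))))

/-- Try the candidates that arise from one starting vertex. -/
def startCmd : Cmd :=
  .seq degreeCmd (.seq prodCmd (.seq initCmd (.loop 2 (.seq (.loop 3 tryCmd) stepCmd))))

/-- The main part of the program. -/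
def searchCmd : Cmd := .loop 0 (.loop 1 startCmd)

/-- Find a heaviest edge. -/
def heaviestCmd : Cmd :=
  .seq (.set 0 (.const 0)) (.seq (.set 1 (.const 0))
    (.loop 4 (.loop 5 (.ite (.weight (.var 0) (.var 1)) (.weight (.ctr 4) (.ctr 5))
      (.seq (.set 0 (.ctr 4)) (.set 1 (.ctr 5))) .skip))))

/-- Decide the remaining vertices greedily. -/
def fillCmd : Cmd :=
  .loop 1 (.seq (.set 4 (.const 0))
    (.seq (.loop 5 (.set 4 (.add (.var 4) (.mul (weightTerm 1 5) (.arr 0 5)))))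
      (.ite (.mul (.arr 0 1) (.arr 0 1)) (.const 1)
        (.ite (.const 0) (.var 4) (.put 0 1 (.const (-1))) (.put 0 1 (.const 1))) .skip)))

/-- The structured part of the rounding program. -/
def cutCmd : Cmd := .seq heaviestCmd (.seq searchCmd fillCmd)

/-! ### Correctness -/

/-- The scaled weights, when `(p, q)` is a heaviest edge. -/
def scaled (n : ℕ) (W : ℕ → ℕ → ℚ) (p q : ℤ) (j l : ℕ) : ℤ :=
  ⌊W j l * (n * (n * n)) / W p.toNat q.toNat⌋

/-- The scaled weights as real numbers. -/
def scaledWeight (n : ℕ) (W : ℕ → ℕ → ℚ) (p q : ℤ) (i j : Fin n) : ℝ := scaled n W p q i j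

/-- The first `n` entries of an array. -/
def entries (n : ℕ) (x : ℕ → ℤ) (i : Fin n) : ℤ := x i

/-- Standing assumptions on the input. -/
structure Setup (n : ℕ) (W : ℕ → ℕ → ℚ) (M : ℕ) (p q : ℤ) : Prop where
  three_le : 3 ≤ n
  big : (n : ℤ) ^ 4 * (2 * ((n : ℤ) ^ 4) ^ n) ^ n ≤ M
  nonneg : ∀ j < n, ∀ l < n, 0 ≤ scaled n W p q j l
  le : ∀ j < n, ∀ l < n, scaled n W p q j l ≤ n ^ 3
  symm : ∀ j l, scaled n W p q j l = scaled n W p q l j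
  loopless : ∀ j, scaled n W p q j j = 0

theorem abs_le_one_of_isPartial {n : ℕ} {x : ℕ → ℤ} (hx : IsPartial (entries n x)) {j : ℕ}
    (hj : j < n) : |x j| ≤ 1 := by
  rcases hx ⟨j, hj⟩ with h | h | h <;> simp only [entries] at h <;> simp [h]

theorem one_sub_sq_of_isPartial {n : ℕ} {x : ℕ → ℤ} (hx : IsPartial (entries n x)) {j : ℕ}
    (hj : j < n) : 1 - x j * x j = 0 ∨ 1 - x j * x j = 1 := by
  rcases hx ⟨j, hj⟩ with h | h | h <;> simp only [entries] at h <;> simp [h]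

theorem cast_sum_range₂ {n : ℕ} (g : ℕ → ℕ → ℤ) :
    ((∑ j ∈ Finset.range n, ∑ l ∈ Finset.range n, g j l : ℤ) : ℝ) =
      ∑ i : Fin n, ∑ j : Fin n, (g i j : ℝ) := by
  rw [Finset.sum_range]
  push_cast
  refine Finset.sum_congr rfl fun i _ => ?_
  rw [Finset.sum_range]

section Correct

variable {n : ℕ} {W : ℕ → ℕ → ℚ} {M : ℕ} {p q : ℤ}

theorem weightTerm_val {s : St} (hp : s.var 0 = p) (hq : s.var 1 = q) (u v : Fin 8) :
    (weightTerm u v).val n W s = scaled n W p q (s.ctr u) (s.ctr v) := by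
  simp only [weightTerm, Term.val, hp, hq, Nat.floor_natCast, scaled]
  rw [← Int.floor_toNat, ← Int.floor_toNat, Int.floor_intCast, Int.floor_intCast]

theorem openWeightTerm_val {s : St} (hp : s.var 0 = p) (hq : s.var 1 = q) (u v : Fin 8) :
    (openWeightTerm u v).val n W s = (scaled n W p q (s.ctr u) (s.ctr v) *
      ((1 - s.arr 0 (s.ctr u) * s.arr 0 (s.ctr u)) *
        (1 - s.arr 0 (s.ctr v) * s.arr 0 (s.ctr v))) : ℤ) := by
  rw [openWeightTerm, Term.val, weightTerm_val hp hq]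
  simp only [openTerm, Term.val]
  push_cast
  rfl

/-- Scaled weights between open vertices. -/
def openScaled (n : ℕ) (W : ℕ → ℕ → ℚ) (p q : ℤ) (x : ℕ → ℤ) (j l : ℕ) : ℤ :=
  scaled n W p q j l * ((1 - x j * x j) * (1 - x l * x l))

theorem openScaled_cast (x : ℕ → ℤ) (i j : Fin n) :
    (openScaled n W p q x i j : ℝ) = openWeight (scaledWeight n W p q) (entries n x) i j := by
  simp [openScaled, openWeight, scaledWeight, entries]

theorem Setup.abs_openScaled_le (h : Setup n W M p q) {x : ℕ → ℤ}
    (hx : IsPartial (entries n x)) {j l : ℕ} (hj : j < n) (hl : l < n) :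
    0 ≤ openScaled n W p q x j l ∧ openScaled n W p q x j l ≤ n ^ 3 := by
  have h1 := h.nonneg j hj l hl
  have h2 := h.le j hj l hl
  have h3 : (0 : ℤ) ≤ n ^ 3 := by positivity
  unfold openScaled
  rcases one_sub_sq_of_isPartial hx hj with e | e <;>
    rcases one_sub_sq_of_isPartial hx hl with e' | e' <;> rw [e, e'] <;> simp [h1, h2, h3]

/-- The walk part of the bound on all numbers. -/
theorem Setup.pow_le (h : Setup n W M p q) : (n : ℤ) ^ 4 ≤ M ∧ ((n : ℤ) ^ 4) ^ n ≤ M ∧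
    (n : ℤ) ^ 4 * (2 * ((n : ℤ) ^ 4) ^ n) ^ n ≤ M := by
  have hn : (1 : ℤ) ≤ n := by exact_mod_cast (by have := h.three_le; omega : 1 ≤ n)
  have h4 : (1 : ℤ) ≤ (n : ℤ) ^ 4 := one_le_pow₀ hn
  have h5 : (1 : ℤ) ≤ ((n : ℤ) ^ 4) ^ n := one_le_pow₀ h4
  have h6 : (1 : ℤ) ≤ 2 * ((n : ℤ) ^ 4) ^ n := by linarith
  have h7 : 2 * ((n : ℤ) ^ 4) ^ n ≤ (2 * ((n : ℤ) ^ 4) ^ n) ^ n :=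
    le_self_pow₀ h6 (by have := h.three_le; omega)
  have h8 := h.big
  refine ⟨?_, ?_, h8⟩ <;> nlinarith

/-! #### Candidates -/

theorem run_sweepCmd (hM : 1 ≤ M) {s : St} (hx : IsPartial (entries n (s.arr 0))) :
    ∀ j < n, (sweepCmd.run n W M s).arr 4 j = mask (s.arr 0) (sweep (s.arr 2) (s.ctr 3)) j := by
  have hM' : (1 : ℤ) ≤ M := by exact_mod_cast hM
  refine run_map _ (by decide) ?_
  intro k hk s' h4 hag _
  have e0 : s'.arr 0 = s.arr 0 := hag.arr 0 (by decide)
  have e2 : s'.arr 2 = s.arr 2 := hag.arr 2 (by decide)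
  have e3 : s'.ctr 3 = s.ctr 3 := hag.ctr 3 (by decide)
  have ho : |1 - s.arr 0 k * s.arr 0 k| ≤ M := by
    rcases one_sub_sq_of_isPartial hx hk with e | e <;> rw [e] <;> simp [hM']
  have hopen : (openTerm 4).val n W s' = ((1 - s.arr 0 k * s.arr 0 k : ℤ) : ℚ) := by
    simp only [openTerm, Term.val, h4, e0]
    push_cast
    rfl
  have hput : ∀ (e : Term) (z : ℤ), e.val n W s' = z → |z| ≤ M →
      ((Cmd.put 4 4 e).run n W M s').arr 4 = Function.update (s'.arr 4) k z := by
    intro e z he hz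
    rw [run_put_arr he hz, h4]
  unfold mask sweep
  rw [Cmd.run]
  by_cases h1 : s.arr 2 k * s.arr 2 k < s.arr 2 (s.ctr 3) * s.arr 2 (s.ctr 3)
  · rw [if_pos (by simp only [Term.val, h4, e2, e3]; exact_mod_cast h1),
      hput _ 0 (by simp [Term.val]) (by simp), if_pos h1, zero_mul]
  · rw [if_neg (by simp only [Term.val, h4, e2, e3]; exact_mod_cast h1), if_neg h1, Cmd.run]
    by_cases h2 : s.arr 2 k < 0
    · rw [if_pos (by simp only [Term.val, h4, e2]; exact_mod_cast h2), if_pos h2]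
      rw [hput _ (-1 * (1 - s.arr 0 k * s.arr 0 k))]
      · rw [Term.val, hopen]
        simp [Term.val]
      · rw [abs_mul]
        simpa using ho
    · rw [if_neg (by simp only [Term.val, h4, e2]; exact_mod_cast h2), if_neg h2, Cmd.run]
      by_cases h3 : 0 < s.arr 2 k
      · rw [if_pos (by simp only [Term.val, h4, e2]; exact_mod_cast h3), if_pos h3, one_mul]
        exact hput _ _ hopen ho
      · rw [if_neg (by simp only [Term.val, h4, e2]; exact_mod_cast h3), if_neg h3, zero_mul]
        exact hput _ 0 (by simp [Term.val]) (by simp)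

theorem run_extendCmd (hM : 1 ≤ M) {s : St} (hx : IsPartial (entries n (s.arr 0)))
    (hz : IsPartial (entries n (s.arr 4))) (hxz : ∀ j < n, s.arr 0 j ≠ 0 → s.arr 4 j = 0) :
    ∃ σ : ℤ, (σ = 1 ∨ σ = -1) ∧ σ * s.var 4 ≤ 0 ∧
      ∀ j < n, (extendCmd.run n W M s).arr 0 j = s.arr 0 j + σ * s.arr 4 j := by
  have hM' : (1 : ℤ) ≤ M := by exact_mod_cast hM
  obtain ⟨s₁, σ, hσ, hc, h6, h0, h4, hr⟩ : ∃ (s₁ : St) (σ : ℤ), (σ = 1 ∨ σ = -1) ∧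
      σ * s.var 4 ≤ 0 ∧ s₁.var 6 = σ ∧ s₁.arr 0 = s.arr 0 ∧ s₁.arr 4 = s.arr 4 ∧
      extendCmd.run n W M s = (Cmd.loop 4 (.put 0 4 (.add (.arr 0 4)
        (.mul (.var 6) (.arr 4 4))))).run n W M s₁ := by
    by_cases h : 0 < s.var 4
    · refine ⟨(s.setVar 6 1).setVar 6 (-1), -1, by simp, by simpa using h.le, by simp, rfl, rfl, ?_⟩
      have : (Term.const 0).val n W (s.setVar 6 1) < (Term.var 4).val n W (s.setVar 6 1) := by
        simpa [Term.val, St.setVar] using h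
      simp only [extendCmd, Cmd.run]
      simp only [Term.val, Int.floor_intCast, clip_of_le (show |(1 : ℤ)| ≤ M by simpa using hM'),
        clip_of_le (show |(-1 : ℤ)| ≤ M by simpa using hM')]
      simp only [Term.val] at this
      rw [if_pos this]
    · refine ⟨s.setVar 6 1, 1, by simp, by simpa using h, by simp, rfl, rfl, ?_⟩
      have : ¬ (Term.const 0).val n W (s.setVar 6 1) < (Term.var 4).val n W (s.setVar 6 1) := by
        simpa [Term.val, St.setVar] using h
      simp only [extendCmd, Cmd.run]
      simp only [Term.val, Int.floor_intCast, clip_of_le (show |(1 : ℤ)| ≤ M by simpa using hM')]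
      simp only [Term.val] at this
      rw [if_neg this]
  refine ⟨σ, hσ, hc, ?_⟩
  rw [hr]
  refine run_map _ (by decide) ?_
  intro k hk s' hk4 hag hsame
  have e4 : s'.arr 4 = s.arr 4 := by rw [hag.arr 4 (by decide), h4]
  have e6 : s'.var 6 = σ := by rw [hag.var 6 (by simp), h6]
  have hx1 : s'.arr 0 k = s.arr 0 k := by rw [hsame, h0]
  rw [run_put_arr (z := s.arr 0 k + σ * s.arr 4 k), hk4]
  · simp only [Term.val, hk4, hx1, e4, e6]
    push_cast
    rfl
  · refine le_trans ?_ hM'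
    have := isPartial_add hx hz (fun i => hxz i i.2) hσ ⟨k, hk⟩
    simp only [entries] at this
    rcases this with h | h | h <;> rw [h] <;> simp

/-- The partial cut `x'` extends `x`. -/
def Extends {V : Type*} (x x' : V → ℤ) : Prop := ∀ i, x i ≠ 0 → x' i = x i

theorem Extends.refl {V : Type*} (x : V → ℤ) : Extends x x := fun _ _ => rfl

theorem Extends.trans {V : Type*} {x x' x'' : V → ℤ} (h : Extends x x') (h' : Extends x' x'') :
    Extends x x'' := by
  intro i hi
  rw [← h i hi]
  exact h' i (by rwa [h i hi])

theorem Extends.ne {V : Type*} {x x' x'' : V → ℤ} (h : Extends x x') (hne : x' ≠ x)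
    (h' : Extends x' x'') : x'' ≠ x := by
  obtain ⟨i, hi⟩ := Function.ne_iff.1 hne
  have hx : x i = 0 := by
    by_contra hx
    exact hi (h i hx)
  have hx' : x' i ≠ 0 := by rwa [hx] at hi
  intro he
  rw [← he, h' i hx'] at hx
  exact hx' hx

theorem Extends.numOpen_lt {V : Type*} [Fintype V] {x x' : V → ℤ} (h : Extends x x')
    (hne : x' ≠ x) : numOpen x' < numOpen x := by
  obtain ⟨i, hi⟩ := Function.ne_iff.1 hne
  have hx : x i = 0 := by
    by_contra hx
    exact hi (h i hx)
  refine Finset.card_lt_card ⟨fun j hj => ?_, fun hsub => ?_⟩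
  · simp only [Finset.mem_filter, Finset.mem_univ, true_and] at hj ⊢
    by_contra hxj
    rw [h j hxj] at hj
    exact hxj hj
  · have := hsub (show i ∈ _ by simpa using hx)
    simp only [Finset.mem_filter, Finset.mem_univ, true_and] at this
    rw [this, hx] at hi
    exact hi rfl

theorem Extends.sum_openWeight_le {V : Type*} [Fintype V] {w : V → V → ℝ}
    (hn : ∀ i j, 0 ≤ w i j) {x x' : V → ℤ} (h : Extends x x') (hx : IsPartial x)
    (hx' : IsPartial x') :
    ∑ i, ∑ j, openWeight w x' i j ≤ ∑ i, ∑ j, openWeight w x i j := by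
  have h1 : ∀ i, (0 : ℝ) ≤ 1 - x' i * x' i ∧ (1 - x' i * x' i : ℝ) ≤ 1 - x i * x i := by
    intro i
    by_cases hi : x i = 0
    · rcases hx' i with e | e | e <;> simp [hi, e]
    · rw [h i hi]
      rcases hx i with e | e | e <;> simp [e]
  refine Finset.sum_le_sum fun i _ => Finset.sum_le_sum fun j _ => ?_
  exact mul_le_mul_of_nonneg_left
    (mul_le_mul (h1 i).2 (h1 j).2 (h1 j).1 ((h1 i).1.trans (h1 i).2)) (hn i j)

/-- The invariant of the search. -/
structure Inv (n : ℕ) (W : ℕ → ℕ → ℚ) (p q : ℤ) (s : St) : Prop where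
  part : IsPartial (entries n (s.arr 0))
  ahead : IsAhead (scaledWeight n W p q) (entries n (s.arr 0))
  p_eq : s.var 0 = p
  q_eq : s.var 1 = q

theorem Inv.congr {s s' : St} (h : Inv n W p q s) (h0 : s'.arr 0 = s.arr 0)
    (hp : s'.var 0 = s.var 0) (hq : s'.var 1 = s.var 1) : Inv n W p q s' :=
  ⟨by rw [h0]; exact h.part, by rw [h0]; exact h.ahead, by rw [hp]; exact h.p_eq,
    by rw [hq]; exact h.q_eq⟩

theorem Setup.one_le (h : Setup n W M p q) : 1 ≤ M := by
  have h1 := h.pow_le.1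
  have h2 := h.three_le
  have h3 : (1 : ℤ) ≤ (n : ℤ) ^ 4 := one_le_pow₀ (by exact_mod_cast (by omega : 1 ≤ n))
  exact_mod_cast h3.trans h1

theorem Setup.n_mul_le (h : Setup n W M p q) : (n : ℤ) * (n * n ^ 3) ≤ M := by
  have h1 := h.three_le
  have h2 := h.pow_le.2.2
  have hn : (3 : ℤ) ≤ n := by exact_mod_cast h1
  have h4 : (1 : ℤ) ≤ (n : ℤ) ^ 4 := one_le_pow₀ (by linarith)
  have h5 : (n : ℤ) ≤ 2 * ((n : ℤ) ^ 4) ^ n := by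
    have : (n : ℤ) ^ 4 ≤ ((n : ℤ) ^ 4) ^ n := le_self_pow₀ h4 (by omega)
    have h6 : (n : ℤ) ≤ (n : ℤ) ^ 4 := le_self_pow₀ (by linarith) (by norm_num)
    linarith
  have h6 : 2 * ((n : ℤ) ^ 4) ^ n ≤ (2 * ((n : ℤ) ^ 4) ^ n) ^ n :=
    le_self_pow₀ (by linarith) (by omega)
  calc (n : ℤ) * (n * n ^ 3) = n ^ 4 * n := by ring
    _ ≤ n ^ 4 * (2 * ((n : ℤ) ^ 4) ^ n) ^ n := by gcongr; linarith
    _ ≤ M := h2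

theorem run_measureCmd (h : Setup n W M p q) {s : St} (hinv : Inv n W p q s)
    (hz : IsPartial (entries n (s.arr 4))) :
    (((measureCmd.run n W M s).var 2 : ℤ) : ℝ) = ∑ i, ∑ j,
      openWeight (scaledWeight n W p q) (entries n (s.arr 0)) i j *
        (entries n (s.arr 4) i * entries n (s.arr 4) i : ℝ) ∧
    (((measureCmd.run n W M s).var 3 : ℤ) : ℝ) = ∑ i, ∑ j,
      openWeight (scaledWeight n W p q) (entries n (s.arr 0)) i j *
        (entries n (s.arr 4) i * entries n (s.arr 4) j : ℝ) ∧
    (((measureCmd.run n W M s).var 4 : ℤ) : ℝ) = ∑ i, ∑ j,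
      scaledWeight n W p q i j * (entries n (s.arr 4) i * entries n (s.arr 0) j : ℝ) := by
  have hn0 : (0 : ℤ) ≤ n ^ 3 := by positivity
  have habs : ∀ {a b c : ℤ}, |a| ≤ n ^ 3 → |b| ≤ 1 → |c| ≤ 1 → |a * (b * c)| ≤ (n : ℤ) ^ 3 := by
    intro a b c ha hb hc
    rw [abs_mul, abs_mul]
    have : |b| * |c| ≤ 1 := mul_le_one₀ hb (abs_nonneg _) hc
    exact (mul_le_of_le_one_right (abs_nonneg _) this).trans ha
  have hopen : ∀ {j l : ℕ}, j < n → l < n → |openScaled n W p q (s.arr 0) j l| ≤ n ^ 3 := by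
    intro j l hj hl
    have := h.abs_openScaled_le hinv.part hj hl
    rw [abs_of_nonneg this.1]
    exact this.2
  have hsc : ∀ {j l : ℕ}, j < n → l < n → |scaled n W p q j l| ≤ n ^ 3 := by
    intro j l hj hl
    rw [abs_of_nonneg (h.nonneg j hj l hl)]
    exact h.le j hj l hl
  have hzb : ∀ {j : ℕ}, j < n → |s.arr 4 j| ≤ 1 := fun hj => abs_le_one_of_isPartial hz hj
  have hxb : ∀ {j : ℕ}, j < n → |s.arr 0 j| ≤ 1 := fun hj => abs_le_one_of_isPartial hinv.part hj
  set s₁ := (sum₂ 2 (.mul (openWeightTerm 4 5) (.mul (.arr 4 4) (.arr 4 4)))).run n W M s with hs₁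
  have a₁ : Agree [4, 5] [2] [] s s₁ := Cmd.agree_run _ (by decide) s
  set s₂ := (sum₂ 3 (.mul (openWeightTerm 4 5) (.mul (.arr 4 4) (.arr 4 5)))).run n W M s₁ with hs₂
  have a₂ : Agree [4, 5] [3] [] s₁ s₂ := Cmd.agree_run _ (by decide) s₁
  set s₃ := (sum₂ 4 (.mul (weightTerm 4 5) (.mul (.arr 4 4) (.arr 0 5)))).run n W M s₂ with hs₃
  have a₃ : Agree [4, 5] [4] [] s₂ s₃ := Cmd.agree_run _ (by decide) s₂
  have hrun : measureCmd.run n W M s = s₃ := rfl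
  rw [hrun]
  have v2 : s₃.var 2 = ∑ j ∈ Finset.range n, ∑ l ∈ Finset.range n,
      openScaled n W p q (s.arr 0) j l * (s.arr 4 j * s.arr 4 j) := by
    rw [a₃.var 2 (by decide), a₂.var 2 (by decide), hs₁]
    refine run_sum₂ _ (fun j hj l hl => habs (hopen hj hl) (hzb hj) (hzb hj)) h.n_mul_le ?_
    intro j hj l hl s' h4 h5 hag
    rw [Term.val, openWeightTerm_val ((hag.var 0 (by decide)).trans hinv.p_eq)
      ((hag.var 1 (by decide)).trans hinv.q_eq)]
    simp only [Term.val, h4, h5, hag.arr 0 (by decide), hag.arr 4 (by decide), openScaled]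
    push_cast
    rfl
  have v3 : s₃.var 3 = ∑ j ∈ Finset.range n, ∑ l ∈ Finset.range n,
      openScaled n W p q (s.arr 0) j l * (s.arr 4 j * s.arr 4 l) := by
    rw [a₃.var 3 (by decide), hs₂]
    refine run_sum₂ _ (fun j hj l hl => habs (hopen hj hl) (hzb hj) (hzb hl)) h.n_mul_le ?_
    intro j hj l hl s' h4 h5 hag
    rw [Term.val, openWeightTerm_val
      ((hag.var 0 (by decide)).trans ((a₁.var 0 (by decide)).trans hinv.p_eq))
      ((hag.var 1 (by decide)).trans ((a₁.var 1 (by decide)).trans hinv.q_eq))]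
    simp only [Term.val, h4, h5, hag.arr 0 (by decide), hag.arr 4 (by decide), openScaled,
      a₁.arr 0 (by decide), a₁.arr 4 (by decide)]
    push_cast
    rfl
  have v4 : s₃.var 4 = ∑ j ∈ Finset.range n, ∑ l ∈ Finset.range n,
      scaled n W p q j l * (s.arr 4 j * s.arr 0 l) := by
    rw [hs₃]
    refine run_sum₂ _ (fun j hj l hl => habs (hsc hj hl) (hzb hj) (hxb hl)) h.n_mul_le ?_
    intro j hj l hl s' h4 h5 hag
    rw [Term.val, weightTerm_val
      ((hag.var 0 (by decide)).trans ((a₂.var 0 (by decide)).trans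
        ((a₁.var 0 (by decide)).trans hinv.p_eq)))
      ((hag.var 1 (by decide)).trans ((a₂.var 1 (by decide)).trans
        ((a₁.var 1 (by decide)).trans hinv.q_eq)))]
    simp only [Term.val, h4, h5, hag.arr 0 (by decide), hag.arr 4 (by decide),
      a₁.arr 0 (by decide), a₁.arr 4 (by decide), a₂.arr 0 (by decide), a₂.arr 4 (by decide)]
    push_cast
    rfl
  refine ⟨?_, ?_, ?_⟩
  · rw [v2, cast_sum_range₂]
    refine Finset.sum_congr rfl fun i _ => Finset.sum_congr rfl fun j _ => ?_
    rw [Int.cast_mul, openScaled_cast]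
    push_cast
    rfl
  · rw [v3, cast_sum_range₂]
    refine Finset.sum_congr rfl fun i _ => Finset.sum_congr rfl fun j _ => ?_
    rw [Int.cast_mul, openScaled_cast]
    push_cast
    rfl
  · rw [v4, cast_sum_range₂]
    refine Finset.sum_congr rfl fun i _ => Finset.sum_congr rfl fun j _ => ?_
    push_cast
    rfl

theorem Setup.scaledWeight_nonneg (h : Setup n W M p q) (i j : Fin n) :
    0 ≤ scaledWeight n W p q i j := by
  have := h.nonneg i i.2 j j.2
  unfold scaledWeight
  exact_mod_cast this

theorem Setup.scaledWeight_symm (h : Setup n W M p q) (i j : Fin n) :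
    scaledWeight n W p q i j = scaledWeight n W p q j i := by
  unfold scaledWeight
  rw [h.symm]

/-- A candidate is used if and only if it is a good cut. -/
theorem run_tryCmd (h : Setup n W M p q) {s : St} (hinv : Inv n W p q s) (h3 : s.ctr 3 < n) :
    Inv n W p q (tryCmd.run n W M s) ∧
      Extends (entries n (s.arr 0)) (entries n ((tryCmd.run n W M s).arr 0)) ∧
      (entries n ((tryCmd.run n W M s).arr 0) ≠ entries n (s.arr 0) ∨
        ¬ GoodCut (openWeight (scaledWeight n W p q) (entries n (s.arr 0)))
          (sweep (entries n (s.arr 2)) ⟨s.ctr 3, h3⟩)) := by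
  set s₁ := sweepCmd.run n W M s with hs₁
  have a₁ : Agree [4, 5] [] [4] s s₁ := Cmd.agree_run _ (by decide) s
  set s₂ := measureCmd.run n W M s₁ with hs₂
  have a₂ : Agree [4, 5] [2, 3, 4] [] s₁ s₂ := Cmd.agree_run _ (by decide) s₁
  set x := entries n (s.arr 0) with hx
  set w := scaledWeight n W p q with hw
  set z := mask x (sweep (entries n (s.arr 2)) ⟨s.ctr 3, h3⟩) with hz
  have hzs : entries n (s₁.arr 4) = z := by
    funext i
    exact run_sweepCmd h.one_le hinv.part i i.2
  have hzp : IsPartial z := isPartial_mask hinv.part (isPartial_sweep _ _)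
  have hinv₁ : Inv n W p q s₁ :=
    hinv.congr (a₁.arr 0 (by decide)) (a₁.var 0 (by decide)) (a₁.var 1 (by decide))
  have hinv₂ : Inv n W p q s₂ :=
    hinv₁.congr (a₂.arr 0 (by decide)) (a₂.var 0 (by decide)) (a₂.var 1 (by decide))
  have hx₁ : entries n (s₁.arr 0) = x := by rw [a₁.arr 0 (by decide)]
  have hx₂ : entries n (s₂.arr 0) = x := by rw [a₂.arr 0 (by decide), hx₁]
  have hz₂ : entries n (s₂.arr 4) = z := by rw [a₂.arr 4 (by decide), hzs]
  obtain ⟨m2, m3, m4⟩ := run_measureCmd h hinv₁ (by rw [hzs]; exact hzp)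
  rw [hzs, hx₁, ← hs₂] at m2 m3
  rw [hzs, hx₁, ← hs₂] at m4
  -- The machine only tests strict inequalities; between integers, `1 - 2 * v` on the right
  -- expresses `≤ -2 * v`.
  have hgood : GoodCut (openWeight w x) (sweep (entries n (s.arr 2)) ⟨s.ctr 3, h3⟩) ↔
      0 < s₂.var 2 ∧ s₂.var 2 < 1 - 2 * s₂.var 3 := by
    rw [← goodCut_mask hinv.part, GoodCut, ← m2, ← m3]
    constructor
    · rintro ⟨g1, g2⟩
      have g1' : 0 < s₂.var 2 := by exact_mod_cast g1
      have g2' : s₂.var 2 ≤ -2 * s₂.var 3 := by exact_mod_cast g2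
      omega
    · rintro ⟨g1, g2⟩
      have g2' : s₂.var 2 ≤ -2 * s₂.var 3 := by omega
      exact ⟨by exact_mod_cast g1, by exact_mod_cast g2'⟩
  have hrun : tryCmd.run n W M s = if 0 < s₂.var 2 then
      (if s₂.var 2 < 1 - 2 * s₂.var 3 then extendCmd.run n W M s₂ else s₂) else s₂ := by
    have c1 : (Term.const 0).val n W s₂ < (Term.var 2).val n W s₂ ↔ 0 < s₂.var 2 := by
      simp [Term.val]
    have c2 : (Term.var 2).val n W s₂ <
        (Term.sub (.const 1) (.mul (.const 2) (.var 3))).val n W s₂ ↔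
        s₂.var 2 < 1 - 2 * s₂.var 3 := by
      simp only [Term.val]
      exact_mod_cast Iff.rfl
    calc tryCmd.run n W M s = if (Term.const 0).val n W s₂ < (Term.var 2).val n W s₂ then
        (if (Term.var 2).val n W s₂ <
          (Term.sub (.const 1) (.mul (.const 2) (.var 3))).val n W s₂ then
            extendCmd.run n W M s₂ else s₂) else s₂ := rfl
      _ = _ := by simp only [c1, c2]
  by_cases hg : 0 < s₂.var 2 ∧ s₂.var 2 < 1 - 2 * s₂.var 3
  · rw [hrun, if_pos hg.1, if_pos hg.2]
    have hxz : ∀ i, x i ≠ 0 → z i = 0 := fun i hi => mask_eq_zero hinv.part i hi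
    obtain ⟨σ, hσ, hc, hres⟩ := run_extendCmd (W := W) h.one_le (s := s₂)
      (by rw [hx₂]; exact hinv.part)
      (by rw [hz₂]; exact hzp) (fun j hj hxj => by
        have := hxz ⟨j, hj⟩
        rw [← hx₂, ← hz₂] at this
        exact this hxj)
    have a₃ : Agree [4] [6] [0] s₂ (extendCmd.run n W M s₂) := Cmd.agree_run _ (by decide) s₂
    have hnew : entries n ((extendCmd.run n W M s₂).arr 0) = fun i => x i + σ * z i := by
      funext i
      rw [← hx₂, ← hz₂]
      exact hres i i.2
    have hgc : GoodCut (openWeight w x) z := (goodCut_mask hinv.part).2 (hgood.2 hg)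
    have hext : Extends x (fun i => x i + σ * z i) := by
      intro i hi
      simp [hxz i hi]
    refine ⟨⟨?_, ?_, ?_, ?_⟩, ?_, Or.inl ?_⟩
    · rw [hnew]
      exact isPartial_add hinv.part hzp hxz hσ
    · rw [hnew]
      refine isAhead_add h.scaledWeight_symm h.scaledWeight_nonneg hxz hσ ?_ hgc hinv.ahead
      rw [← m4]
      exact_mod_cast hc
    · rw [a₃.var 0 (by decide), hinv₂.p_eq]
    · rw [a₃.var 1 (by decide), hinv₂.q_eq]
    · rw [hnew]
      exact hext
    · rw [hnew]
      obtain ⟨i, hi⟩ := hgc.exists_ne_zero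
      intro he
      have := congrFun he i
      have hσ0 : σ ≠ 0 := by rcases hσ with e | e <;> simp [e]
      simp [hi, hσ0] at this
  · have hr : tryCmd.run n W M s = s₂ := by
      rw [hrun]
      split_ifs with g1 g2
      · exact absurd ⟨g1, g2⟩ hg
      · rfl
      · rfl
    rw [hr, hx₂]
    exact ⟨hinv₂, Extends.refl x, Or.inr fun hh => hg (hgood.1 hh)⟩

end Correct

/-- A sweep depends only on signs and on comparisons of squares, both invariant under positive
scaling. This permits an integer version of the walk. -/
theorem sweep_eq_of_scaled {V : Type*} {F : V → ℤ} {f : V → ℝ} {c : ℝ} (hc : 0 < c)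
    (h : ∀ j, (F j : ℝ) = c * f j) (r : V) : sweep F r = sweep f r := by
  funext j
  have h1 : F j * F j < F r * F r ↔ f j * f j < f r * f r := by
    rw [← Int.cast_lt (R := ℝ)]
    push_cast
    rw [h, h, show c * f j * (c * f j) = c * c * (f j * f j) by ring,
      show c * f r * (c * f r) = c * c * (f r * f r) by ring,
      mul_lt_mul_iff_right₀ (mul_pos hc hc)]
  have h2 : F j < 0 ↔ f j < 0 := by
    rw [← Int.cast_lt (R := ℝ), h, Int.cast_zero, mul_neg_iff]
    simp [hc, hc.not_gt]
  have h3 : 0 < F j ↔ 0 < f j := by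
    rw [← Int.cast_lt (R := ℝ), h, Int.cast_zero, mul_pos_iff_of_pos_left hc]
  simp only [sweep, h1, h2, h3]

section Correct

variable {n : ℕ} {W : ℕ → ℕ → ℚ} {M : ℕ} {p q : ℤ}

/-! #### The walk -/

/-- The scaled weights that a state leaves open. -/
def stateWeight (n : ℕ) (W : ℕ → ℕ → ℚ) (p q : ℤ) (s : St) : Fin n → Fin n → ℝ :=
  openWeight (scaledWeight n W p q) (entries n (s.arr 0))

/-- The state holds the degrees, a common multiple of them, and the distribution of the walk from
`i` of length `k`, scaled to integers. -/
structure Walking (n : ℕ) (W : ℕ → ℕ → ℚ) (p q : ℤ) (i : Fin n) (k : ℕ) (s : St) : Prop where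
  deg : ∀ j : Fin n, (s.arr 1 j : ℝ) = wdeg (stateWeight n W p q s) j
  one_le : 1 ≤ s.var 5
  le : s.var 5 ≤ ((n : ℤ) ^ 4) ^ n
  dvd : ∀ j < n, s.arr 1 j ≠ 0 → s.arr 1 j ∣ s.var 5
  walk : ∀ j : Fin n,
    (s.arr 2 j : ℝ) = (2 * s.var 5) ^ k * (walk (stateWeight n W p q s) ^ k) j i

theorem Walking.congr {i : Fin n} {k : ℕ} {s s' : St} (h : Walking n W p q i k s)
    (h0 : entries n (s'.arr 0) = entries n (s.arr 0)) (h1 : s'.arr 1 = s.arr 1)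
    (h2 : s'.arr 2 = s.arr 2) (h5 : s'.var 5 = s.var 5) : Walking n W p q i k s' := by
  have hw : stateWeight n W p q s' = stateWeight n W p q s := by rw [stateWeight, h0, stateWeight]
  refine ⟨?_, ?_, ?_, ?_, ?_⟩
  · rw [h1, hw]; exact h.deg
  · rw [h5]; exact h.one_le
  · rw [h5]; exact h.le
  · rw [h1, h5]; exact h.dvd
  · rw [h2, h5, hw]; exact h.walk

theorem Walking.sweep_eq {i : Fin n} {k : ℕ} {s : St} (h : Walking n W p q i k s) (r : Fin n) :
    sweep (entries n (s.arr 2)) r =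
      sweep (fun j => (SAMaxCut.walk (stateWeight n W p q s) ^ k) j i) r := by
  have h5 : (1 : ℝ) ≤ s.var 5 := by exact_mod_cast h.one_le
  exact sweep_eq_of_scaled (c := (2 * s.var 5) ^ k) (by positivity) h.walk r

/-- The largest numbers that occur: sums of `n` terms, each a weight of size at most `n ^ 3` times a
scaled walk entry of size at most `(2 * D) ^ k`. -/
theorem Setup.pow_four_mul_le (h : Setup n W M p q) {D : ℤ} {k : ℕ} (h1 : 1 ≤ D)
    (hD : D ≤ ((n : ℤ) ^ 4) ^ n) (hk : k ≤ n) : (n : ℤ) ^ 4 * (2 * D) ^ k ≤ M := by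
  refine le_trans (mul_le_mul_of_nonneg_left ?_ (by positivity)) h.big
  calc (2 * D) ^ k ≤ (2 * D) ^ n := pow_le_pow_right₀ (by linarith) hk
    _ ≤ (2 * ((n : ℤ) ^ 4) ^ n) ^ n := by gcongr

theorem Setup.stateWeight_nonneg (h : Setup n W M p q) {s : St} (hs : Inv n W p q s) (i j : Fin n) :
    0 ≤ stateWeight n W p q s i j :=
  openWeight_nonneg h.scaledWeight_nonneg hs.part i j

theorem run_degreeCmd (h : Setup n W M p q) {s : St} (hs : Inv n W p q s) :
    ∀ j < n, (degreeCmd.run n W M s).arr 1 j =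
      ∑ l ∈ Finset.range n, openScaled n W p q (s.arr 0) j l := by
  refine run_rowSums _ (G := n ^ 3) (fun j hj l hl => ?_)
    (le_trans (le_of_eq (by ring)) h.pow_le.1) ?_
  · have := h.abs_openScaled_le hs.part hj hl
    rw [abs_of_nonneg this.1]
    exact this.2
  · intro j hj l hl s' h4 h5 hag
    rw [openWeightTerm_val ((hag.var 0 (by simp)).trans hs.p_eq)
      ((hag.var 1 (by simp)).trans hs.q_eq), h4, h5, hag.arr 0 (by decide), openScaled]

/-- Degrees equal to zero are skipped, so the product stays positive and is a common multiple of the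
remaining degrees. -/
theorem run_prodCmd (h : Setup n W M p q) {s : St}
    (hd : ∀ j < n, 0 ≤ s.arr 1 j ∧ s.arr 1 j ≤ n ^ 4) :
    1 ≤ (prodCmd.run n W M s).var 5 ∧ (prodCmd.run n W M s).var 5 ≤ ((n : ℤ) ^ 4) ^ n ∧
      ∀ j < n, s.arr 1 j ≠ 0 → s.arr 1 j ∣ (prodCmd.run n W M s).var 5 := by
  have hn : (1 : ℤ) ≤ n := by exact_mod_cast (by have := h.three_le; omega : 1 ≤ n)
  have h4 : (1 : ℤ) ≤ (n : ℤ) ^ 4 := one_le_pow₀ hn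
  have h1M : (1 : ℤ) ≤ M := by exact_mod_cast h.one_le
  have h0 : (prodCmd.run n W M s) = (Cmd.loop 4 (.ite (.const 0) (.arr 1 4)
      (.set 5 (.mul (.var 5) (.arr 1 4))) .skip)).run n W M (s.setVar 5 1) := by
    simp only [prodCmd, Cmd.run, Term.val, Int.floor_intCast,
      clip_of_le (show |(1 : ℤ)| ≤ M by simpa using h1M)]
  rw [h0]
  have hl := Cmd.run_loop (n := n) (W := W) (M := M) (v := 4) (c := .ite (.const 0) (.arr 1 4)
      (.set 5 (.mul (.var 5) (.arr 1 4))) .skip) (s := s.setVar 5 1)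
    (fun k s' => s'.arr 1 = s.arr 1 ∧ 1 ≤ s'.var 5 ∧ s'.var 5 ≤ ((n : ℤ) ^ 4) ^ k ∧
      ∀ j < k, s.arr 1 j ≠ 0 → s.arr 1 j ∣ s'.var 5)
    ⟨rfl, by simp, by simp, by simp⟩ (by
      rintro k hk s' hu ⟨h1, h2, h3, h5⟩
      have hpow : ((n : ℤ) ^ 4) ^ (k + 1) = ((n : ℤ) ^ 4) ^ k * n ^ 4 := pow_succ _ _
      simp only [Cmd.run, setCtr_var, setCtr_arr]
      by_cases hpos : 0 < s.arr 1 k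
      · have hle := (hd k hk).2
        have hmul : s'.var 5 * s.arr 1 k ≤ ((n : ℤ) ^ 4) ^ (k + 1) := by
          rw [hpow]
          exact mul_le_mul h3 hle hpos.le (by positivity)
        have hone : 1 ≤ s'.var 5 * s.arr 1 k := one_le_mul_of_one_le_of_one_le h2 hpos
        have hM : |s'.var 5 * s.arr 1 k| ≤ M := by
          rw [abs_of_nonneg (by linarith)]
          exact hmul.trans ((pow_le_pow_right₀ h4 hk).trans h.pow_le.2.1)
        have hv : ⌊(Term.mul (.var 5) (.arr 1 4)).val n W s'⌋ = s'.var 5 * s.arr 1 k := by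
          simp only [Term.val, hu, h1]
          rw [← Int.cast_mul, Int.floor_intCast]
        rw [if_pos (by simp only [Term.val, hu, h1]; exact_mod_cast hpos), hv, clip_of_le hM]
        refine ⟨h1, by simpa using hone, by simpa using hmul, fun j hj hj0 => ?_⟩
        rw [setVar_var_same]
        rcases eq_or_ne j k with rfl | hjk
        · exact dvd_mul_left _ _
        · exact (h5 j (by omega) hj0).mul_right _
      · rw [if_neg (by simp only [Term.val, hu, h1]; exact_mod_cast hpos)]
        refine ⟨h1, h2, h3.trans (pow_le_pow_right₀ h4 (by omega)), fun j hj hj0 => ?_⟩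
        rcases eq_or_ne j k with rfl | hjk
        · exact absurd (le_antisymm (not_lt.1 hpos) (hd j hk).1) hj0
        · exact h5 j (by omega) hj0)
  exact hl.2

theorem run_initCmd (hM : 1 ≤ M) (s : St) :
    ∀ j < n, (initCmd.run n W M s).arr 2 j = if j = s.ctr 1 then 1 else 0 := by
  have hM' : (1 : ℤ) ≤ M := by exact_mod_cast hM
  intro j hj
  rw [initCmd, Cmd.run]
  set s₁ := (Cmd.loop 4 (.put 2 4 (.const 0))).run n W M s with hs₁
  have a₁ : Agree [4] [] [2] s s₁ := Cmd.agree_run _ (by decide) s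
  have hz : ∀ j < n, s₁.arr 2 j = 0 := by
    refine run_map (fun _ => 0) (by decide) ?_
    intro k hk s' hk4 _ _
    rw [run_put_arr (z := 0) (by simp [Term.val]) (by simp), hk4]
  rw [run_put_arr (z := 1) (by simp [Term.val]) (by simpa using hM'), a₁.ctr 1 (by decide)]
  by_cases e : j = s.ctr 1
  · simp [e]
  · rw [Function.update_of_ne e, if_neg e, hz j hj]

/-- Multiplying one step of the walk by `2 * D`, with `D` the common multiple, clears its
denominators. The scaled entries stay below powers of `2 * D` because the walk is substochastic in
absolute value, so nothing is clipped. -/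
theorem run_stepCmd (h : Setup n W M p q) {s : St} (hs : Inv n W p q s) {i : Fin n} {k : ℕ}
    (hk : k < n) (hw : Walking n W p q i k s) :
    Walking n W p q i (k + 1) (stepCmd.run n W M s) := by
  set a := stateWeight n W p q s with ha
  set D := s.var 5 with hD
  have hD1 : (1 : ℝ) ≤ D := by exact_mod_cast hw.one_le
  have hnn := h.stateWeight_nonneg hs
  have hbound : ∀ k : ℕ, ∀ j : Fin n, |(SAMaxCut.walk a ^ k) j i| ≤ 1 := fun k j =>
    (Finset.single_le_sum (f := fun l => |(SAMaxCut.walk a ^ k) j l|) (fun l _ => abs_nonneg _)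
      (Finset.mem_univ i)).trans (sum_abs_walk_pow_le hnn k j)
  have hF : ∀ j < n, |s.arr 2 j| ≤ (2 * D) ^ k := by
    intro j hj
    rw [← Int.cast_le (R := ℝ)]
    push_cast
    rw [hw.walk ⟨j, hj⟩, abs_mul, abs_of_nonneg (by positivity)]
    exact mul_le_of_le_one_right (by positivity) (hbound k ⟨j, hj⟩)
  set s₁ := (rowSums 3 (.mul (openWeightTerm 4 5) (.arr 2 5))).run n W M s with hs₁
  have a₁ : Agree [4, 5] [] [3] s s₁ := Cmd.agree_run _ (by decide) s
  have hrow : ∀ j < n, s₁.arr 3 j =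
      ∑ l ∈ Finset.range n, openScaled n W p q (s.arr 0) j l * s.arr 2 l := by
    refine run_rowSums _ (G := n ^ 3 * (2 * D) ^ k) (fun j hj l hl => ?_) ?_ ?_
    · have := h.abs_openScaled_le hs.part hj hl
      rw [abs_mul, abs_of_nonneg this.1]
      exact mul_le_mul this.2 (hF l hl) (abs_nonneg _) (by positivity)
    · refine le_trans (le_of_eq (by ring)) (h.pow_four_mul_le hw.one_le hw.le hk.le)
    · intro j hj l hl s' h4 h5 hag
      rw [Term.val, openWeightTerm_val ((hag.var 0 (by simp)).trans hs.p_eq)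
        ((hag.var 1 (by simp)).trans hs.q_eq), Term.val, h4, h5, hag.arr 0 (by decide),
        hag.arr 2 (by decide), openScaled]
      push_cast
      rfl
  have hrowR : ∀ j : Fin n, (s₁.arr 3 j : ℝ) =
      (2 * D) ^ k * ∑ l, a j l * (SAMaxCut.walk a ^ k) l i := by
    intro j
    rw [hrow j j.2, Finset.sum_range, Finset.mul_sum]
    push_cast
    refine Finset.sum_congr rfl fun l _ => ?_
    rw [openScaled_cast, hw.walk]
    rw [← hD, ← ha]
    change stateWeight n W p q s j l * _ = _
    ring
  -- The division is exact at positive degrees; at degree zero, integer and rational division both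
  -- return `0`, as in the definition of the walk.
  set g : ℕ → ℤ := fun j => D * s.arr 2 j - D / s.arr 1 j * s₁.arr 3 j with hg
  have hgq : ∀ j < n, ((g j : ℤ) : ℚ) = D * s.arr 2 j - (D / s.arr 1 j : ℚ) * s₁.arr 3 j := by
    intro j hj
    by_cases h0 : s.arr 1 j = 0
    · simp [hg, h0]
    · simp only [hg]
      push_cast
      rw [Int.cast_div (hw.dvd j hj h0) (by exact_mod_cast h0)]
  have hgR : ∀ j : Fin n, ((g j : ℤ) : ℝ) =
      (2 * D) ^ (k + 1) * (SAMaxCut.walk a ^ (k + 1)) j i := by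
    intro j
    have e : ((g j : ℤ) : ℝ) = D * s.arr 2 j - (D / s.arr 1 j : ℝ) * s₁.arr 3 j := by
      exact_mod_cast congrArg (Rat.cast (K := ℝ)) (hgq j j.2)
    rw [e, hrowR, hw.walk, walk_pow_succ_apply, hw.deg, ← ha, ← hD]
    ring
  set s₂ := (Cmd.loop 4 (.put 2 4 (.sub (.mul (.var 5) (.arr 2 4))
    (.mul (.div (.var 5) (.arr 1 4)) (.arr 3 4))))).run n W M s₁ with hs₂
  have a₂ : Agree [4, 5] [] [2] s₁ s₂ := Cmd.agree_run _ (by decide) s₁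
  have hnew : ∀ j < n, s₂.arr 2 j = g j := by
    refine run_map g (by decide) ?_
    intro j hj s' h4 hag hsame
    have e2 : s'.arr 2 j = s.arr 2 j := by rw [hsame, a₁.arr 2 (by decide)]
    have e1 : s'.arr 1 = s.arr 1 := by rw [hag.arr 1 (by decide), a₁.arr 1 (by decide)]
    have e3 : s'.arr 3 = s₁.arr 3 := hag.arr 3 (by decide)
    have e5 : s'.var 5 = D := by rw [hag.var 5 (by simp), a₁.var 5 (by simp)]
    rw [run_put_arr (z := g j), h4]
    · simp only [Term.val, h4, e1, e2, e3, e5]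
      rw [hgq j hj]
    · have hle : |g j| ≤ (2 * D) ^ (k + 1) := by
        rw [← Int.cast_le (R := ℝ)]
        push_cast
        rw [hgR ⟨j, hj⟩, abs_mul, abs_of_nonneg (by positivity)]
        exact mul_le_of_le_one_right (by positivity) (hbound (k + 1) ⟨j, hj⟩)
      refine hle.trans (le_trans ?_ (h.pow_four_mul_le hw.one_le hw.le (Nat.succ_le_of_lt hk)))
      have hn : (1 : ℤ) ≤ n := by exact_mod_cast (by have := h.three_le; omega : 1 ≤ n)
      have hpos : 0 ≤ (2 * D) ^ (k + 1) := (abs_nonneg _).trans hle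
      exact le_mul_of_one_le_left hpos (one_le_pow₀ hn)
  have hrun : stepCmd.run n W M s = s₂ := rfl
  rw [hrun]
  have e0 : s₂.arr 0 = s.arr 0 := by rw [a₂.arr 0 (by decide), a₁.arr 0 (by decide)]
  have e1 : s₂.arr 1 = s.arr 1 := by rw [a₂.arr 1 (by decide), a₁.arr 1 (by decide)]
  have e5 : s₂.var 5 = s.var 5 := by rw [a₂.var 5 (by simp), a₁.var 5 (by simp)]
  have ew : stateWeight n W p q s₂ = a := by rw [stateWeight, e0, ha, stateWeight]
  refine ⟨?_, ?_, ?_, ?_, ?_⟩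
  · rw [e1, ew]; exact hw.deg
  · rw [e5]; exact hw.one_le
  · rw [e5]; exact hw.le
  · rw [e1, e5]; exact hw.dvd
  · intro j
    rw [hnew j j.2, hgR, ew, e5]

/-- The state after the preparations for one starting vertex. -/
theorem run_prepare (h : Setup n W M p q) {s : St} (hs : Inv n W p q s) (h1 : s.ctr 1 < n) :
    Walking n W p q ⟨s.ctr 1, h1⟩ 0
      (initCmd.run n W M (prodCmd.run n W M (degreeCmd.run n W M s))) := by
  set s₁ := degreeCmd.run n W M s with hs₁
  have a₁ : Agree [4, 5] [] [1] s s₁ := Cmd.agree_run _ (by decide) s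
  set s₂ := prodCmd.run n W M s₁ with hs₂
  have a₂ : Agree [4] [5] [] s₁ s₂ := Cmd.agree_run _ (by decide) s₁
  set s₃ := initCmd.run n W M s₂ with hs₃
  have a₃ : Agree [4] [] [2] s₂ s₃ := Cmd.agree_run _ (by decide) s₂
  have hd := run_degreeCmd h hs
  rw [← hs₁] at hd
  have hb : ∀ j < n, 0 ≤ s₁.arr 1 j ∧ s₁.arr 1 j ≤ n ^ 4 := by
    intro j hj
    rw [hd j hj]
    refine ⟨Finset.sum_nonneg fun l hl =>
      (h.abs_openScaled_le hs.part hj (Finset.mem_range.1 hl)).1, ?_⟩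
    refine (Finset.sum_le_card_nsmul _ _ ((n : ℤ) ^ 3) fun l hl =>
      (h.abs_openScaled_le hs.part hj (Finset.mem_range.1 hl)).2).trans (le_of_eq ?_)
    simp only [Finset.card_range, nsmul_eq_mul]
    ring
  obtain ⟨p1, p2, p3⟩ := run_prodCmd h hb
  rw [← hs₂] at p1 p2 p3
  have e0 : s₃.arr 0 = s.arr 0 := by
    rw [a₃.arr 0 (by decide), a₂.arr 0 (by simp), a₁.arr 0 (by decide)]
  have e1 : s₃.arr 1 = s₁.arr 1 := by rw [a₃.arr 1 (by decide), a₂.arr 1 (by simp)]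
  have e5 : s₃.var 5 = s₂.var 5 := a₃.var 5 (by simp)
  have ec : s₂.ctr 1 = s.ctr 1 := by rw [a₂.ctr 1 (by decide), a₁.ctr 1 (by decide)]
  refine ⟨?_, ?_, ?_, ?_, ?_⟩
  · intro j
    rw [e1, hd j j.2, wdeg, Finset.sum_range]
    push_cast
    refine Finset.sum_congr rfl fun l _ => ?_
    rw [openScaled_cast, stateWeight, e0]
  · rw [e5]; exact p1
  · rw [e5]; exact p2
  · rw [e1, e5]; exact p3
  · intro j
    rw [hs₃, run_initCmd h.one_le s₂ j j.2, ec]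
    simp [Matrix.one_apply, Fin.ext_iff]

/-! #### The search -/

/-- The partial cut of a state. -/
def partialCut (n : ℕ) (s : St) : Fin n → ℤ := entries n (s.arr 0)

/-- A part of the search keeps the invariant; and if it does not extend the partial cut, then `P`
holds. -/
structure Progress (n : ℕ) (W : ℕ → ℕ → ℚ) (p q : ℤ) (s s' : St) (P : Prop) : Prop where
  inv : Inv n W p q s'
  ext : Extends (partialCut n s) (partialCut n s')
  fail : partialCut n s' ≠ partialCut n s ∨ P

/-- If the composite leaves the cut unchanged, then so does each part, and both failure statements
concern one and the same cut. -/
theorem Progress.trans {s s' s'' : St} {P Q : Prop} (h : Progress n W p q s s' P)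
    (h' : Progress n W p q s' s'' Q) :
    Progress n W p q s s''
      (partialCut n s' = partialCut n s ∧ partialCut n s'' = partialCut n s' ∧ P ∧ Q) := by
  refine ⟨h'.inv, h.ext.trans h'.ext, ?_⟩
  by_cases e : partialCut n s' = partialCut n s
  · by_cases e' : partialCut n s'' = partialCut n s'
    · exact Or.inr ⟨e, e', h.fail.resolve_left (not_not.2 e), h'.fail.resolve_left (not_not.2 e')⟩
    · left
      rwa [e] at e'
  · exact Or.inl (h.ext.ne e h'.ext)

theorem Progress.imp {s s' : St} {P Q : Prop} (h : Progress n W p q s s' P) (hPQ : P → Q) :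
    Progress n W p q s s' Q :=
  ⟨h.inv, h.ext, h.fail.imp_right hPQ⟩

theorem progress_of_arr_eq {s : St} (hs : Inv n W p q s) (s' : St) (h0 : s'.arr 0 = s.arr 0)
    (hp : s'.var 0 = s.var 0) (hq : s'.var 1 = s.var 1) {P : Prop} (hP : P) :
    Progress n W p q s s' P :=
  ⟨hs.congr h0 hp hq, by rw [partialCut, partialCut, h0]; exact Extends.refl _, Or.inr hP⟩

theorem stateWeight_eq {s s' : St} (h : partialCut n s' = partialCut n s) :
    stateWeight n W p q s' = stateWeight n W p q s := by
  unfold partialCut at h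
  rw [stateWeight, h, stateWeight]

/-- Once a candidate is accepted, the stored walk belongs to outdated weights. This is harmless:
every candidate is tested against the current open weights, and nothing about the walk is claimed
once the cut has changed. -/
theorem run_thresholds (h : Setup n W M p q) {s : St} (hs : Inv n W p q s) :
    Progress n W p q s ((Cmd.loop 3 tryCmd).run n W M s)
      (∀ r, ¬ GoodCut (stateWeight n W p q s) (sweep (entries n (s.arr 2)) r)) := by
  have hl := Cmd.run_loop (n := n) (W := W) (M := M) (v := 3) (c := tryCmd) (s := s)
    (fun k s' => Agree [3, 4, 5] [2, 3, 4, 6] [0, 4] s s' ∧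
      Progress n W p q s s' (∀ r : Fin n, (r : ℕ) < k →
        ¬ GoodCut (stateWeight n W p q s) (sweep (entries n (s.arr 2)) r)))
    ⟨agree_setCtr s (by simp) 0, progress_of_arr_eq hs (s.setCtr 3 0) rfl rfl rfl (by simp)⟩ (by
      rintro k hk s' hu ⟨hag, hp⟩
      have hag' : Agree [3, 4, 5] [2, 3, 4, 6] [0, 4] s' (tryCmd.run n W M s') :=
        Cmd.agree_run _ (by decide) s'
      refine ⟨(hag.trans hag').trans (agree_setCtr _ (by simp) _), ?_⟩
      have h3 : s'.ctr 3 < n := by omega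
      obtain ⟨t1, t2, t3⟩ := run_tryCmd h hp.inv h3
      have hp' : Progress n W p q s' ((tryCmd.run n W M s').setCtr 3 (k + 1)) _ :=
        ⟨t1.congr rfl rfl rfl, t2, t3⟩
      refine (hp.trans hp').imp ?_
      rintro ⟨e, _, hP, hQ⟩ r hr
      rcases eq_or_ne (r : ℕ) k with hrk | hrk
      · have e' : (⟨s'.ctr 3, h3⟩ : Fin n) = r := Fin.ext (by simp [hu, hrk])
        rw [e', hag.arr 2 (by decide)] at hQ
        rw [← stateWeight_eq e]
        exact hQ
      · exact hP r (by omega))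
  exact hl.2.imp fun hP r => hP r r.2

theorem run_startCmd (h : Setup n W M p q) {s : St} (hs : Inv n W p q s) (h1 : s.ctr 1 < n) :
    Progress n W p q s (startCmd.run n W M s) (∀ k < n, ∀ r,
      ¬ GoodCut (stateWeight n W p q s)
        (sweep (fun j => (walk (stateWeight n W p q s) ^ k) j ⟨s.ctr 1, h1⟩) r)) := by
  set i : Fin n := ⟨s.ctr 1, h1⟩ with hi
  set s₀ := initCmd.run n W M (prodCmd.run n W M (degreeCmd.run n W M s)) with hs₀
  have a₀ : Agree [4, 5] [5] [1, 2] s s₀ := by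
    have : s₀ = (Cmd.seq degreeCmd (.seq prodCmd initCmd)).run n W M s := rfl
    rw [this]
    exact Cmd.agree_run _ (by decide) s
  have hw₀ : Walking n W p q i 0 s₀ := run_prepare h hs h1
  have hrun : startCmd.run n W M s =
      (Cmd.loop 2 (.seq (.loop 3 tryCmd) stepCmd)).run n W M s₀ := rfl
  rw [hrun]
  have hl := Cmd.run_loop (n := n) (W := W) (M := M) (v := 2)
    (c := .seq (.loop 3 tryCmd) stepCmd) (s := s₀)
    (fun k s' => Progress n W p q s s' (Walking n W p q i k s' ∧ ∀ k' < k, ∀ r,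
      ¬ GoodCut (stateWeight n W p q s)
        (sweep (fun j => (walk (stateWeight n W p q s) ^ k') j i) r)))
    (progress_of_arr_eq hs (s₀.setCtr 2 0) (a₀.arr 0 (by decide))
      (a₀.var 0 (by decide)) (a₀.var 1 (by decide))
      ⟨hw₀.congr rfl rfl rfl rfl, by simp⟩) (by
      rintro k hk s' _ hp
      rw [Cmd.run]
      set s₁ := (Cmd.loop 3 tryCmd).run n W M s' with hs₁
      have a₁ : Agree [3, 4, 5] [2, 3, 4, 6] [0, 4] s' s₁ := Cmd.agree_run _ (by decide) s'
      have a₂ : Agree [4, 5] [] [2, 3] s₁ (stepCmd.run n W M s₁) := Cmd.agree_run _ (by decide) s₁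
      have p₁ : Progress n W p q s' s₁ _ := run_thresholds h hp.inv
      have p₂ : Progress n W p q s₁ ((stepCmd.run n W M s₁).setCtr 2 (k + 1)) True :=
        progress_of_arr_eq p₁.inv ((stepCmd.run n W M s₁).setCtr 2 (k + 1))
          (a₂.arr 0 (by decide)) (a₂.var 0 (by simp)) (a₂.var 1 (by simp)) trivial
      refine ((hp.trans p₁).trans p₂).imp ?_
      rintro ⟨-, -, ⟨e, e', ⟨hw, hP⟩, hQ⟩, -⟩
      have hw₁ : Walking n W p q i k s₁ :=
        hw.congr e' (a₁.arr 1 (by decide)) (a₁.arr 2 (by decide)) (a₁.var 5 (by decide))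
      refine ⟨(run_stepCmd h p₁.inv hk hw₁).congr rfl rfl rfl rfl, fun k' hk' r => ?_⟩
      rcases eq_or_ne k' k with rfl | hkk
      · have := hQ r
        rwa [hw.sweep_eq, stateWeight_eq e] at this
      · exact hP k' (by omega) r)
  exact hl.imp And.right

theorem run_starts (h : Setup n W M p q) {s : St} (hs : Inv n W p q s) :
    Progress n W p q s ((Cmd.loop 1 startCmd).run n W M s) (∀ i, ∀ k < n, ∀ r,
      ¬ GoodCut (stateWeight n W p q s)
        (sweep (fun j => (walk (stateWeight n W p q s) ^ k) j i) r)) := by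
  have hl := Cmd.run_loop (n := n) (W := W) (M := M) (v := 1) (c := startCmd) (s := s)
    (fun m s' => Progress n W p q s s' (∀ i : Fin n, (i : ℕ) < m → ∀ k < n, ∀ r,
      ¬ GoodCut (stateWeight n W p q s)
        (sweep (fun j => (walk (stateWeight n W p q s) ^ k) j i) r)))
    (progress_of_arr_eq hs (s.setCtr 1 0) rfl rfl rfl (by simp)) (by
      rintro m hm s' hu hp
      have h1 : s'.ctr 1 < n := by omega
      have p₁ := run_startCmd h hp.inv h1
      have p₁' : Progress n W p q s' ((startCmd.run n W M s').setCtr 1 (m + 1)) _ :=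
        ⟨p₁.inv.congr rfl rfl rfl, p₁.ext, p₁.fail⟩
      refine (hp.trans p₁').imp ?_
      rintro ⟨e, -, hP, hQ⟩ i hi
      rcases eq_or_ne (i : ℕ) m with him | him
      · have e' : (⟨s'.ctr 1, h1⟩ : Fin n) = i := Fin.ext (by simp [hu, him])
        rwa [e', stateWeight_eq e] at hQ
      · exact hP i (by omega))
  exact hl.imp fun hP i => hP i i.2

/-- While at least half of the weight is open, `H` provides a good candidate, so a full round must
decide at least one more vertex. After `n` rounds at most half of the weight is open, and being
ahead gives the bound. -/
theorem run_searchCmd (h : Setup n W M p q) {s : St} (hs : Inv n W p q s)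
    (H : ∀ x : Fin n → ℤ, IsPartial x → ∑ i, ∑ j, scaledWeight n W p q i j ≤
        2 * ∑ i, ∑ j, openWeight (scaledWeight n W p q) x i j →
      ∃ i, ∃ k < n, ∃ r, GoodCut (openWeight (scaledWeight n W p q) x)
        (sweep (fun j => (walk (openWeight (scaledWeight n W p q) x) ^ k) j i) r)) :
    Inv n W p q (searchCmd.run n W M s) ∧
      8 * cutForm (scaledWeight n W p q) (partialCut n (searchCmd.run n W M s)) ≤
        -∑ i, ∑ j, scaledWeight n W p q i j := by
  set w := scaledWeight n W p q with hw
  have hl := Cmd.run_loop (n := n) (W := W) (M := M) (v := 0) (c := .loop 1 startCmd) (s := s)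
    (fun k s' => Inv n W p q s' ∧
      (2 * ∑ i, ∑ j, openWeight w (partialCut n s') i j < ∑ i, ∑ j, w i j ∨
        numOpen (partialCut n s') + k ≤ n))
    ⟨hs.congr rfl rfl rfl, Or.inr (by
      simpa [numOpen] using Finset.card_filter_le (Finset.univ : Finset (Fin n)) _)⟩ (by
      rintro k hk s' _ ⟨hinv, hor⟩
      have hp := run_starts h hinv
      refine ⟨hp.inv.congr rfl rfl rfl, ?_⟩
      change 2 * ∑ i, ∑ j, openWeight w
          (partialCut n ((Cmd.loop 1 startCmd).run n W M s')) i j < ∑ i, ∑ j, w i j ∨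
        numOpen (partialCut n ((Cmd.loop 1 startCmd).run n W M s')) + (k + 1) ≤ n
      have hmono := hp.ext.sum_openWeight_le h.scaledWeight_nonneg hinv.part hp.inv.part
      by_cases hlt : 2 * ∑ i, ∑ j, openWeight w (partialCut n s') i j < ∑ i, ∑ j, w i j
      · left
        linarith
      · right
        have h1 := hor.resolve_left hlt
        rcases hp.fail with hne | hno
        · have := hp.ext.numOpen_lt hne
          omega
        · obtain ⟨i, k, hk, r, hg⟩ := H _ hinv.part (not_lt.1 hlt)
          exact absurd hg (hno i k hk r))
  have hrun : searchCmd.run n W M s = (Cmd.loop 0 (.loop 1 startCmd)).run n W M s := rfl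
  rw [← hrun] at hl
  obtain ⟨hinv, hor⟩ := hl
  refine ⟨hinv, ?_⟩
  have hle : 2 * ∑ i, ∑ j, openWeight w (partialCut n (searchCmd.run n W M s)) i j ≤
      ∑ i, ∑ j, w i j := by
    rcases hor with hlt | h0
    · exact hlt.le
    · have hno : numOpen (partialCut n (searchCmd.run n W M s)) = 0 := by omega
      have hz : ∀ i, partialCut n (searchCmd.run n W M s) i ≠ 0 := by
        intro i hi
        have := Finset.card_eq_zero.1 hno
        have hmem : i ∈ Finset.univ.filter
          fun i => partialCut n (searchCmd.run n W M s) i = 0 := by simpa using hi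
        rw [this] at hmem
        simp at hmem
      have : ∑ i, ∑ j, openWeight w (partialCut n (searchCmd.run n W M s)) i j = 0 := by
        refine Finset.sum_eq_zero fun i _ => Finset.sum_eq_zero fun j _ => ?_
        unfold openWeight
        rcases (hinv.part i).resolve_left (hz i) with e | e <;>
          · change partialCut n (searchCmd.run n W M s) i = _ at e
            simp [e]
      rw [this, mul_zero]
      exact Finset.sum_nonneg fun i _ => Finset.sum_nonneg fun j _ => h.scaledWeight_nonneg i j
  have := hinv.ahead
  unfold IsAhead at this
  change 4 * cutForm w (partialCut n (searchCmd.run n W M s)) + _ ≤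
    ∑ i, ∑ j, openWeight w (partialCut n (searchCmd.run n W M s)) i j at this
  linarith

/-! #### The remaining vertices -/

theorem run_fillCmd (h : Setup n W M p q) {s : St} (hs : Inv n W p q s) :
    (∀ i, partialCut n (fillCmd.run n W M s) i = 1 ∨ partialCut n (fillCmd.run n W M s) i = -1) ∧
      cutForm (scaledWeight n W p q) (partialCut n (fillCmd.run n W M s)) ≤
        cutForm (scaledWeight n W p q) (partialCut n s) := by
  have h1M : (1 : ℤ) ≤ M := by exact_mod_cast h.one_le
  set w := scaledWeight n W p q with hw
  set body : Cmd := .seq (.set 4 (.const 0))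
    (.seq (.loop 5 (.set 4 (.add (.var 4) (.mul (weightTerm 1 5) (.arr 0 5)))))
      (.ite (.mul (.arr 0 1) (.arr 0 1)) (.const 1)
        (.ite (.const 0) (.var 4) (.put 0 1 (.const (-1))) (.put 0 1 (.const 1))) .skip)) with hbody
  have hrun : fillCmd.run n W M s = (Cmd.loop 1 body).run n W M s := rfl
  rw [hrun]
  have hl := Cmd.run_loop (n := n) (W := W) (M := M) (v := 1) (c := body) (s := s)
    (fun k s' => s'.var 0 = p ∧ s'.var 1 = q ∧ IsPartial (partialCut n s') ∧
      (∀ i : Fin n, (i : ℕ) < k → partialCut n s' i ≠ 0) ∧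
      cutForm w (partialCut n s') ≤ cutForm w (partialCut n s))
    ⟨hs.p_eq, hs.q_eq, hs.part, by simp, le_rfl⟩ (by
      rintro k hk s' hu ⟨e0, e1, hpart, hfull, hle⟩
      have hbodyag : Agree [5] [4] [0] s' (body.run n W M s') := Cmd.agree_run _ (by decide) s'
      refine ⟨(hbodyag.var 0 (by decide)).trans e0, (hbodyag.var 1 (by decide)).trans e1, ?_⟩
      set s₁ := (Cmd.loop 5 (.set 4 (.add (.var 4) (.mul (weightTerm 1 5) (.arr 0 5))))).run n W M
        (s'.setVar 4 0) with hs₁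
      have a₁ : Agree [5] [4] [] s' s₁ :=
        (agree_setVar s' (by simp) 0).trans (Cmd.agree_run _ (by decide) _)
      have hsum : s₁.var 4 = ∑ l ∈ Finset.range n, scaled n W p q k l * s'.arr 0 l := by
        rw [hs₁, run_sumVar (fun l => scaled n W p q k l * s'.arr 0 l) (G := n ^ 3)]
        · simp
        · intro l hl
          rw [abs_mul, abs_of_nonneg (h.nonneg k hk l hl)]
          exact (mul_le_of_le_one_right (h.nonneg k hk l hl)
            (abs_le_one_of_isPartial hpart hl)).trans (h.le k hk l hl)
        · rw [setVar_var_same, abs_zero, zero_add]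
          exact le_trans (le_of_eq (by ring)) h.pow_le.1
        · intro l hl s'' h5 hag
          rw [Term.val, weightTerm_val ((hag.var 0 (by decide)).trans e0)
            ((hag.var 1 (by decide)).trans e1), hag.ctr 1 (by decide), h5]
          simp only [Term.val, h5, hag.arr 0 (by simp), setVar_arr, setVar_ctr, hu]
          push_cast
          rfl
      have hsumR : (s₁.var 4 : ℝ) = ∑ j, w ⟨k, hk⟩ j * partialCut n s' j := by
        rw [hsum, Finset.sum_range]
        push_cast
        rfl
      have hc1 : s₁.ctr 1 = k := by rw [a₁.ctr 1 (by decide), hu]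
      have harr : s₁.arr 0 = s'.arr 0 := a₁.arr 0 (by simp)
      have hbrun : body.run n W M s' = if s'.arr 0 k * s'.arr 0 k < 1 then
          (if 0 < s₁.var 4 then s₁.setArr 0 k (-1) else s₁.setArr 0 k 1) else s₁ := by
        have hset : (Cmd.set 4 (.const 0)).run n W M s' = s'.setVar 4 0 := by
          simp [Cmd.run, Term.val, clip]
        have c1 : (Term.mul (.arr 0 1) (.arr 0 1)).val n W s₁ < (Term.const 1).val n W s₁ ↔
            s'.arr 0 k * s'.arr 0 k < 1 := by
          simp only [Term.val, hc1, harr]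
          exact_mod_cast Iff.rfl
        have c2 : (Term.const 0).val n W s₁ < (Term.var 4).val n W s₁ ↔ 0 < s₁.var 4 := by
          simp [Term.val]
        have c3 : (Cmd.put 0 1 (.const (-1))).run n W M s₁ = s₁.setArr 0 k (-1) := by
          simp only [Cmd.run, Term.val, Int.floor_intCast, hc1,
            clip_of_le (show |(-1 : ℤ)| ≤ M by simpa using h1M)]
        have c4 : (Cmd.put 0 1 (.const 1)).run n W M s₁ = s₁.setArr 0 k 1 := by
          simp only [Cmd.run, Term.val, Int.floor_intCast, hc1,
            clip_of_le (show |(1 : ℤ)| ≤ M by simpa using h1M)]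
        rw [hbody, Cmd.run, hset, Cmd.run, ← hs₁, Cmd.run]
        simp only [c1]
        rw [Cmd.run]
        simp only [c2, c3, c4]
        rfl
      have hkeep : partialCut n s' ⟨k, hk⟩ ≠ 0 → body.run n W M s' = s₁ := by
        intro hne
        rw [hbrun, if_neg]
        have e : s'.arr 0 k = partialCut n s' ⟨k, hk⟩ := rfl
        rw [e]
        rcases (hpart ⟨k, hk⟩).resolve_left hne with e | e <;> simp [e]
      by_cases hz : partialCut n s' ⟨k, hk⟩ = 0
      · obtain ⟨σ, hσ, hcr, hnew⟩ : ∃ σ : ℤ, (σ = 1 ∨ σ = -1) ∧ σ * s₁.var 4 ≤ 0 ∧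
            body.run n W M s' = s₁.setArr 0 k σ := by
          have e : s'.arr 0 k = 0 := hz
          rw [hbrun, if_pos (by simp [e])]
          by_cases hpos : 0 < s₁.var 4
          · exact ⟨-1, by simp, by simpa using hpos.le, by rw [if_pos hpos]⟩
          · exact ⟨1, by simp, by simpa using hpos, by rw [if_neg hpos]⟩
        have hcut : partialCut n ((body.run n W M s').setCtr 1 (k + 1)) =
            Function.update (partialCut n s') ⟨k, hk⟩ σ := by
          funext i
          rw [hnew]
          change Function.update s₁.arr 0 (Function.update (s₁.arr 0) k σ) 0 i = _
          rw [Function.update_self, harr]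
          by_cases hik : i = ⟨k, hk⟩
          · subst hik
            simp
          · have : (i : ℕ) ≠ k := fun hh => hik (Fin.ext hh)
            rw [Function.update_of_ne this, Function.update_of_ne hik]
            rfl
        rw [hcut]
        refine ⟨fun i => ?_, fun i hi => ?_, ?_⟩
        · by_cases hik : i = ⟨k, hk⟩
          · subst hik
            simp [hσ]
          · simpa [hik] using hpart i
        · by_cases hik : i = ⟨k, hk⟩
          · subst hik
            rcases hσ with e | e <;> simp [e]
          · have : (i : ℕ) ≠ k := fun hh => hik (Fin.ext hh)
            simpa [hik] using hfull i (by omega)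
        · refine (cutForm_update_le h.scaledWeight_symm (fun i => ?_) hz hσ ?_).trans hle
          · simp [scaledWeight, h.loopless]
          · rw [← hsumR]
            exact_mod_cast hcr
      · have hcut : partialCut n ((body.run n W M s').setCtr 1 (k + 1)) = partialCut n s' := by
          rw [hkeep hz]
          change entries n (s₁.arr 0) = _
          rw [harr]
          rfl
        rw [hcut]
        refine ⟨hpart, fun i hi => ?_, hle⟩
        rcases eq_or_ne (i : ℕ) k with hik | hik
        · rwa [show i = ⟨k, hk⟩ from Fin.ext hik]
        · exact hfull i (by omega))
  obtain ⟨-, -, hpart, hfull, hle⟩ := hl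
  exact ⟨fun i => (hpart i).resolve_left (hfull i i.2), hle⟩

/-! #### Scaling -/

theorem run_heaviestCmd (hn : 0 < n) (hM : n ≤ M) (s : St) :
    ∃ p < n, ∃ q < n, (heaviestCmd.run n W M s).var 0 = (p : ℤ) ∧
      (heaviestCmd.run n W M s).var 1 = (q : ℤ) ∧ ∀ j < n, ∀ l < n, W j l ≤ W p q := by
  set body : Cmd := .ite (.weight (.var 0) (.var 1)) (.weight (.ctr 4) (.ctr 5))
      (.seq (.set 0 (.ctr 4)) (.set 1 (.ctr 5))) .skip with hbody
  have hrun : heaviestCmd.run n W M s =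
      (Cmd.loop 4 (.loop 5 body)).run n W M ((s.setVar 0 0).setVar 1 0) := by
    simp [heaviestCmd, Cmd.run, Term.val, clip, hbody]
  rw [hrun]
  have hclip : ∀ k < n, clip M (k : ℤ) = k := fun k hk =>
    clip_of_le (by rw [Nat.abs_cast]; exact_mod_cast hk.le.trans hM)
  have hstep : ∀ (s' : St) (p q j l : ℕ), s'.var 0 = (p : ℤ) → s'.var 1 = (q : ℤ) →
      s'.ctr 4 = j → s'.ctr 5 = l → p < n → q < n → j < n → l < n →
      ∃ p' < n, ∃ q' < n, (body.run n W M s').var 0 = (p' : ℤ) ∧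
        (body.run n W M s').var 1 = (q' : ℤ) ∧ W p q ≤ W p' q' ∧ W j l ≤ W p' q' := by
    intro s' p q j l hp hq hj hl hpn hqn hjn hln
    have c : (Term.weight (.var 0) (.var 1)).val n W s' <
        (Term.weight (.ctr 4) (.ctr 5)).val n W s' ↔ W p q < W j l := by
      simp [Term.val, hp, hq, hj, hl]
    rw [hbody, Cmd.run]
    simp only [c]
    by_cases hlt : W p q < W j l
    · refine ⟨j, hjn, l, hln, ?_, ?_, hlt.le, le_rfl⟩
      · rw [if_pos hlt]
        simp [Cmd.run, Term.val, St.setVar, hj, hclip j hjn]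
      · rw [if_pos hlt]
        simp [Cmd.run, Term.val, St.setVar, hl, hclip l hln]
    · rw [if_neg hlt]
      exact ⟨p, hpn, q, hqn, hp, hq, le_rfl, not_lt.1 hlt⟩
  have hl := Cmd.run_loop (n := n) (W := W) (M := M) (v := 4) (c := .loop 5 body)
    (s := (s.setVar 0 0).setVar 1 0)
    (fun k s' => ∃ p < n, ∃ q < n, s'.var 0 = (p : ℤ) ∧ s'.var 1 = (q : ℤ) ∧
      ∀ j < k, ∀ l < n, W j l ≤ W p q)
    ⟨0, hn, 0, hn, by simp [St.setVar], by simp [St.setVar], by simp⟩ (by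
      rintro k hk s' hu ⟨p, hp, q, hq, e0, e1, hle⟩
      have hin := Cmd.run_loop (n := n) (W := W) (M := M) (v := 5) (c := body) (s := s')
        (fun m s'' => s''.ctr 4 = k ∧ ∃ p' < n, ∃ q' < n, s''.var 0 = (p' : ℤ) ∧
          s''.var 1 = (q' : ℤ) ∧ W p q ≤ W p' q' ∧ ∀ l < m, W k l ≤ W p' q')
        ⟨by simp [St.setCtr, hu], p, hp, q, hq, e0, e1, le_rfl, by simp⟩ (by
          rintro m hm s'' hu' ⟨h4, p', hp', q', hq', e0', e1', hle', hrow⟩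
          have hag : Agree [] [0, 1] [] s'' (body.run n W M s'') := Cmd.agree_run _ (by decide) s''
          obtain ⟨P, hP, Q, hQ, f0, f1, f2, f3⟩ :=
            hstep s'' p' q' k m e0' e1' h4 hu' hp' hq' hk hm
          refine ⟨?_, P, hP, Q, hQ, f0, f1, hle'.trans f2, fun l hl => ?_⟩
          · simp [St.setCtr, hag.ctr 4 (by simp), h4]
          · rcases eq_or_ne l m with rfl | hlm
            · exact f3
            · exact (hrow l (by omega)).trans f2)
      obtain ⟨-, P, hP, Q, hQ, f0, f1, f2, f3⟩ := hin
      refine ⟨P, hP, Q, hQ, f0, f1, fun j hj l hl => ?_⟩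
      rcases eq_or_ne j k with rfl | hjk
      · exact f3 l hl
      · exact (hle j (by omega) l hl).trans f2)
  exact hl

end Correct

section Correct

variable {n : ℕ} {W : ℕ → ℕ → ℚ} {M : ℕ}

theorem exists_pos_weight (G : WeightedGraph n) : ∃ i j, 0 < G.w i j := by
  by_contra! h
  exact G.total_pos.not_ge
    (Finset.sum_nonpos fun i _ => Finset.sum_nonpos fun j _ => h i j)

theorem setup_of_heaviest (G : WeightedGraph n) (hW : ∀ i j : Fin n, (W i j : ℝ) = G.w i j)
    (hW0 : ∀ j l, ¬ (j < n ∧ l < n) → W j l = 0) (h3 : 3 ≤ n)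
    (hbig : (n : ℤ) ^ 4 * (2 * ((n : ℤ) ^ 4) ^ n) ^ n ≤ M) {p q : ℕ} (hm : 0 < W p q)
    (hmax : ∀ j < n, ∀ l < n, W j l ≤ W p q) : Setup n W M p q where
  three_le := h3
  big := hbig
  nonneg j hj l hl := by
    have h0 : 0 ≤ W j l := by
      have := G.nonneg ⟨j, hj⟩ ⟨l, hl⟩
      rw [← hW] at this
      exact_mod_cast this
    simp only [scaled, Int.toNat_natCast]
    exact Int.floor_nonneg.2 (by positivity)
  le j hj l hl := by
    simp only [scaled, Int.toNat_natCast]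
    have h1 : W j l * (n * (n * n)) / W p q ≤ ((n ^ 3 : ℤ) : ℚ) := by
      rw [div_le_iff₀ hm]
      push_cast
      calc W j l * (n * (n * n)) ≤ W p q * (n * (n * n)) :=
            mul_le_mul_of_nonneg_right (hmax j hj l hl) (by positivity)
        _ = n ^ 3 * W p q := by ring
    exact (Int.floor_le_floor h1).trans (le_of_eq (Int.floor_intCast _))
  symm j l := by
    have : W j l = W l j := by
      by_cases h : j < n ∧ l < n
      · have := G.symm ⟨j, h.1⟩ ⟨l, h.2⟩
        rw [← hW, ← hW] at this
        exact_mod_cast this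
      · rw [hW0 j l h, hW0 l j fun h' => h h'.symm]
    simp only [scaled, this]
  loopless j := by
    have : W j j = 0 := by
      by_cases h : j < n ∧ j < n
      · have := G.loopless ⟨j, h.1⟩
        rw [← hW] at this
        exact_mod_cast this
      · exact hW0 j j h
    simp [scaled, this]

/-- The structured program finds a cut that is far ahead. -/
theorem run_cutCmd (G : WeightedGraph n) (hW : ∀ i j : Fin n, (W i j : ℝ) = G.w i j)
    (hW0 : ∀ j l, ¬ (j < n ∧ l < n) → W j l = 0) (hn : 18 ≤ n)
    (hbig : (n : ℤ) ^ 4 * (2 * ((n : ℤ) ^ 4) ^ n) ^ n ≤ M) {s : St} (hs : ∀ j, s.arr 0 j = 0)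
    {t : ℕ} {μ : LocalFamily n ℝ} (hμ : IsLocalPseudodistribution t μ) (ht : 2 ≤ t) {ε : ℝ}
    (hε : 0 ≤ ε) (hgood : ∀ a : Fin n → Fin n → ℝ, (∀ i j, a i j = a j i) → (∀ i j, 0 ≤ a i j) →
      0 < ∑ i, ∑ j, a i j → (1 - 4 * ε) * ∑ i, ∑ j, a i j ≤ ∑ i, ∑ j, a i j * cutProb μ i j →
      ∃ i, ∃ k < n, ∃ r, GoodCut a (sweep (fun j => (walk a ^ k) j i) r))
    (hobj : 1 - ε ≤ objective G μ) :
    (∀ i, partialCut n (cutCmd.run n W M s) i = 1 ∨ partialCut n (cutCmd.run n W M s) i = -1) ∧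
      16 * cutForm G.w (partialCut n (cutCmd.run n W M s)) ≤ -G.total := by
  have hnM : n ≤ M := by
    have hn1 : (1 : ℤ) ≤ n := by exact_mod_cast (by omega : 1 ≤ n)
    have h4 : (1 : ℤ) ≤ (n : ℤ) ^ 4 := one_le_pow₀ hn1
    have h5 : (1 : ℤ) ≤ (2 * ((n : ℤ) ^ 4) ^ n) ^ n :=
      one_le_pow₀ (by have : (1 : ℤ) ≤ ((n : ℤ) ^ 4) ^ n := one_le_pow₀ h4
                      linarith)
    have h6 : (n : ℤ) ≤ n ^ 4 := le_self_pow₀ hn1 (by norm_num)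
    have : (n : ℤ) ≤ M := by nlinarith
    exact_mod_cast this
  obtain ⟨p, hp, q, hq, hvp, hvq, hmax⟩ := run_heaviestCmd (W := W) (by omega) hnM s
  set s₁ := heaviestCmd.run n W M s with hs₁
  have a₁ : Agree [4, 5] [0, 1] [] s s₁ := Cmd.agree_run _ (by decide) s
  have hm : 0 < W p q := by
    obtain ⟨i, j, hij⟩ := exists_pos_weight G
    rw [← hW] at hij
    have : 0 < W i j := by exact_mod_cast hij
    exact this.trans_le (hmax i i.2 j j.2)
  have h := setup_of_heaviest (M := M) G hW hW0 (by omega) hbig hm hmax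
  set w := scaledWeight n W p q with hw
  set c : ℝ := n ^ 3 / W p q with hc
  have hn0 : (18 : ℝ) ≤ n := by exact_mod_cast hn
  have hmR : (0 : ℝ) < W p q := by exact_mod_cast hm
  have hc0 : 0 < c := by positivity
  have hval : ∀ i j, c * G.w i j = ((W i j * (n * (n * n)) / W p q : ℚ) : ℝ) := by
    intro i j
    rw [← hW, hc]
    push_cast
    ring
  have hsc : ∀ i j, w i j = (⌊W i j * (n * (n * n)) / W p q⌋ : ℝ) := by
    intro i j
    simp [hw, scaledWeight, scaled]
  have hup : ∀ i j, w i j ≤ c * G.w i j := by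
    intro i j
    rw [hval, hsc]
    exact_mod_cast Int.floor_le _
  have hlo : ∀ i j, c * G.w i j - w i j ≤ 1 := by
    intro i j
    rw [hval, hsc]
    have := (Int.lt_floor_add_one (W i j * (n * (n * n)) / W p q)).le
    have : ((W i j * (n * (n * n)) / W p q : ℚ) : ℝ) ≤
        (⌊W i j * (n * (n * n)) / W p q⌋ : ℝ) + 1 := by exact_mod_cast this
    linarith
  have hT : 0 < G.total := G.total_pos
  have hcT : (n : ℝ) ^ 3 ≤ c * G.total := by
    have h1 : (W p q : ℝ) ≤ G.total := by
      rw [show (W p q : ℝ) = G.w ⟨p, hp⟩ ⟨q, hq⟩ from hW ⟨p, hp⟩ ⟨q, hq⟩, WeightedGraph.total]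
      refine (Finset.single_le_sum (f := fun j : Fin n => G.w ⟨p, hp⟩ j) (fun j _ => G.nonneg _ j)
        (Finset.mem_univ (⟨q, hq⟩ : Fin n))).trans ?_
      exact Finset.single_le_sum (f := fun i => ∑ j, G.w i j)
        (fun i _ => Finset.sum_nonneg fun j _ => G.nonneg i j) (Finset.mem_univ (⟨p, hp⟩ : Fin n))
    rw [hc, div_mul_eq_mul_div, le_div_iff₀ hmR]
    exact mul_le_mul_of_nonneg_left h1 (by positivity)
  -- The heaviest edge alone has scaled weight `n ^ 3`, while rounding down costs at most `1` per
  -- ordered pair, hence `n ^ 2` in all.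
  have hcT2 : 18 * (n : ℝ) ^ 2 ≤ c * G.total := by nlinarith [sq_nonneg (n : ℝ)]
  have hdiff : ∀ z : Fin n → Fin n → ℝ, (∀ i j, z i j ≤ 1) →
      ∑ i, ∑ j, (c * G.w i j - w i j) * z i j ≤ (n : ℝ) ^ 2 := by
    intro z hz
    have : ∀ i j, (c * G.w i j - w i j) * z i j ≤ 1 := by
      intro i j
      have h0 : 0 ≤ c * G.w i j - w i j := by linarith [hup i j]
      exact (mul_le_of_le_one_right h0 (hz i j)).trans (hlo i j)
    refine (Finset.sum_le_sum fun i _ => Finset.sum_le_sum fun j _ => this i j).trans ?_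
    simp
    nlinarith
  have htot : c * G.total - ∑ i, ∑ j, w i j ≤ (n : ℝ) ^ 2 := by
    have := hdiff (fun _ _ => 1) fun _ _ => le_rfl
    simp_rw [mul_one, Finset.sum_sub_distrib, ← Finset.mul_sum] at this
    exact this
  have hhat : c * G.total ≤ 2 * ∑ i, ∑ j, w i j := by nlinarith [sq_nonneg (n : ℝ)]
  have hhat0 : 0 < ∑ i, ∑ j, w i j := by nlinarith [mul_pos hc0 hT]
  -- Rounding does not increase the uncut weight and keeps at least half of the total, so `ε` at
  -- most doubles; the passage to open weights doubles it once more, which explains the `4 * ε` in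
  -- `hgood`.
  have hwval : (1 - 2 * ε) * ∑ i, ∑ j, w i j ≤ ∑ i, ∑ j, w i j * cutProb μ i j := by
    rw [objective, le_div_iff₀ hT] at hobj
    have h1 : ∑ i, ∑ j, w i j * (1 - cutProb μ i j) ≤
        ∑ i, ∑ j, c * G.w i j * (1 - cutProb μ i j) :=
      Finset.sum_le_sum fun i _ => Finset.sum_le_sum fun j _ =>
        mul_le_mul_of_nonneg_right (hup i j) (by linarith [cutProb_le_one hμ ht i j])
    simp_rw [mul_sub, mul_one, Finset.sum_sub_distrib, mul_assoc, ← Finset.mul_sum] at h1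
    have h2 : c * ((1 - ε) * G.total) ≤ c * ∑ i, ∑ j, G.w i j * cutProb μ i j :=
      mul_le_mul_of_nonneg_left hobj hc0.le
    have h3 : ε * (c * G.total) ≤ ε * (2 * ∑ i, ∑ j, w i j) := mul_le_mul_of_nonneg_left hhat hε
    change _ ≤ c * G.total - _ at h1
    linarith
  have hinv₁ : Inv n W p q s₁ := by
    have he : entries n (s₁.arr 0) = 0 := by
      funext i
      rw [a₁.arr 0 (by simp)]
      exact hs i
    exact ⟨by rw [he]; intro i; simp, by rw [he]; exact isAhead_zero _, hvp, hvq⟩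
  obtain ⟨hinv₂, hcut₂⟩ := run_searchCmd h hinv₁ (fun x hx hxT => by
    refine hgood _ (openWeight_symm h.scaledWeight_symm x)
      (openWeight_nonneg h.scaledWeight_nonneg hx) (by rw [← hw] at hxT ⊢; linarith) ?_
    have := le_sum_openWeight_mul_cutProb hμ ht h.scaledWeight_nonneg (ε := 2 * ε)
      (by linarith) hwval hx hxT
    rwa [show 2 * (2 * ε) = 4 * ε by ring] at this)
  set s₂ := searchCmd.run n W M s₁ with hs₂
  obtain ⟨hfull, hcut₃⟩ := run_fillCmd h hinv₂
  have hrun : cutCmd.run n W M s = fillCmd.run n W M s₂ := rfl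
  rw [hrun]
  refine ⟨hfull, ?_⟩
  set y := partialCut n (fillCmd.run n W M s₂) with hy
  rw [← hw] at hcut₃ hcut₂
  have hy1 : ∀ i j, (y i * y j : ℝ) ≤ 1 := by
    intro i j
    rcases hfull i with e | e <;> rcases hfull j with e' | e' <;> simp [e, e']
  have h1 := hdiff (fun i j => (y i * y j : ℝ)) hy1
  simp_rw [sub_mul, Finset.sum_sub_distrib, mul_assoc, ← Finset.mul_sum] at h1
  change c * cutForm G.w y - cutForm w y ≤ _ at h1
  -- Undoing the rounding costs `16 * n ^ 2` in the form and `2 * n ^ 2` in the total, which leaves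
  -- `18 * n ^ 2 - c * G.total ≤ 0`. This is where `18` comes from.
  have h2 : c * (16 * cutForm G.w y + G.total) ≤ 0 := by nlinarith
  have h3 : 16 * cutForm G.w y + G.total ≤ 0 := by
    by_contra hpos
    push Not at hpos
    exact absurd (mul_pos hc0 hpos) (not_lt.2 h2)
  linarith

end Correct

/-! ### The complete program -/

/-- Compute the bound `2 ^ n ^ 5` for stored values. -/
def prologue : Prog :=
  .seq (.store (.const 1) (.const 0)) (.seq (.store boundAddr (.const 1))
    (.while (.load (ctrAddr 0)) (Term.mul .size (.mul .size (.mul .size (.mul .size .size)))).toExpr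
      (.seq (.store boundAddr (.add (.load boundAddr) (.load boundAddr)))
        (.store (ctrAddr 0) (.add (.load (ctrAddr 0)) (.const 1))))))

/-- Write the cut to the cells `1, …, n - 1`. The content of cell `0` is not zero, which puts vertex
`0` on the side of the vertices with the same sign. -/
def epilogue : Prog :=
  .seq (.store (ctrAddr 0) (.const 1)) (.seq (.store (ctrAddr 1) (.const 0))
    (.while (.load (ctrAddr 0)) (.load (.const 0))
      (.seq (.ite (Term.mul (.arr 0 0) (.arr 0 1)).toExpr (.const 0)
          (.store (.load (ctrAddr 0)) (.const 0)) (.store (.load (ctrAddr 0)) (.const 1)))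
        (.store (ctrAddr 0) (.add (.load (ctrAddr 0)) (.const 1))))))

/-- The rounding algorithm. -/
def roundProg : Prog := .seq prologue (.seq cutCmd.toProg epilogue)

section Program

variable {n M Q : ℕ} {I : Input}

theorem Rep.setBound (hn : 0 < n) {s : St} {σ : Mem} (h : Rep n M s σ) (M' : ℕ) :
    Rep n M' s (Function.update σ n M') where
  size := by rw [Function.update_of_ne (by omega), h.size]
  bound := by simp
  ctr u := by rw [Function.update_of_ne (by omega), h.ctr]
  var u := by rw [Function.update_of_ne (by omega), h.var]
  arr b i := by rw [Function.update_of_ne (by omega), h.arr]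

theorem Rep.setOutput {s : St} {σ : Mem} (h : Rep n M s σ) {a : ℕ} (ha : 0 < a) (han : a < n)
    (v : ℚ) : Rep n M s (Function.update σ a v) where
  size := by rw [Function.update_of_ne (by omega), h.size]
  bound := by rw [Function.update_of_ne (by omega), h.bound]
  ctr u := by rw [Function.update_of_ne (by omega), h.ctr]
  var u := by rw [Function.update_of_ne (by omega), h.var]
  arr b i := by rw [Function.update_of_ne (by omega), h.arr]

theorem exec_store (hI : I.Bounded Q) {σ : Mem} (hσ : σ.Bounded Q) (a e : Expr) :
    ∃ k, Exec I (.store a e) σ k (Function.update σ ⌊a.eval I σ⌋₊ (e.eval I σ)) ∧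
      k ≤ (1 + a.factor + e.factor) * (Q + 1) := by
  have h1 := (Expr.cost_le hI hσ a).1
  have h2 := (Expr.cost_le hI hσ e).1
  refine ⟨_, Exec.store a e σ, ?_⟩
  nlinarith

theorem exec_while (hI : I.Bounded Q) {e₁ e₂ : Expr} {c : Prog} (P : ℕ → Mem → Prop) {N L : ℕ}
    (hb : ∀ k ≤ N, ∀ σ, P k σ → σ.Bounded Q)
    (hlt : ∀ k ≤ N, ∀ σ, P k σ → (e₁.eval I σ < e₂.eval I σ ↔ k < N))
    (hstep : ∀ k < N, ∀ σ, P k σ → ∃ κ σ', Exec I c σ κ σ' ∧ κ ≤ L * (Q + 1) ∧ P (k + 1) σ')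
    {σ : Mem} {k₀ : ℕ} (hk₀ : k₀ ≤ N) (h0 : P k₀ σ) :
    ∃ κ σ', Exec I (.while e₁ e₂ c) σ κ σ' ∧
      κ ≤ (N + 1) * ((L + 1 + e₁.factor + e₂.factor) * (Q + 1)) ∧ P N σ' := by
  set F := (L + 1 + e₁.factor + e₂.factor) * (Q + 1) with hF
  have hF' : 1 + e₁.factor * (Q + 1) + e₂.factor * (Q + 1) + L * (Q + 1) ≤ F := by
    rw [hF]
    nlinarith
  have key : ∀ r k, k + r = N → ∀ σ, P k σ → ∃ κ σ', Exec I (.while e₁ e₂ c) σ κ σ' ∧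
      κ ≤ (r + 1) * F ∧ P N σ' := by
    intro r
    induction r with
    | zero =>
      intro k hk σ hP
      have c1 := (Expr.cost_le hI (hb k (by omega) σ hP) e₁).1
      have c2 := (Expr.cost_le hI (hb k (by omega) σ hP) e₂).1
      have hkN : k = N := by omega
      subst hkN
      refine ⟨_, σ, Exec.while_false ?_, ?_, hP⟩
      · rw [hlt k le_rfl σ hP]
        exact lt_irrefl k
      · omega
    | succ r ih =>
      intro k hk σ hP
      have c1 := (Expr.cost_le hI (hb k (by omega) σ hP) e₁).1
      have c2 := (Expr.cost_le hI (hb k (by omega) σ hP) e₂).1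
      obtain ⟨κ, σ₁, h₁, hκ, hP₁⟩ := hstep k (by omega) σ hP
      obtain ⟨κ', σ₂, h₂, hκ', hP₂⟩ := ih (k + 1) (by omega) σ₁ hP₁
      refine ⟨_, σ₂, Exec.while_true ((hlt k (by omega) σ hP).2 (by omega)) h₁ h₂, ?_, hP₂⟩
      have : (r + 1 + 1) * F = (r + 1) * F + F := by ring
      omega
  obtain ⟨κ, σ', h, hκ, hP⟩ := key (N - k₀) k₀ (by omega) σ h0
  exact ⟨κ, σ', h, hκ.trans (Nat.mul_le_mul_right _ (by omega)), hP⟩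

theorem size_two_pow (k : ℕ) : (2 ^ k).size = k + 1 := Nat.size_pow

theorem bitSize_natCast (m : ℕ) : bitSize (m : ℚ) = m.size + 1 := by
  have := bitSize_intCast (m : ℤ)
  simpa using this

theorem size_le_self (m : ℕ) : m.size ≤ m := Nat.size_le.2 Nat.lt_two_pow_self

/-- The empty state, with the counter `0` set. -/
def counting (k : ℕ) : St := ⟨Function.update 0 0 k, 0, 0⟩

theorem exec_prologue : ∃ K : ℕ, ∀ (n Q : ℕ) (I : Input) (t : ℕ), 2 ≤ n → I.Bounded Q →
    n ^ 5 + 3 ≤ Q → ∃ k σ, Exec I prologue (initialMem n t) k σ ∧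
      k ≤ K * (n ^ 5 + 1) * (Q + 1) ∧ Rep n (2 ^ n ^ 5) (counting (n ^ 5)) σ ∧ σ.Bounded Q := by
  set five : Expr := (Term.mul .size (.mul .size (.mul .size (.mul .size .size)))).toExpr with hfive
  set dbl : Expr := .add (.load boundAddr) (.load boundAddr) with hdbl
  set inc : Expr := .add (.load (ctrAddr 0)) (.const 1) with hinc
  set L : ℕ := (1 + boundAddr.factor + dbl.factor) + (1 + (ctrAddr 0).factor + inc.factor) with hL
  refine ⟨(1 + (Expr.const 1).cost ⟨0, 0⟩ 0 + (Expr.const 0).cost ⟨0, 0⟩ 0) +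
    (1 + boundAddr.factor + (Expr.const 1).factor) +
    (L + 1 + (Expr.load (ctrAddr 0)).factor + five.factor), fun n Q I t hn hI hQ => ?_⟩
  have hn5 : n ≤ n ^ 5 := Nat.le_self_pow (by norm_num) n
  have hpow : ∀ k ≤ n ^ 5, bitSize ((2 ^ k : ℕ) : ℚ) ≤ Q := by
    intro k hk
    rw [bitSize_natCast, size_two_pow]
    omega
  have hnat : ∀ k ≤ n ^ 5, bitSize (k : ℚ) ≤ Q := by
    intro k hk
    rw [bitSize_natCast]
    have := size_le_self k
    omega
  -- The degree in cell `1` is not needed; erasing it makes the bound on bit lengths independent of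
  -- `t`.
  set σ₁ : Mem := Function.update (initialMem n t) 1 0 with hσ₁
  have hσ₁v : ∀ a, σ₁ a = if a = 0 then (n : ℚ) else 0 := by
    intro a
    rw [hσ₁]
    by_cases h1 : a = 1
    · simp [h1]
    · simp [h1, initialMem]
  have ex₁ : Exec I (.store (.const 1) (.const 0)) (initialMem n t)
      (1 + (Expr.const 1).cost ⟨0, 0⟩ 0 + (Expr.const 0).cost ⟨0, 0⟩ 0) σ₁ := by
    have := Exec.store (I := I) (.const 1) (.const 0) (initialMem n t)
    simpa [Expr.eval, Expr.cost] using this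
  have hb₁ : σ₁.Bounded Q := by
    intro a
    rw [hσ₁v]
    split_ifs
    · exact hnat n hn5
    · simpa using hnat 0 (by omega)
  obtain ⟨k₂, ex₂, hk₂⟩ := exec_store hI hb₁ boundAddr (.const 1)
  have hba : ⌊boundAddr.eval I σ₁⌋₊ = n := by simp [boundAddr, Expr.eval, hσ₁v]
  rw [hba] at ex₂
  set σ₂ : Mem := Function.update σ₁ n ((Expr.const 1).eval I σ₁) with hσ₂
  have hr₂ : Rep n (2 ^ 0) (counting 0) σ₂ := by
    have hz : ∀ a, n < a → σ₂ a = 0 := by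
      intro a ha
      rw [hσ₂, Function.update_of_ne (by omega), hσ₁v, if_neg (by omega)]
    refine ⟨?_, ?_, fun v => ?_, fun v => ?_, fun b i => ?_⟩
    · rw [hσ₂, Function.update_of_ne (by omega), hσ₁v, if_pos rfl]
    · simp [hσ₂, Expr.eval]
    · rw [hz _ (by omega)]
      simp [counting]
    · rw [hz _ (by omega)]
      simp [counting]
    · rw [hz _ (by omega)]
      simp [counting]
  have hb₂ : σ₂.Bounded Q := hb₁.update n (by simpa [Expr.eval] using hnat 1 (by omega))
  have hset : ∀ k k' : ℕ, (counting k).setCtr 0 k' = counting k' := by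
    intro k k'
    simp [counting, St.setCtr]
  obtain ⟨κ, σ₃, ex₃, hκ, hr₃, hb₃⟩ := exec_while hI (e₁ := .load (ctrAddr 0)) (e₂ := five)
    (c := .seq (.store boundAddr dbl) (.store (ctrAddr 0) inc))
    (fun k σ => Rep n (2 ^ k) (counting k) σ ∧ σ.Bounded Q) (N := n ^ 5) (L := L)
    (fun k _ σ h => h.2)
    (fun k _ σ h => by
      rw [hfive, h.1.eval_toExpr]
      simp only [Expr.eval, h.1.floor_ctrAddr, h.1.ctr, Term.val]
      have : (n * (n * (n * (n * n))) : ℚ) = ((n ^ 5 : ℕ) : ℚ) := by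
        push_cast
        ring
      rw [this, Nat.cast_lt]
      simp [counting])
    (fun k hk σ h => by
      obtain ⟨hr, hb⟩ := h
      obtain ⟨k₁, e₁, hk₁⟩ := exec_store hI hb boundAddr dbl
      have v1 : ⌊boundAddr.eval I σ⌋₊ = n := by simp [boundAddr, Expr.eval, hr.size]
      have v2 : dbl.eval I σ = ((2 ^ (k + 1) : ℕ) : ℚ) := by
        rw [hdbl, Expr.eval, Expr.eval, v1, hr.bound]
        push_cast
        ring
      rw [v1, v2] at e₁
      have hr' := hr.setBound (by omega) (2 ^ (k + 1))
      have hb' := hb.update n (hpow (k + 1) (by omega))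
      obtain ⟨k₂, e₂, hk₂⟩ := exec_store hI hb' (ctrAddr 0) inc
      have v3 : inc.eval I (Function.update σ n ((2 ^ (k + 1) : ℕ) : ℚ)) = ((k + 1 : ℕ) : ℚ) := by
        simp only [hinc, Expr.eval, hr'.floor_ctrAddr, hr'.ctr]
        simp [counting]
      rw [hr'.floor_ctrAddr, v3] at e₂
      refine ⟨_, _, e₁.seq e₂, ?_, ?_, hb'.update _ (hnat (k + 1) (by omega))⟩
      · rw [hL, add_mul]
        exact add_le_add hk₁ hk₂
      · have := hr'.setCtr (by omega) 0 (k + 1)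
        rwa [hset] at this)
    (Nat.zero_le _) ⟨hr₂, hb₂⟩
  refine ⟨_, σ₃, ex₁.seq (ex₂.seq ex₃), ?_, hr₃, hb₃⟩
  have e1 : ∀ a b c : ℕ, (a + b + c) * (n ^ 5 + 1) * (Q + 1) =
      (n ^ 5 + 1) * (a * (Q + 1)) + (n ^ 5 + 1) * (b * (Q + 1)) +
        (n ^ 5 + 1) * (c * (Q + 1)) := by
    intro a b c
    ring
  have e2 : ∀ a : ℕ, a ≤ (n ^ 5 + 1) * a := fun a => Nat.le_mul_of_pos_left a (by omega)
  have e3 : ∀ a : ℕ, a ≤ a * (Q + 1) := fun a => Nat.le_mul_of_pos_right a (by omega)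
  rw [e1, ← add_assoc]
  exact add_le_add (add_le_add ((e3 _).trans (e2 _)) (hk₂.trans (e2 _))) hκ

theorem exec_epilogue : ∃ K : ℕ, ∀ (n M Q : ℕ) (I : Input) (s : St) (σ : Mem), 0 < n →
    I.Bounded Q → n + 2 ≤ Q → Rep n M s σ → σ.Bounded Q →
    ∃ k σ', Exec I epilogue σ k σ' ∧ k ≤ K * (n + 1) * (Q + 1) ∧ σ' 0 = n ∧
      ∀ i, 0 < i → i < n → σ' i = if s.arr 0 i * s.arr 0 0 < 0 then 0 else 1 := by
  set test : Expr := (Term.mul (.arr 0 0) (.arr 0 1)).toExpr with htest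
  set inc : Expr := .add (.load (ctrAddr 0)) (.const 1) with hinc
  set out : Expr := .load (ctrAddr 0) with hout
  set L : ℕ := (1 + test.factor + (Expr.const 0).factor +
    ((1 + out.factor + (Expr.const 0).factor) + (1 + out.factor + (Expr.const 1).factor))) +
    (1 + (ctrAddr 0).factor + inc.factor) with hL
  refine ⟨(1 + (ctrAddr 0).factor + (Expr.const 1).factor) +
    (1 + (ctrAddr 1).factor + (Expr.const 0).factor) +
    (L + 1 + out.factor + (Expr.load (.const 0)).factor), fun n M Q I s σ hn hI hQ hr hσ => ?_⟩
  have hnat : ∀ k ≤ n, bitSize (k : ℚ) ≤ Q := by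
    intro k hk
    rw [bitSize_natCast]
    have := size_le_self k
    omega
  have hb0 : bitSize (0 : ℚ) ≤ Q := by simpa using hnat 0 (by omega)
  have hb1 : bitSize (1 : ℚ) ≤ Q := by simpa using hnat 1 (by omega)
  obtain ⟨k₁, ex₁, hk₁⟩ := exec_store hI hσ (ctrAddr 0) (.const 1)
  rw [hr.floor_ctrAddr] at ex₁
  have hr₁ := hr.setCtr hn 0 1
  have hσ₁ := hσ.update (n + (1 + (0 : Fin 8))) (hnat 1 (by omega))
  have v1 : (Expr.const 1).eval I σ = ((1 : ℕ) : ℚ) := by simp [Expr.eval]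
  rw [v1] at ex₁
  obtain ⟨k₂, ex₂, hk₂⟩ := exec_store hI hσ₁ (ctrAddr 1) (.const 0)
  rw [hr₁.floor_ctrAddr] at ex₂
  have hr₂ := hr₁.setCtr hn 1 0
  have hσ₂ := hσ₁.update (n + (1 + (1 : Fin 8))) (hnat 0 (by omega))
  have v2 : ∀ σ, (Expr.const 0).eval I σ = ((0 : ℕ) : ℚ) := fun σ => by simp [Expr.eval]
  rw [v2] at ex₂
  set s' : ℕ → St := fun k => ((s.setCtr 0 1).setCtr 1 0).setCtr 0 k with hs'
  have hs'0 : ∀ k, (s' k).ctr 0 = k := by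
    intro k
    simp [hs']
  have hs'1 : ∀ k, (s' k).ctr 1 = 0 := by
    intro k
    simp [hs', St.setCtr]
  have hs's : ∀ k k', (s' k).setCtr 0 k' = s' k' := by
    intro k k'
    simp [hs', St.setCtr]
  have hs'start : s' 1 = (s.setCtr 0 1).setCtr 1 0 := by
    ext v
    · by_cases h0 : v = 0
      · subst h0
        simp [hs', St.setCtr]
      · simp [hs', St.setCtr, h0]
    · rfl
    · rfl
  obtain ⟨κ, σ₃, ex₃, hκ, -, hr₃, -, hout₃⟩ := exec_while hI (e₁ := out) (e₂ := .load (.const 0))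
    (c := .seq (.ite test (.const 0) (.store out (.const 0)) (.store out (.const 1)))
      (.store (ctrAddr 0) inc))
    (fun k σ => 0 < k ∧ Rep n M (s' k) σ ∧ σ.Bounded Q ∧
      ∀ i, 0 < i → i < k → σ i = if s.arr 0 i * s.arr 0 0 < 0 then 0 else 1)
    (N := n) (L := L)
    (fun k _ σ h => h.2.2.1)
    (fun k _ σ h => by
      simp only [hout, Expr.eval, h.2.1.floor_ctrAddr, h.2.1.ctr, hs'0, Nat.floor_zero, h.2.1.size,
        Nat.cast_lt])
    (fun k hk σ h => by
      obtain ⟨h0, hr, hb, hres⟩ := h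
      have hov : out.eval I σ = k := by
        simp only [hout, Expr.eval, hr.floor_ctrAddr, hr.ctr, hs'0]
      have htv : test.eval I σ = ((s.arr 0 k * s.arr 0 0 : ℤ) : ℚ) := by
        rw [htest, hr.eval_toExpr]
        simp only [Term.val, hs'0, hs'1]
        push_cast
        rfl
      obtain ⟨κ₁, e₁, hκ₁⟩ : ∃ κ, Exec I
          (.ite test (.const 0) (.store out (.const 0)) (.store out (.const 1))) σ κ
          (Function.update σ k (if s.arr 0 k * s.arr 0 0 < 0 then 0 else 1)) ∧
          κ ≤ (1 + test.factor + (Expr.const 0).factor + ((1 + out.factor + (Expr.const 0).factor) +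
            (1 + out.factor + (Expr.const 1).factor))) * (Q + 1) := by
        have c1 := (Expr.cost_le hI hb test).1
        have c2 := (Expr.cost_le hI hb (.const 0)).1
        have hsum : ∀ f₁ f₂ f₃ f₄ c₁ c₂ κ : ℕ, c₁ ≤ f₁ * (Q + 1) → c₂ ≤ f₂ * (Q + 1) →
            κ ≤ f₃ * (Q + 1) ∨ κ ≤ f₄ * (Q + 1) →
            1 + c₁ + c₂ + κ ≤ (1 + f₁ + f₂ + (f₃ + f₄)) * (Q + 1) := by
          intro f₁ f₂ f₃ f₄ c₁ c₂ κ h₁ h₂ h₃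
          have e : (1 + f₁ + f₂ + (f₃ + f₄)) * (Q + 1) = Q + 1 + f₁ * (Q + 1) + f₂ * (Q + 1) +
              (f₃ * (Q + 1) + f₄ * (Q + 1)) := by ring
          omega
        by_cases hneg : s.arr 0 k * s.arr 0 0 < 0
        · obtain ⟨κ, e, hκ⟩ := exec_store hI hb out (.const 0)
          rw [hov, Nat.floor_natCast] at e
          refine ⟨_, Exec.ite_true (k := κ) ?_ ?_, ?_⟩
          · rw [htv]
            simpa [Expr.eval] using (by exact_mod_cast hneg : ((s.arr 0 k * s.arr 0 0 : ℤ) : ℚ) < 0)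
          · rw [if_pos hneg]
            exact e
          · exact hsum _ _ _ _ _ _ _ c1 c2 (Or.inl hκ)
        · obtain ⟨κ, e, hκ⟩ := exec_store hI hb out (.const 1)
          rw [hov, Nat.floor_natCast] at e
          refine ⟨_, Exec.ite_false (k := κ) ?_ ?_, ?_⟩
          · rw [htv, Expr.eval]
            exact_mod_cast hneg
          · rw [if_neg hneg]
            exact e
          · exact hsum _ _ _ _ _ _ _ c1 c2 (Or.inr hκ)
      have hr' := hr.setOutput h0 hk (if s.arr 0 k * s.arr 0 0 < 0 then 0 else 1)
      have hb' := hb.update k (q := if s.arr 0 k * s.arr 0 0 < 0 then 0 else 1) (by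
        split_ifs
        · exact hb0
        · exact hb1)
      obtain ⟨κ₂, e₂, hκ₂⟩ := exec_store hI hb' (ctrAddr 0) inc
      have v3 : inc.eval I (Function.update σ k
          (if s.arr 0 k * s.arr 0 0 < 0 then 0 else 1)) = ((k + 1 : ℕ) : ℚ) := by
        simp only [hinc, hout, Expr.eval, hr'.floor_ctrAddr, hr'.ctr, hs'0]
        push_cast
        rfl
      rw [hr'.floor_ctrAddr, v3] at e₂
      refine ⟨_, _, e₁.seq e₂, ?_, by omega, ?_, hb'.update _ (hnat (k + 1) (by omega)), ?_⟩
      · rw [hL, add_mul]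
        exact add_le_add hκ₁ hκ₂
      · have := hr'.setCtr hn 0 (k + 1)
        rwa [hs's] at this
      · intro i hi hik
        rw [Function.update_of_ne (by omega)]
        rcases eq_or_ne i k with rfl | hne
        · simp
        · rw [Function.update_of_ne hne]
          exact hres i hi (by omega))
    (k₀ := 1) (by omega) ⟨by omega, by rw [hs'start]; exact hr₂, hσ₂, fun i h1 h2 => by omega⟩
  refine ⟨_, σ₃, ex₁.seq (ex₂.seq ex₃), ?_, hr₃.size, hout₃⟩
  have e1 : ∀ a b c : ℕ, (a + b + c) * (n + 1) * (Q + 1) =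
      (n + 1) * (a * (Q + 1)) + (n + 1) * (b * (Q + 1)) + (n + 1) * (c * (Q + 1)) := by
    intro a b c
    ring
  have e2 : ∀ a : ℕ, a ≤ (n + 1) * a := fun a => Nat.le_mul_of_pos_left a (by omega)
  rw [e1, ← add_assoc]
  exact add_le_add (add_le_add (hk₁.trans (e2 _)) (hk₂.trans (e2 _))) hκ

theorem cutCmd_wf : cutCmd.WF := by
  simp [cutCmd, heaviestCmd, searchCmd, startCmd, fillCmd, degreeCmd, prodCmd, initCmd, tryCmd,
    stepCmd, sweepCmd, measureCmd, extendCmd, sum₂, rowSums, Cmd.WF, Cmd.noLoop]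

/-- The program halts in polynomial time, and outputs the cut that its structured part computes. -/
theorem exec_roundProg : ∃ P : Polynomial ℕ, ∀ (n B : ℕ) (I : Input) (t : ℕ), 2 ≤ n →
    I.Bounded (B + 1) → ∃ k σ, Exec I roundProg (initialMem n t) k σ ∧ k ≤ P.eval (n + B) ∧
      σ 0 = n ∧ ∀ i, 0 < i → i < n →
        σ i = if (cutCmd.run n I.weight (2 ^ n ^ 5) (counting (n ^ 5))).arr 0 i *
          (cutCmd.run n I.weight (2 ^ n ^ 5) (counting (n ^ 5))).arr 0 0 < 0 then 0 else 1 := by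
  obtain ⟨K₁, h₁⟩ := exec_prologue
  obtain ⟨K₂, h₂⟩ := exec_epilogue
  obtain ⟨p, hp⟩ := cutCmd.exists_polynomial
  refine ⟨(Polynomial.C K₁ * (Polynomial.X ^ 5 + 1) + p + Polynomial.C K₂ * (Polynomial.X + 1)) *
    (Polynomial.X ^ 5 + Polynomial.X + 5), fun n B I t hn hI => ?_⟩
  -- One common bit bound for the input, for the addresses, and for all stored values, which are at
  -- most `2 ^ n ^ 5` in absolute value.
  have hI' : I.Bounded (n ^ 5 + B + 4) :=
    ⟨fun i j => (hI.1 i j).trans (by omega), fun c => (hI.2 c).trans (by omega)⟩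
  have hn5 : n ≤ n ^ 5 := Nat.le_self_pow (by norm_num) n
  obtain ⟨k₁, σ₁, e₁, hk₁, hr₁, hb₁⟩ := h₁ n _ I t hn hI' (by omega)
  obtain ⟨k₂, σ₂, e₂, hk₂, hr₂, hb₂⟩ := cutCmd.exec_toProg (by omega) hI'
    (by rw [size_two_pow]; omega) (hn5.trans Nat.lt_two_pow_self.le) cutCmd_wf _ _ hr₁ hb₁
  obtain ⟨k₃, σ₃, e₃, hk₃, h0, hout⟩ := h₂ n _ _ I _ σ₂ (by omega) hI' (by omega) hr₂ hb₂
  refine ⟨_, σ₃, e₁.seq (e₂.seq e₃), ?_, h0, hout⟩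
  simp only [Polynomial.eval_mul, Polynomial.eval_add, Polynomial.eval_C, Polynomial.eval_pow,
    Polynomial.eval_X, Polynomial.eval_one, Polynomial.eval_ofNat]
  have hx5 : n ^ 5 ≤ (n + B) ^ 5 := Nat.pow_le_pow_left (by omega) 5
  have hc : cutCmd.cost n ≤ p.eval (n + B) := by
    rw [← hp]
    exact Cmd.cost_mono _ (by omega)
  have hsum : k₁ + (k₂ + k₃) ≤
      (K₁ * (n ^ 5 + 1) + cutCmd.cost n + K₂ * (n + 1)) * (n ^ 5 + B + 4 + 1) := by
    rw [add_mul, add_mul]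
    omega
  refine hsum.trans (Nat.mul_le_mul ?_ (by omega))
  exact add_le_add (add_le_add (Nat.mul_le_mul_left _ (by omega)) hc)
    (Nat.mul_le_mul_left _ (by omega))

end Program

/-! ### The main theorem -/

/-- From `n ≤ 2 ^ n` the exponent is at most `5n + 4n³`, which is below `n ^ 5` for `n ≥ 3`. Hence
the bound computed by `prologue` is never exceeded in the analysis. -/
theorem big_le_two_pow {n : ℕ} (hn : 3 ≤ n) :
    (n : ℤ) ^ 4 * (2 * ((n : ℤ) ^ 4) ^ n) ^ n ≤ ((2 ^ n ^ 5 : ℕ) : ℤ) := by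
  have h1 : n ≤ 2 ^ n := Nat.lt_two_pow_self.le
  have h4 : n ^ 4 ≤ 2 ^ (n * 4) := by
    rw [pow_mul]
    exact Nat.pow_le_pow_left h1 4
  have h : n ^ 4 * (2 * (n ^ 4) ^ n) ^ n ≤ 2 ^ n ^ 5 := by
    calc n ^ 4 * (2 * (n ^ 4) ^ n) ^ n ≤ 2 ^ (n * 4) * (2 * (2 ^ (n * 4)) ^ n) ^ n := by gcongr
      _ = 2 ^ (n * 4 + (1 + n * 4 * n) * n) := by
        rw [← pow_mul, ← pow_succ', ← pow_mul, ← pow_add, add_comm (n * 4 * n) 1]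
      _ ≤ 2 ^ n ^ 5 := by
        refine Nat.pow_le_pow_right (by norm_num) ?_
        have h2 : 9 ≤ n * n := Nat.mul_le_mul hn hn
        nlinarith [Nat.mul_le_mul h2 h2, Nat.mul_le_mul h2 (le_refl n)]
  exact_mod_cast h

theorem two_le_of_weightedGraph {n : ℕ} (G : WeightedGraph n) : 2 ≤ n := by
  obtain ⟨i, j, hij⟩ := exists_pos_weight G
  have hne : i ≠ j := by
    rintro rfl
    exact hij.ne' (G.loopless i)
  have : (i : ℕ) ≠ j := fun h => hne (Fin.ext h)
  omega

theorem bounded_roundingInput {n t B : ℕ} {w : Fin n → Fin n → ℚ} {μ : LocalFamily n ℚ}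
    (h : BitBound t w μ B) : (roundingInput t w μ).Bounded (B + 1) := by
  have h0 : bitSize 0 = 1 := by simp [bitSize]
  refine ⟨fun i j => ?_, fun c => ?_⟩
  · simp only [roundingInput]
    split_ifs
    · exact (h.1 _ _).trans (by omega)
    · omega
  · simp only [roundingInput]
    split_ifs with hc
    · exact (h.2 _ hc _).trans (by omega)
    · omega

theorem outputCut_eq_iff {n : ℕ} (hn : 0 < n) {σ : Mem} {x : ℕ → ℤ}
    (hx : ∀ i : Fin n, x i = 1 ∨ x i = -1) (h0 : σ 0 = n)
    (h : ∀ i, 0 < i → i < n → σ i = if x i * x 0 < 0 then 0 else 1) (i j : Fin n) :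
    outputCut n σ i = outputCut n σ j ↔ x i = x j := by
  have h00 := hx ⟨0, hn⟩
  have key : ∀ i : Fin n, outputCut n σ i = decide (x i = x 0) := by
    intro i
    unfold outputCut
    rcases Nat.eq_zero_or_pos (i : ℕ) with hi | hi
    · simp [hi, h0, hn.ne']
    · rw [h i hi i.2]
      rcases hx i with e | e <;> rcases h00 with e' | e' <;> simp only at e' <;> simp [e, e']
  rw [key, key]
  rcases hx i with e | e <;> rcases hx j with e' | e' <;> rcases h00 with e'' | e'' <;>
    simp only at e'' <;> simp [e, e', e'']

/-- One program serves for all `α`. The solution `μ` enters only through `h`, as a witness that some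
candidate is good. Rounding the weights halves the guaranteed surplus, from `1/16` to `1/32`. -/
theorem isPolyTimeRounding_roundProg {α ε : ℝ} {n₀ : ℕ} (hε : 0 ≤ ε) (hε' : ε ≤ 1 / 32)
    (hn₀ : 18 ≤ n₀) (h : ∀ n, n₀ ≤ n → 3 ≤ degree α n ∧
      ∀ (μ : LocalFamily n ℝ), IsLocalPseudodistribution (degree α n) μ →
      ∀ a : Fin n → Fin n → ℝ, (∀ i j, a i j = a j i) → (∀ i j, 0 ≤ a i j) →
      0 < ∑ i, ∑ j, a i j →
      (1 - 4 * ε) * ∑ i, ∑ j, a i j ≤ ∑ i, ∑ j, a i j * cutProb μ i j →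
      ∃ i, ∃ k < n, ∃ r, GoodCut a (sweep (fun j => (walk a ^ k) j i) r)) :
    IsPolyTimeRounding α ε n₀ roundProg := by
  obtain ⟨P, hP⟩ := exec_roundProg
  refine ⟨P, fun n G w μ B hw hμ hB => ?_⟩
  have hn2 := two_le_of_weightedGraph G
  obtain ⟨k, σ, hex, hk, h0, hout⟩ := hP n B _ (degree α n) hn2 (bounded_roundingInput hB)
  refine ⟨k, σ, hex, hk, fun hn hobj => ?_⟩
  obtain ⟨ht, hgood⟩ := h n hn
  obtain ⟨hfull, hcut⟩ := run_cutCmd (W := (roundingInput (degree α n) w μ).weight)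
    (M := 2 ^ n ^ 5) (s := counting (n ^ 5)) G
    (fun i j => by simp [roundingInput, hw])
    (fun j l hjl => by simp only [roundingInput, dif_neg hjl]) (by omega)
    (big_le_two_pow (by omega)) (fun j => rfl) hμ (by omega) hε (hgood _ hμ) hobj
  rw [cutValue_eq G hfull (outputCut_eq_iff (by omega) hfull h0 hout)]
  have hT : 0 < G.total := G.total_pos
  have : cutForm G.w (partialCut n (cutCmd.run n (roundingInput (degree α n) w μ).weight (2 ^ n ^ 5)
      (counting (n ^ 5)))) / (2 * G.total) ≤ -(1 / 32) := by
    rw [div_le_iff₀ (by linarith)]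
    linarith
  linarith

/-- The argument only needs `ε` to be a small multiple of `min 1 α`. This follows from `exp (-x) ≤ 1
/ x`, because `1 / α ^ 3` is at least `1 / α` for `α ≤ 1`. -/
theorem exp_neg_mul_max_le {α : ℝ} (hα : 0 < α) {C : ℝ} (hC : 0 < C) :
    Real.exp (-(C * max 1 (1 / α ^ 3))) ≤ min 1 α / C := by
  set m := max 1 (1 / α ^ 3) with hm
  have hm1 : 1 ≤ m := le_max_left _ _
  have hβ : 0 < min 1 α := lt_min one_pos hα
  have h1 : 1 ≤ min 1 α * m := by
    rcases le_total 1 α with h | h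
    · rw [min_eq_left h, one_mul]
      exact hm1
    · rw [min_eq_right h]
      have h2 : 1 / α ^ 3 ≤ m := le_max_right _ _
      have h3 : α ^ 2 ≤ 1 := pow_le_one₀ hα.le h
      calc (1 : ℝ) ≤ 1 / α ^ 2 := by
            rw [le_div_iff₀ (by positivity)]
            linarith
        _ = α * (1 / α ^ 3) := by field_simp
        _ ≤ α * m := mul_le_mul_of_nonneg_left h2 hα.le
  have h4 := Real.add_one_le_exp (C * m)
  rw [Real.exp_neg, inv_le_comm₀ (Real.exp_pos _) (by positivity), inv_div,
    div_le_iff₀ hβ]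
  have h5 : C ≤ C * (min 1 α * m) := le_mul_of_one_le_right hC.le h1
  nlinarith

end SAMaxCut

open SAMaxCut
theorem mainTheorem1 :
    ∃ C : ℝ, 0 < C ∧ ∀ α : ℝ, 0 < α →
      ∃ ε : ℝ, ε = Real.exp (-(C * max 1 (1 / α ^ 3))) ∧
      ∃ n₀ : ℕ,
        (∀ (n : ℕ) (G : WeightedGraph n), n₀ ≤ n → 1 - ε ≤ saValue (degree α n) G →
          ∃ x : Fin n → Bool, 1 / 2 + ε ≤ cutValue G x) ∧
        (∃ c : Prog, IsPolyTimeRounding α ε n₀ c) ∧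
        (∀ (n : ℕ) (G : WeightedGraph n), n₀ ≤ n →
          maxCut G ≤ saValue (degree α n) G ∧
            (1 / 2 + ε) * saValue (degree α n) G ≤ maxCut G) := by
  -- `16384 = 4 * 4096`, since `exists_cutValue_ge` is applied with `4 * ε`.
  refine ⟨16384, by norm_num, fun α hα => ⟨_, rfl, ?_⟩⟩
  have hle := exp_neg_mul_max_le hα (C := 16384) (by norm_num)
  set ε := Real.exp (-(16384 * max 1 (1 / α ^ 3))) with hε
  have hε0 : 0 < ε := Real.exp_pos _
  have hβ : 0 < min 1 α := lt_min one_pos hα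
  have hβ1 : min 1 α ≤ 1 := min_le_left _ _
  have hε1 : ε ≤ 1 / 32 := by linarith
  have hev := ((exists_cutValue_ge (ε := 4 * ε) hβ hβ1 (min_le_right 1 α) (by linarith)
    (by linarith)).and (eventually_exists_goodCut (ε := 4 * ε) hβ hβ1 (min_le_right 1 α)
    (by linarith) (by linarith))).and (Filter.eventually_ge_atTop 18)
  obtain ⟨n₀, hn₀⟩ := Filter.eventually_atTop.1 hev
  have hcut : ∀ (n : ℕ) (G : WeightedGraph n), n₀ ≤ n → 1 - 4 * ε < saValue (degree α n) G →
      ∃ x : Fin n → Bool, 9 / 16 ≤ cutValue G x := by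
    intro n G hn hval
    obtain ⟨μ, hμ, hobj⟩ := exists_lt_objective hval
    exact (hn₀ n hn).1.1 G μ hμ hobj.le
  refine ⟨n₀, fun n G hn hval => ?_, ⟨roundProg, ?_⟩, fun n G hn => ?_⟩
  · obtain ⟨x, hx⟩ := hcut n G hn (by linarith)
    exact ⟨x, by linarith⟩
  · exact isPolyTimeRounding_roundProg hε0.le hε1 (hn₀ n₀ le_rfl).2 fun n hn => (hn₀ n hn).1.2
  · have ht : 2 ≤ degree α n := by
      have := (hn₀ n hn).1.2.1
      omega
    refine ⟨maxCut_le_saValue ht G, ?_⟩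
    -- Above `1 - 4ε` rounding yields `9/16`, and the relaxation is at most `1`. Below it, `(1/2 +
    -- ε)(1 - 4ε) ≤ 1/2`, which a greedy cut attains.
    rcases lt_or_ge (1 - 4 * ε) (saValue (degree α n) G) with hval | hval
    · obtain ⟨x, hx⟩ := hcut n G hn hval
      have h1 := saValue_le_one ht G
      have h2 := cutValue_le_maxCut G x
      nlinarith
    · obtain ⟨x, hx⟩ := exists_half_le_cutValue G
      have h2 := cutValue_le_maxCut G x
      nlinarith
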